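/- \textbf{Proposition.} Let $\Delta$ be the category of nonempty finite ordinals $[n]=\{0<1<\dots<n\}$ and monotone maps, let $\Delta_{\mathrm{inert}}\subset\Delta$ be the subcategory with all objects, whose arrows are the inert (distance-preserving) maps, $f(i+1)=f(i)+1$, and let $j\colon\Delta_{\mathrm{inert}}\to\Delta$ be the inclusion. Let $\mathcal S$ be the $\infty$-category of spaces ($\infty$-groupoids, i.e. Kan complexes), and let $j_!$ denote left Kan extension along $j$, left adjoint to the restriction functor $j^*\colon \mathrm{PrSh}(\Delta)\to\mathrm{PrSh}(\Delta_{\mathrm{inert}})$ on presheaves of spaces. View $[n]$ as the linear graph with vertices $0,\dots,n$ and edges $i\to i+1$, and equip $\Delta_{\mathrm{inert}}$ with the Grothendieck topology in which a sieve on $[n]$ is covering if and only if it is jointly surjective on vertices and edges (equivalently, if it contains all the elementary subgraphs of $[n]$, i.e. all inert maps $[0]\to[n]$ and $[1]\to[n]$). A presheaf $A\colon\Delta_{\mathrm{inert}}^{\mathrm{op}}\to\mathcal S$ is a sheaf if for every covering sieve $S$ of every $[n]$ the canonical map $A_n\to\lim_{([m]\to[n])\in S}A_m$ (limit in $\mathcal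 S$) is an equivalence. A simplicial space $X\colon\Delta^{\mathrm{op}}\to\mathcal S$ is Segal if for every $k\ge1$ the canonical map $X_k\to X_1\times_{X_0}\cdots\times_{X_0}X_1$ ($k$ factors, fibre product in $\mathcal S$) is an equivalence. Let $A\colon\Delta_{\mathrm{inert}}^{\mathrm{op}}\to\mathcal S$ be a presheaf of spaces. Then the left Kan extension $j_!(A)\colon\Delta^{\mathrm{op}}\to\mathcal S$ (the free decomposition space on $A$) exists, and: \begin{enumerate} \item $j_!(A)$ is Segal if and only if $A$ is a sheaf; \item $A$ is a sheaf if and only if $j^*j_!(A)\colon\Delta_{\mathrm{inert}}^{\mathrm{op}}\to\mathcal S$ is a sheaf. \end{enumerate} -/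

import Mathlib

open CategoryTheory MonoidalCategory CartesianMonoidalCategory Simplicial Opposite

universe u

noncomputable section

namespace FreeDecomposition

/-! ### Spaces

A space (infinity-groupoid) is a Kan complex. A presheaf of spaces on a small (ordinary) category
`C` is a functor from `Cᵒᵖ` to Kan complexes; equivalences of such presheaves are the natural
transformations that are objectwise homotopy equivalences. Inverting them gives the homotopy
category of the infinity-category of presheaves of spaces on `C`. -/

/-- A map of simplicial sets is a homotopy equivalence if it has a two-sided inverse up to
simplicial homotopy. Between Kan complexes these are the equivalences of spaces. -/
def IsHomotopyEquiv {K L : SSet.{u}} (f : K ⟶ L) : Prop :=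
  ∃ g : L ⟶ K, Nonempty (SSet.Homotopy (f ≫ g) (𝟙 K)) ∧ Nonempty (SSet.Homotopy (g ≫ f) (𝟙 L))

/-- The category of spaces: the full subcategory of simplicial sets on the Kan complexes. -/
abbrev Space : Type (u + 1) :=
  ObjectProperty.FullSubcategory (fun K : SSet.{u} ↦ SSet.KanComplex K)

/-- The underlying simplicial set of a space. -/
abbrev Space.toSSet : Space.{u} ⥤ SSet.{u} := ObjectProperty.ι _

/-- The equivalences of spaces. -/
def spaceEquivalences : MorphismProperty Space.{u} :=
  fun _ _ f ↦ IsHomotopyEquiv (Space.toSSet.map f)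

/-- Presheaves of spaces on a category. -/
abbrev SpacePresheaf (C : Type) [SmallCategory C] := Cᵒᵖ ⥤ Space.{u}

/-- The equivalences of presheaves of spaces: objectwise equivalences of spaces. -/
abbrev presheafEquivalences (C : Type) [SmallCategory C] :
    MorphismProperty (SpacePresheaf.{u} C) :=
  spaceEquivalences.functorCategory Cᵒᵖ

/-- The homotopy category of the infinity-category of presheaves of spaces on `C`. -/
abbrev HoPresheaf (C : Type) [SmallCategory C] := (presheafEquivalences.{u} C).Localization

/-! ### Restriction and homotopy left Kan extension -/

section KanExtension

variable {C D : Type} [SmallCategory C] [SmallCategory D] (j : C ⥤ D)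

/-- Restriction `j^*` of presheaves of spaces along `j : C ⥤ D`. -/
abbrev restriction : SpacePresheaf.{u} D ⥤ SpacePresheaf.{u} C :=
  (Functor.whiskeringLeft _ _ _).obj j.op

theorem restriction_inverts :
    (presheafEquivalences.{u} D).IsInvertedBy
      (restriction.{u} j ⋙ (presheafEquivalences.{u} C).Q) := fun _ _ f hf ↦
  (presheafEquivalences.{u} C).Q_inverts ((restriction j).map f) (fun c ↦ hf (j.op.obj c))

/-- The functor induced by `j^*` on homotopy categories. -/
def hoRestriction : HoPresheaf.{u} D ⥤ HoPresheaf.{u} C :=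
  Localization.Construction.lift (restriction.{u} j ⋙ (presheafEquivalences.{u} C).Q)
    (restriction_inverts j)

/-- `X` is the (homotopy) left Kan extension `j_!(A)` of `A` along `j : C ⥤ D`: in the homotopy
category of presheaves of spaces there is a universal arrow `A ⟶ j^* X`, that is, `X` is the value
at `A` of the left adjoint `j_!` of `j^*`. This determines `X` up to equivalence. -/
def IsHomotopyLeftKanExtension (A : SpacePresheaf.{u} C) (X : SpacePresheaf.{u} D) : Prop :=
  ∃ η : (presheafEquivalences.{u} C).Q.obj A ⟶
      (hoRestriction.{u} j).obj ((presheafEquivalences.{u} D).Q.obj X),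
    Nonempty (Limits.IsInitial (StructuredArrow.mk η))

end KanExtension

/-! ### Homotopy limits and sheaves of spaces -/

theorem stdSimplex_map_id (n : SimplexCategory) :
    SSet.stdSimplex.{u}.map (𝟙 n) = 𝟙 (SSet.stdSimplex.obj n) :=
  CategoryTheory.Functor.map_id SSet.stdSimplex n

theorem stdSimplex_map_comp {m n p : SimplexCategory} (f : m ⟶ n) (g : n ⟶ p) :
    SSet.stdSimplex.{u}.map (f ≫ g) = SSet.stdSimplex.map f ≫ SSet.stdSimplex.map g :=
  CategoryTheory.Functor.map_comp SSet.stdSimplex f g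

theorem yonedaEquiv_symm_map {K : SSet.{u}} {n m : SimplexCategoryᵒᵖ} (f : n ⟶ m) (x : K.obj n) :
    SSet.yonedaEquiv.symm (K.map f x) =
      SSet.stdSimplex.map f.unop ≫ SSet.yonedaEquiv.symm x := by
  exact (SSet.yonedaEquiv_symm_naturality_left f.unop x).symm

theorem yonedaEquiv_symm_map_comp {K L : SSet.{u}} {n m : SimplexCategoryᵒᵖ} (f : n ⟶ m)
    (x : K.obj n) (g : K ⟶ L) :
    SSet.yonedaEquiv.symm (K.map f x) ≫ g =
      SSet.stdSimplex.map f.unop ≫ SSet.yonedaEquiv.symm x ≫ g := by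
  rw [yonedaEquiv_symm_map, Category.assoc]

section HomotopyLimit

variable {I : Type} [SmallCategory I]

/-- The weight `i ↦ N(I / i)` of the Bousfield-Kan homotopy limit. -/
def bousfieldKanWeight (I : Type) [SmallCategory I] : I ⥤ SSet.{u} :=
  Over.mapFunctor I ⋙ nerveFunctor ⋙ SSet.uliftFunctor.{u, 0}

/-- The Bousfield-Kan homotopy limit of a diagram `F` of simplicial sets: its `n`-simplices are the
natural transformations `N(I / -) × Δ[n] ⟶ F`. If all values of `F` are Kan complexes, it is a Kan
complex and a model for the limit of `F` in the infinity-category of spaces. -/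
def homotopyLimit (F : I ⥤ SSet.{u}) : SSet.{u} :=
  (SSet.stdSimplex ⋙ Functor.const I ⋙ tensorLeft (bousfieldKanWeight.{u} I)).op ⋙ yoneda.obj F

/-- The canonical map from the cone point of a (strict) cone to the homotopy limit. -/
def homotopyLimitLift {F : I ⥤ SSet.{u}} (c : Limits.Cone F) : c.pt ⟶ homotopyLimit F where
  app n := ↾fun x ↦
    (snd (bousfieldKanWeight.{u} I) ((Functor.const I).obj (SSet.stdSimplex.obj n.unop)) ≫
      (Functor.const I).map (SSet.yonedaEquiv.symm x) ≫ c.π :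
      bousfieldKanWeight.{u} I ⊗ (Functor.const I).obj (SSet.stdSimplex.obj n.unop) ⟶ F)
  naturality n m f := by
    ext x
    apply NatTrans.ext
    funext i
    change snd _ _ ≫ SSet.yonedaEquiv.symm (c.pt.map f x) ≫ c.π.app i =
      (_ ◁ SSet.stdSimplex.map f.unop) ≫ snd _ _ ≫ SSet.yonedaEquiv.symm x ≫ c.π.app i
    rw [whiskerLeft_snd_assoc, yonedaEquiv_symm_map_comp]

end HomotopyLimit

/-- A presheaf of spaces `A` is a sheaf for the Grothendieck topology `J` if for every covering
sieve `S` of an object `U` the canonical map from `A(U)` to the homotopy limit of the `A(V)`, over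
all `V ⟶ U` in `S`, is an equivalence. -/
def IsSpaceSheaf {C : Type} [SmallCategory C] (J : GrothendieckTopology C)
    (A : SpacePresheaf.{u} C) : Prop :=
  ∀ (U : C) (S : Sieve U), S ∈ J U →
    IsHomotopyEquiv
      (homotopyLimitLift ((A ⋙ Space.toSSet).mapCone S.arrows.cocone.op))

/-! ### The inert subcategory of the simplex category and its topology -/

/-- A map `f : [m] ⟶ [n]` is inert if it preserves distances: `f (i + 1) = f i + 1`. -/
def inert : MorphismProperty SimplexCategory := fun m _ f ↦
  ∀ i : Fin m.len, (f.toOrderHom i.succ : ℕ) = (f.toOrderHom i.castSucc : ℕ) + 1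

instance : inert.IsMultiplicative where
  id_mem _ _ := by simp
  comp_mem {m n p} f g hf hg i := by
    have h := hf i
    have hlt : (f.toOrderHom i.castSucc : ℕ) < n.len := by
      have := (f.toOrderHom i.succ).isLt
      omega
    have h1 : f.toOrderHom i.castSucc = Fin.castSucc ⟨_, hlt⟩ := rfl
    have h2 : f.toOrderHom i.succ = Fin.succ ⟨_, hlt⟩ := Fin.ext h
    change (g.toOrderHom (f.toOrderHom i.succ) : ℕ) = g.toOrderHom (f.toOrderHom i.castSucc) + 1
    rw [h1, h2]
    exact hg ⟨_, hlt⟩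

/-- The category of finite nonempty ordinals and inert maps. -/
abbrev InertCat : Type := WideSubcategory inert

/-- The inclusion of the inert maps in the simplex category. -/
abbrev inertInclusion : InertCat ⥤ SimplexCategory := wideSubcategoryInclusion inert

/-- The vertex `v` of `[n]`, as an inert map `[0] ⟶ [n]`. -/
def vertexMap {U : InertCat} (v : Fin (U.obj.len + 1)) : (⟨⦋0⦌⟩ : InertCat) ⟶ U :=
  ⟨SimplexCategory.const ⦋0⦌ U.obj v, fun i ↦ i.elim0⟩

/-- The edge `e ⟶ e + 1` of `[n]`, as an inert map `[1] ⟶ [n]`. -/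
def edgeMap {U : InertCat} (e : Fin U.obj.len) : (⟨⦋1⦌⟩ : InertCat) ⟶ U :=
  ⟨SimplexCategory.mkOfSucc e, fun i ↦ by
    obtain rfl : i = 0 := Subsingleton.elim (α := Fin 1) _ _
    rfl⟩

theorem exists_edge {U V : InertCat} (f : V ⟶ U) (e : Fin V.obj.len) :
    ∃ e' : Fin U.obj.len, f.hom.toOrderHom e.castSucc = e'.castSucc ∧
      f.hom.toOrderHom e.succ = e'.succ := by
  have h := f.property e
  have hlt : (f.hom.toOrderHom e.castSucc : ℕ) < U.obj.len := by
    have := (f.hom.toOrderHom e.succ).isLt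
    omega
  exact ⟨⟨_, hlt⟩, rfl, Fin.ext h⟩

theorem vertexMap_comp {U V : InertCat} (f : V ⟶ U) (v : Fin (V.obj.len + 1)) :
    vertexMap v ≫ f = vertexMap (f.hom.toOrderHom v) := by
  apply WideSubcategory.hom_ext
  rfl

theorem edgeMap_comp {U V : InertCat} (f : V ⟶ U) (e : Fin V.obj.len) (e' : Fin U.obj.len)
    (h₁ : f.hom.toOrderHom e.castSucc = e'.castSucc) (h₂ : f.hom.toOrderHom e.succ = e'.succ) :
    edgeMap e ≫ f = edgeMap e' := by
  apply WideSubcategory.hom_ext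
  apply SimplexCategory.Hom.ext
  ext (i : Fin 2)
  match i with
  | 0 => exact congrArg Fin.val h₁
  | 1 => exact congrArg Fin.val h₂

/-- A sieve on `[n]`, viewed as the linear graph with vertices `0, …, n` and edges `i ⟶ i + 1`, is
jointly surjective if every vertex and every edge is in the image of some arrow of the sieve. -/
def JointlySurjective {U : InertCat} (S : Sieve U) : Prop :=
  (∀ v : Fin (U.obj.len + 1), ∃ (V : InertCat) (f : V ⟶ U), S f ∧
    ∃ w : Fin (V.obj.len + 1), f.hom.toOrderHom w = v) ∧
  (∀ e : Fin U.obj.len, ∃ (V : InertCat) (f : V ⟶ U), S f ∧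
    ∃ d : Fin V.obj.len, f.hom.toOrderHom d.castSucc = e.castSucc ∧
      f.hom.toOrderHom d.succ = e.succ)

/-- A sieve is jointly surjective if and only if it contains all elementary subgraphs. -/
theorem jointlySurjective_iff {U : InertCat} (S : Sieve U) :
    JointlySurjective S ↔ (∀ v, S (vertexMap v)) ∧ ∀ e, S (edgeMap e) := by
  constructor
  · rintro ⟨hv, he⟩
    refine ⟨fun v ↦ ?_, fun e ↦ ?_⟩
    · obtain ⟨V, f, hf, w, rfl⟩ := hv v
      rw [← vertexMap_comp]
      exact S.downward_closed hf _
    · obtain ⟨V, f, hf, d, h₁, h₂⟩ := he e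
      rw [← edgeMap_comp f d e h₁ h₂]
      exact S.downward_closed hf _
  · rintro ⟨hv, he⟩
    exact ⟨fun v ↦ ⟨_, _, hv v, (0 : Fin 1), rfl⟩, fun e ↦ ⟨_, _, he e, (0 : Fin 1), rfl, rfl⟩⟩

/-- The Grothendieck topology on the inert category whose covering sieves are those that are
jointly surjective on vertices and edges, equivalently those that contain all elementary subgraphs
(the inert maps from `[0]` and `[1]`). -/
def inertTopology : GrothendieckTopology InertCat where
  sieves _ := {S | JointlySurjective S}
  top_mem' U := ⟨fun v ↦ ⟨U, 𝟙 U, trivial, v, rfl⟩, fun e ↦ ⟨U, 𝟙 U, trivial, e, rfl, rfl⟩⟩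
  pullback_stable' U V S f hS := by
    rw [Set.mem_ofPred_eq, jointlySurjective_iff] at hS ⊢
    refine ⟨fun v ↦ ?_, fun e ↦ ?_⟩
    · rw [Sieve.pullback_apply, vertexMap_comp]
      exact hS.1 _
    · obtain ⟨e', h₁, h₂⟩ := exists_edge f e
      rw [Sieve.pullback_apply, edgeMap_comp f e e' h₁ h₂]
      exact hS.2 _
  transitive' U S hS R hR := by
    simp only [Set.mem_ofPred_eq, jointlySurjective_iff] at hS hR ⊢
    refine ⟨fun v ↦ ?_, fun e ↦ ?_⟩
    · have h := (hR (hS.1 v)).1 0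
      rwa [Sieve.pullback_apply, vertexMap_comp] at h
    · have h := (hR (hS.2 e)).2 0
      rwa [Sieve.pullback_apply, edgeMap_comp (edgeMap e) 0 e rfl rfl] at h

/-! ### Segal spaces -/

/-- The homotopy fibre product `X₁ ×_{X₀} ⋯ ×_{X₀} X₁` with `k + 1` factors of a simplicial space
`X`. An `m`-simplex consists of `m`-simplices `e 0, …, e k` of `X₁` and, for each `i < k`, a path
(an `m`-simplex of the path space of `X₀`) from the target of `e i` to the source of `e (i + 1)`. -/
def segalFibreProduct (X : SpacePresheaf.{u} SimplexCategory) (k : ℕ) : SSet.{u} where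
  obj m :=
    { p : (Fin (k + 1) → (SSet.stdSimplex.obj m.unop ⟶ (X.obj (op ⦋1⦌)).obj)) ×
        (Fin k → (SSet.stdSimplex.obj m.unop ⊗ Δ[1] ⟶ (X.obj (op ⦋0⦌)).obj)) //
      ∀ i : Fin k,
        SSet.ι₀ ≫ p.2 i = p.1 i.castSucc ≫ Space.toSSet.map (X.map (SimplexCategory.δ 0).op) ∧
        SSet.ι₁ ≫ p.2 i = p.1 i.succ ≫ Space.toSSet.map (X.map (SimplexCategory.δ 1).op) }
  map f := ↾fun p ↦
    ⟨(fun i ↦ SSet.stdSimplex.map f.unop ≫ p.1.1 i,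
      fun i ↦ SSet.stdSimplex.map f.unop ▷ Δ[1] ≫ p.1.2 i), fun i ↦ by
      have h := p.2 i
      constructor
      · change SSet.stdSimplex.map f.unop ≫ SSet.ι₀ ≫ p.1.2 i = _
        rw [h.1, Category.assoc]
      · change SSet.stdSimplex.map f.unop ≫ SSet.ι₁ ≫ p.1.2 i = _
        rw [h.2, Category.assoc]⟩
  map_id m := by
    ext p : 3
    apply Subtype.ext
    apply Prod.ext
    · funext i
      change SSet.stdSimplex.map (𝟙 _) ≫ p.1.1 i = p.1.1 i
      rw [stdSimplex_map_id, Category.id_comp]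
    · funext i
      change SSet.stdSimplex.map (𝟙 _) ▷ Δ[1] ≫ p.1.2 i = p.1.2 i
      rw [stdSimplex_map_id, id_whiskerRight, Category.id_comp]
  map_comp f g := by
    ext p : 3
    apply Subtype.ext
    apply Prod.ext
    · funext i
      change SSet.stdSimplex.map (g.unop ≫ f.unop) ≫ p.1.1 i =
        SSet.stdSimplex.map g.unop ≫ SSet.stdSimplex.map f.unop ≫ p.1.1 i
      rw [stdSimplex_map_comp, Category.assoc]
    · funext i
      change SSet.stdSimplex.map (g.unop ≫ f.unop) ▷ Δ[1] ≫ p.1.2 i =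
        SSet.stdSimplex.map g.unop ▷ Δ[1] ≫ SSet.stdSimplex.map f.unop ▷ Δ[1] ≫ p.1.2 i
      rw [stdSimplex_map_comp, comp_whiskerRight, Category.assoc]

/-- The Segal map `X_{k+1} ⟶ X₁ ×_{X₀} ⋯ ×_{X₀} X₁` of a simplicial space. It sends `x` to its
`k + 1` principal edges, with constant paths at the `k` inner vertices of `x`. -/
def segalMap (X : SpacePresheaf.{u} SimplexCategory) (k : ℕ) :
    (X.obj (op ⦋k + 1⦌)).obj ⟶ segalFibreProduct X k where
  app m := ↾fun x ↦
    ⟨(fun i ↦ SSet.yonedaEquiv.symm x ≫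
        Space.toSSet.map (X.map (SimplexCategory.mkOfSucc i).op),
      fun i ↦ fst _ _ ≫ SSet.yonedaEquiv.symm x ≫
        Space.toSSet.map (X.map (SimplexCategory.const ⦋0⦌ ⦋k + 1⦌ i.succ.castSucc).op)), fun i ↦ by
      constructor
      · change SSet.yonedaEquiv.symm x ≫ _ = _
        rw [Category.assoc, ← Functor.map_comp, ← Functor.map_comp, ← op_comp,
          SimplexCategory.δ_zero_mkOfSucc]
        rfl
      · change SSet.yonedaEquiv.symm x ≫ _ = _
        rw [Category.assoc, ← Functor.map_comp, ← Functor.map_comp, ← op_comp,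
          SimplexCategory.δ_one_mkOfSucc]⟩
  naturality m n f := by
    ext x
    apply Subtype.ext
    apply Prod.ext
    · funext i
      exact yonedaEquiv_symm_map_comp f x _
    · funext i
      change fst _ _ ≫ SSet.yonedaEquiv.symm ((X.obj (op ⦋k + 1⦌)).obj.map f x) ≫ _ =
        SSet.stdSimplex.map f.unop ▷ Δ[1] ≫ fst _ _ ≫ SSet.yonedaEquiv.symm x ≫ _
      rw [whiskerRight_fst_assoc, yonedaEquiv_symm_map_comp]

/-- A simplicial space is Segal if all its Segal maps are equivalences. (The map for `X₀`, whose
target is the empty fibre product `X₀`, is the identity.) -/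
def IsSegal (X : SpacePresheaf.{u} SimplexCategory) : Prop :=
  ∀ k : ℕ, IsHomotopyEquiv (segalMap X k)

end FreeDecomposition

end

/-!
A map `[m] ⟶ [n]` of the simplex category factors uniquely as an active map (one that preserves the
first and the last element) followed by an inert map. Hence restriction of presheaves of spaces
along the inert maps has a strict left adjoint, `freeObj`: its value on `A` at `[n]` is the disjoint
union of the spaces `A_m`, over all active maps `[n] ⟶ [m]`. As both functors preserve objectwise
homotopy equivalences, the adjunction descends to homotopy categories
(`isHomotopyLeftKanExtension_free`), so `freeObj A` is the homotopy left Kan extension of `A`. Any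
other homotopy left Kan extension is isomorphic to it in the homotopy category.

The sheaf and the Segal conditions are both compared with conditions on concatenations. Write `[n]`
as the concatenation of `[a]` and `[b]` at a common vertex (`IsCut`), and consider the map from
`A_n` to the homotopy pullback of `A_a` and `A_b` over `A_0` (`cutMap`). `CutLocal` asks that it is
an equivalence for all concatenations, `EdgeLocal` for those with `1 ≤ a` and `b = 1`.

* A sheaf is `CutLocal` (`cutLocal_of_isSpaceSheaf`): the two parts of a concatenation generate a
  covering sieve, and the homotopy limit over this sieve is the homotopy pullback.
* An `EdgeLocal` presheaf is a sheaf (`EdgeLocal.isHomotopyEquiv_fromValue`,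
  `EdgeLocal.isSpaceSheaf`), by induction on the length of the covered interval, splitting off its
  last edge.
* A simplicial space is Segal if and only if its restriction is `EdgeLocal`
  (`isSegal_iff_edgeLocal`), as the iterated fibre product with one more factor is a homotopy
  pullback.
* An active map out of a concatenation is a pair of active maps out of the two parts, and it
  decomposes its target as a concatenation. As homotopy pullbacks commute with disjoint unions, the
  comparison map of `freeObj A` at a concatenation is the disjoint union of those of `A` at these
  targets (`isHomotopyEquiv_cutMap_freeObj_iff`). So `freeObj A` is `EdgeLocal` if `A` is
  `CutLocal`, and, by the summand of the identity, `A` is `EdgeLocal` if `freeObj A` is.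

Therefore `A` is a sheaf if and only if the restriction of `freeObj A` is `EdgeLocal`, which means
both that `freeObj A` is Segal and that its restriction is a sheaf. `EdgeLocal` is invariant under
isomorphism in the homotopy category (`isHomotopyEquiv_cutMap_iff_of_iso`), which gives the
statement for all homotopy left Kan extensions.

The category of intervals in `[n]` is thin, so homotopy limits over families of intervals that are
closed under subintervals can be computed as mapping spaces out of weights of chains (`chainMap`),
which are subfunctors of a common weight. These mapping spaces take unions of families to strict
pullbacks along fibrations (`isPullback_chainRes`, `chainRes_fibration`), and are homotopy
equivalent to the value at an interval as soon as that interval is the largest one of the family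
(`isHomotopyEquiv_fromValue`). The fibration property rests on a relative nerve, whose map for an
objectwise trivial fibration is a trivial fibration (`relNerveMap_trivFib`).
-/

open HomotopicalAlgebra

noncomputable section

namespace FreeDecomposition

/-! ### Maps of simplicial sets given by their values on simplices -/

theorem sset_hom_ext {K L : SSet.{u}} {f g : K ⟶ L}
    (h : ∀ (n : SimplexCategory) (x : K.obj (op n)), f.app (op n) x = g.app (op n) x) : f = g := by
  apply NatTrans.ext
  funext n
  ext x
  exact h n.unop x

/-- A simplicial set given by its simplices and the action of the maps of `SimplexCategory`. -/
def mkSSet (obj : SimplexCategory → Type u)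
    (map : ∀ {m n : SimplexCategory}, (m ⟶ n) → obj n → obj m)
    (map_id : ∀ n x, map (𝟙 n) x = x)
    (map_comp : ∀ {l m n : SimplexCategory} (f : l ⟶ m) (g : m ⟶ n) (x : obj n),
      map (f ≫ g) x = map f (map g x)) : SSet.{u} where
  obj n := obj n.unop
  map f := ↾fun x ↦ map f.unop x
  map_id n := by ext x; exact map_id _ x
  map_comp f g := by ext x; exact map_comp _ _ x

/-- A map of simplicial sets given by its values on simplices. -/
def mkHom {K L : SSet.{u}} (f : ∀ n : SimplexCategory, K.obj (op n) → L.obj (op n))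
    (hf : ∀ {m n : SimplexCategory} (g : m ⟶ n) (x : K.obj (op n)),
      f m (K.map g.op x) = L.map g.op (f n x)) : K ⟶ L where
  app n := ↾fun x ↦ f n.unop x
  naturality n m g := by ext x; exact hf g.unop x

theorem sset_map_comp {K : SSet.{u}} {l m n : SimplexCategory} (f : l ⟶ m) (g : m ⟶ n)
    (x : K.obj (op n)) : K.map f.op (K.map g.op x) = K.map (f ≫ g).op x := by
  rw [op_comp, Functor.map_comp]; rfl

theorem sset_map_id {K : SSet.{u}} {n : SimplexCategory}
    (x : K.obj (op n)) : K.map (𝟙 n).op x = x := by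
  exact ConcreteCategory.congr_hom (K.map_id (op n)) x

theorem sset_naturality {K L : SSet.{u}} (f : K ⟶ L) {m n : SimplexCategory} (g : m ⟶ n)
    (x : K.obj (op n)) : f.app (op m) (K.map g.op x) = L.map g.op (f.app (op n) x) :=
  NatTrans.naturality_apply f g.op x

/-- The values of a simplex of `Δ[d]`, seen as a monotone map. -/
def stdVal {d : ℕ} {n : SimplexCategory} (t : (Δ[d] : SSet.{u}).obj (op n)) (a : Fin (n.len + 1)) :
    Fin (d + 1) :=
  (SSet.stdSimplex.objEquiv t).toOrderHom a

theorem stdVal_map {d : ℕ} {m n : SimplexCategory} (f : m ⟶ n) (t : (Δ[d] : SSet.{u}).obj (op n))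
    (a : Fin (m.len + 1)) : stdVal ((Δ[d] : SSet.{u}).map f.op t) a = stdVal t (f.toOrderHom a) :=
  rfl

theorem stdVal_mono {d : ℕ} {n : SimplexCategory} (t : (Δ[d] : SSet.{u}).obj (op n)) :
    Monotone (stdVal t) :=
  (SSet.stdSimplex.objEquiv t).toOrderHom.monotone

theorem stdVal_ext {d : ℕ} {n : SimplexCategory} {t t' : (Δ[d] : SSet.{u}).obj (op n)}
    (h : ∀ a, stdVal t a = stdVal t' a) : t = t' := by
  apply SSet.stdSimplex.objEquiv.injective
  apply SimplexCategory.Hom.ext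
  ext a : 2
  exact h a

/-- A simplex of `Δ[d]` given by a monotone map. -/
def stdMk {d : ℕ} {n : SimplexCategory} (v : Fin (n.len + 1) → Fin (d + 1)) (hv : Monotone v) :
    (Δ[d] : SSet.{u}).obj (op n) :=
  SSet.stdSimplex.objEquiv.symm (SimplexCategory.Hom.mk ⟨v, hv⟩)

/-! ### Homotopies of maps into Kan complexes -/

/-- A homotopy, given by its underlying map. -/
def mkHomotopy {X Y : SSet.{u}} {f g : X ⟶ Y} (h : X ⊗ Δ[1] ⟶ Y) (h₀ : SSet.ι₀ ≫ h = f)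
    (h₁ : SSet.ι₁ ≫ h = g) : SSet.Homotopy f g where
  h := h
  h₀ := h₀
  h₁ := h₁
  rel := by
    apply sset_hom_ext
    rintro n ⟨⟨x, hx⟩, t⟩
    exact hx.elim

/-- Two maps are homotopic if there is a homotopy from the first to the second. -/
def Homotopic {X Y : SSet.{u}} (f g : X ⟶ Y) : Prop := Nonempty (SSet.Homotopy f g)

theorem homotopic_iff {X Y : SSet.{u}} (f g : X ⟶ Y) :
    Homotopic f g ↔ ∃ h : X ⊗ Δ[1] ⟶ Y, SSet.ι₀ ≫ h = f ∧ SSet.ι₁ ≫ h = g :=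
  ⟨fun ⟨H⟩ ↦ ⟨H.h, H.h₀, H.h₁⟩, fun ⟨h, h₀, h₁⟩ ↦ ⟨mkHomotopy h h₀ h₁⟩⟩

theorem Homotopic.refl {X Y : SSet.{u}} (f : X ⟶ Y) : Homotopic f f :=
  (homotopic_iff _ _).2 ⟨fst _ _ ≫ f, by simp, by simp⟩

theorem Homotopic.postcomp {X Y Z : SSet.{u}} {f g : X ⟶ Y} (h : Homotopic f g) (k : Y ⟶ Z) :
    Homotopic (f ≫ k) (g ≫ k) := by
  rw [homotopic_iff] at h ⊢
  obtain ⟨h, rfl, rfl⟩ := h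
  exact ⟨h ≫ k, by simp, by simp⟩

theorem Homotopic.precomp {X Y Z : SSet.{u}} {f g : Y ⟶ Z} (h : Homotopic f g) (k : X ⟶ Y) :
    Homotopic (k ≫ f) (k ≫ g) := by
  rw [homotopic_iff] at h ⊢
  obtain ⟨h, rfl, rfl⟩ := h
  exact ⟨k ▷ _ ≫ h, by simp, by simp⟩

theorem whiskerLeft_δ_one (X : SSet.{u}) :
    X ◁ SSet.stdSimplex.δ (n := 0) 1 = fst _ _ ≫ SSet.ι₀ := by
  apply sset_hom_ext
  rintro n ⟨x, t⟩
  refine Prod.ext rfl (stdVal_ext fun a ↦ ?_)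
  obtain rfl : t = stdMk (fun _ ↦ 0) (fun _ _ _ ↦ le_rfl) :=
    stdVal_ext fun a ↦ Subsingleton.elim (α := Fin 1) _ _
  rfl

theorem whiskerLeft_δ_zero (X : SSet.{u}) :
    X ◁ SSet.stdSimplex.δ (n := 0) 0 = fst _ _ ≫ SSet.ι₁ := by
  apply sset_hom_ext
  rintro n ⟨x, t⟩
  refine Prod.ext rfl (stdVal_ext fun a ↦ ?_)
  obtain rfl : t = stdMk (fun _ ↦ 0) (fun _ _ _ ↦ le_rfl) :=
    stdVal_ext fun a ↦ Subsingleton.elim (α := Fin 1) _ _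
  rfl

/-- The vertex of the mapping space `(ihom X).obj Y` given by a map `X ⟶ Y`. -/
def vert {X Y : SSet.{u}} (f : X ⟶ Y) : Δ[0] ⟶ (ihom X).obj Y :=
  MonoidalClosed.curry (fst X Δ[0] ≫ f)

theorem vert_injective {X Y : SSet.{u}} {f g : X ⟶ Y} (h : vert f = vert g) : f = g := by
  have h' := congrArg (fun k ↦ lift (𝟙 X) (SSet.stdSimplex.isTerminalObj₀.from X) ≫ k)
    (MonoidalClosed.curry_injective h)
  simpa using h'

theorem vert_map {X Y Z : SSet.{u}} (f : X ⟶ Y) (p : Y ⟶ Z) :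
    vert f ≫ (ihom X).map p = vert (f ≫ p) := by
  rw [vert, vert, ← MonoidalClosed.curry_natural_right, Category.assoc]

/-- Two vertices are joined by an edge. -/
def Joined {P : SSet.{u}} (x y : Δ[0] ⟶ P) : Prop :=
  ∃ e : Δ[1] ⟶ P, SSet.stdSimplex.δ 1 ≫ e = x ∧ SSet.stdSimplex.δ 0 ≫ e = y

/-- A map `X ⊗ Δ[1] ⟶ Y` is an edge of the mapping space, whose ends are those of the homotopy. -/
theorem joined_vert_iff {X Y : SSet.{u}} (h : X ⊗ Δ[1] ⟶ Y) (f g : X ⟶ Y) :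
    (SSet.stdSimplex.δ 1 ≫ MonoidalClosed.curry h = vert f ↔ SSet.ι₀ ≫ h = f) ∧
    (SSet.stdSimplex.δ 0 ≫ MonoidalClosed.curry h = vert g ↔ SSet.ι₁ ≫ h = g) := by
  rw [← MonoidalClosed.curry_natural_left, ← MonoidalClosed.curry_natural_left,
    whiskerLeft_δ_one, whiskerLeft_δ_zero, Category.assoc, Category.assoc]
  exact ⟨⟨vert_injective, fun h ↦ by rw [h]; rfl⟩, ⟨vert_injective, fun h ↦ by rw [h]; rfl⟩⟩

theorem homotopic_iff_joined {X Y : SSet.{u}} (f g : X ⟶ Y) :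
    Homotopic f g ↔ Joined (vert f) (vert g) := by
  rw [homotopic_iff]
  constructor
  · rintro ⟨h, h₀, h₁⟩
    exact ⟨MonoidalClosed.curry h, (joined_vert_iff h f g).1.2 h₀, (joined_vert_iff h f g).2.2 h₁⟩
  · rintro ⟨e, h₀, h₁⟩
    obtain ⟨h, rfl⟩ : ∃ h, MonoidalClosed.curry h = e :=
      ⟨MonoidalClosed.uncurry e, MonoidalClosed.curry_uncurry e⟩
    exact ⟨h, (joined_vert_iff h f g).1.1 h₀, (joined_vert_iff h f g).2.1 h₁⟩

section Horn

open SSet modelCategoryQuillen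

theorem vertex_zero : (stdSimplex.δ 1 : (Δ[0] : SSet.{u}) ⟶ Δ[1]) ≫ stdSimplex.δ 2 =
    stdSimplex.δ 1 ≫ stdSimplex.δ 1 :=
  CosimplicialObject.δ_comp_δ stdSimplex (n := 0) (i := 1) (j := 1) le_rfl

theorem vertex_one : (stdSimplex.δ 0 : (Δ[0] : SSet.{u}) ⟶ Δ[1]) ≫ stdSimplex.δ 2 =
    stdSimplex.δ 1 ≫ stdSimplex.δ 0 :=
  CosimplicialObject.δ_comp_δ stdSimplex (n := 0) (i := 0) (j := 1) (by simp)

theorem vertex_two : (stdSimplex.δ 0 : (Δ[0] : SSet.{u}) ⟶ Δ[1]) ≫ stdSimplex.δ 1 =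
    stdSimplex.δ 0 ≫ stdSimplex.δ 0 :=
  CosimplicialObject.δ_comp_δ stdSimplex (n := 0) (i := 0) (j := 0) le_rfl

theorem δ_σ_zero (i : Fin 2) : (stdSimplex.δ i : (Δ[0] : SSet.{u}) ⟶ Δ[1]) ≫ stdSimplex.σ 0 = 𝟙 _ :=
  stdSimplex.ext₀

theorem δ_two_σ_zero : (stdSimplex.δ 2 : (Δ[1] : SSet.{u}) ⟶ Δ[2]) ≫ stdSimplex.σ 0 =
    stdSimplex.σ 0 ≫ stdSimplex.δ 1 :=
  CosimplicialObject.δ_comp_σ_of_gt stdSimplex (n := 0) (i := 1) (j := 0) (by simp)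

theorem δ_zero_σ_zero : (stdSimplex.δ 0 : (Δ[1] : SSet.{u}) ⟶ Δ[2]) ≫ stdSimplex.σ 0 = 𝟙 _ :=
  CosimplicialObject.δ_comp_σ_self stdSimplex (n := 1) (i := 0)

theorem δ_one_σ_zero : (stdSimplex.δ 1 : (Δ[1] : SSet.{u}) ⟶ Δ[2]) ≫ stdSimplex.σ 0 = 𝟙 _ :=
  CosimplicialObject.δ_comp_σ_succ stdSimplex (n := 1) (i := 0)

/-- A Kan fibration lifts 2-simplices along horns, whose faces are given as edges. -/
theorem exists_triangle_lift {P Q : SSet.{u}} (p : P ⟶ Q) [Fibration p] (i : Fin 3)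
    (e : Fin 3 → (Δ[1] ⟶ P))
    (b : Δ[2] ⟶ Q) (hb : ∀ j, j ≠ i → e j ≫ p = stdSimplex.δ j ≫ b)
    (h01 : 0 ≠ i → 1 ≠ i → stdSimplex.δ (n := 0) 0 ≫ e 0 = stdSimplex.δ 0 ≫ e 1)
    (h02 : 0 ≠ i → 2 ≠ i → stdSimplex.δ (n := 0) 1 ≫ e 0 = stdSimplex.δ 0 ≫ e 2)
    (h12 : 1 ≠ i → 2 ≠ i → stdSimplex.δ (n := 0) 1 ≫ e 1 = stdSimplex.δ 1 ≫ e 2) :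
    ∃ φ : Δ[2] ⟶ P, (∀ j, j ≠ i → stdSimplex.δ j ≫ φ = e j) ∧ φ ≫ p = b := by
  refine horn.IsCompatible.exists_lift (n := 1) (i := i) (f := fun j _ ↦ e j) ?_ p b hb
  rw [horn.isCompatible_iff]
  intro j k hj hk hjk
  fin_cases j <;> fin_cases k <;> first | (exfalso; revert hjk; decide) | skip
  · exact h01 hj hk
  · exact h02 hj hk
  · exact h12 hj hk

theorem exists_triangle {P : SSet.{u}} [KanComplex P] (i : Fin 3) (e : Fin 3 → (Δ[1] ⟶ P))
    (h01 : 0 ≠ i → 1 ≠ i → stdSimplex.δ (n := 0) 0 ≫ e 0 = stdSimplex.δ 0 ≫ e 1)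
    (h02 : 0 ≠ i → 2 ≠ i → stdSimplex.δ (n := 0) 1 ≫ e 0 = stdSimplex.δ 0 ≫ e 2)
    (h12 : 1 ≠ i → 2 ≠ i → stdSimplex.δ (n := 0) 1 ≫ e 1 = stdSimplex.δ 1 ≫ e 2) :
    ∃ φ : Δ[2] ⟶ P, ∀ j, j ≠ i → stdSimplex.δ j ≫ φ = e j := by
  obtain ⟨φ, hφ, -⟩ := exists_triangle_lift (Limits.terminal.from P) i e (Limits.terminal.from _)
    (fun _ _ ↦ Subsingleton.elim _ _) h01 h02 h12
  exact ⟨φ, hφ⟩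

/-- A Kan fibration lifts edges with one prescribed end. -/
theorem exists_edge_lift {P Q : SSet.{u}} (p : P ⟶ Q) [Fibration p] (i j : Fin 2) (hij : j ≠ i)
    (x : Δ[0] ⟶ P) (b : Δ[1] ⟶ Q) (hb : x ≫ p = stdSimplex.δ j ≫ b) :
    ∃ φ : Δ[1] ⟶ P, stdSimplex.δ j ≫ φ = x ∧ φ ≫ p = b := by
  have hj (k : Fin 2) (hk : k ≠ i) : k = j := by omega
  obtain ⟨φ, h, h'⟩ := horn.IsCompatible.exists_lift (n := 0) (i := i) (f := fun _ _ ↦ x)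
    trivial p b (fun k hk ↦ by rw [hj k hk]; exact hb)
  exact ⟨φ, h j hij, h'⟩

theorem Joined.symm {P : SSet.{u}} [KanComplex P] {x y : Δ[0] ⟶ P} (h : Joined x y) :
    Joined y x := by
  obtain ⟨e, rfl, rfl⟩ := h
  obtain ⟨φ, hφ⟩ := exists_triangle (P := P) 0
    ![e, stdSimplex.σ 0 ≫ stdSimplex.δ 1 ≫ e, e] (by simp) (by simp) (fun _ _ ↦ by
      change stdSimplex.δ 1 ≫ stdSimplex.σ 0 ≫ stdSimplex.δ 1 ≫ e = stdSimplex.δ 1 ≫ e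
      rw [← Category.assoc, δ_σ_zero, Category.id_comp])
  have h1 : stdSimplex.δ 1 ≫ φ = stdSimplex.σ 0 ≫ stdSimplex.δ 1 ≫ e := hφ 1 (by simp)
  have h2 : stdSimplex.δ 2 ≫ φ = e := hφ 2 (by simp)
  refine ⟨stdSimplex.δ 0 ≫ φ, ?_, ?_⟩
  · rw [← Category.assoc, ← vertex_one, Category.assoc, h2]
  · rw [← Category.assoc, ← vertex_two, Category.assoc, h1, ← Category.assoc, δ_σ_zero,
      Category.id_comp]

theorem Joined.trans {P : SSet.{u}} [KanComplex P] {x y z : Δ[0] ⟶ P} (h : Joined x y)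
    (h' : Joined y z) : Joined x z := by
  obtain ⟨e, rfl, rfl⟩ := h
  obtain ⟨e', h₀, rfl⟩ := h'
  obtain ⟨φ, hφ⟩ := exists_triangle (P := P) 1 ![e', e, e] (by simp) (fun _ _ ↦ h₀) (by simp)
  have h0 : stdSimplex.δ 0 ≫ φ = e' := hφ 0 (by simp)
  have h2 : stdSimplex.δ 2 ≫ φ = e := hφ 2 (by simp)
  refine ⟨stdSimplex.δ 1 ≫ φ, ?_, ?_⟩
  · rw [← Category.assoc, ← vertex_zero, Category.assoc, h2]
  · rw [← Category.assoc, vertex_two, Category.assoc, h0]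

theorem Homotopic.symm {X Y : SSet.{u}} [KanComplex Y] {f g : X ⟶ Y} (h : Homotopic f g) :
    Homotopic g f := by
  rw [homotopic_iff_joined] at h ⊢
  exact h.symm

theorem Homotopic.trans {X Y : SSet.{u}} [KanComplex Y] {f g h : X ⟶ Y} (H : Homotopic f g)
    (H' : Homotopic g h) : Homotopic f h := by
  rw [homotopic_iff_joined] at H H' ⊢
  exact H.trans H'

end Horn

/-! ### The homotopy category of spaces -/

/-- The homotopy relation between maps of spaces. -/
def spaceHomotopic : HomRel Space.{u} := fun _ _ f g ↦ Homotopic f.hom g.hom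

instance (X : Space.{u}) : SSet.KanComplex X.obj := X.property

instance : Congruence spaceHomotopic.{u} where
  equivalence := ⟨fun _ ↦ Homotopic.refl _, fun h ↦ Homotopic.symm h,
    fun h h' ↦ Homotopic.trans h h'⟩
  comp_left f _ _ h := Homotopic.precomp h f.hom
  comp_right f h := Homotopic.postcomp h f.hom

/-- The homotopy category of spaces: homotopy classes of maps between Kan complexes. -/
abbrev HoSpace : Type (u + 1) := Quotient spaceHomotopic.{u}

/-- The functor from spaces to their homotopy category. -/
abbrev toHo : Space.{u} ⥤ HoSpace.{u} := Quotient.functor _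

theorem toHo_map_eq_iff {X Y : Space.{u}} (f g : X ⟶ Y) :
    toHo.map f = toHo.map g ↔ Homotopic f.hom g.hom :=
  Quotient.functor_map_eq_iff _ f g

theorem isIso_toHo_map_iff {X Y : Space.{u}} (f : X ⟶ Y) :
    IsIso (toHo.map f) ↔ IsHomotopyEquiv f.hom := by
  constructor
  · intro h
    obtain ⟨g, hg⟩ := toHo.map_surjective (inv (toHo.map f))
    have h₁ : toHo.map (f ≫ g) = toHo.map (𝟙 X) := by simp [hg]
    have h₂ : toHo.map (g ≫ f) = toHo.map (𝟙 Y) := by simp [hg]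
    rw [toHo_map_eq_iff] at h₁ h₂
    exact ⟨g.hom, h₁, h₂⟩
  · rintro ⟨g, h₁, h₂⟩
    refine ⟨toHo.map ⟨g⟩, ?_, ?_⟩
    · rw [← Functor.map_comp, ← CategoryTheory.Functor.map_id, toHo_map_eq_iff]
      exact h₁
    · rw [← Functor.map_comp, ← CategoryTheory.Functor.map_id, toHo_map_eq_iff]
      exact h₂

section Equivalences

open SSet

variable {K L M N : SSet.{u}} [KanComplex K] [KanComplex L] [KanComplex M] [KanComplex N]

/-- The homotopy class of a map between Kan complexes. -/
abbrev hoMap (f : K ⟶ L) : toHo.obj (⟨K, ‹_›⟩ : Space.{u}) ⟶ toHo.obj (⟨L, ‹_›⟩ : Space.{u}) :=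
  toHo.map (ObjectProperty.homMk f)

theorem isHomotopyEquiv_iff (f : K ⟶ L) : IsHomotopyEquiv f ↔ IsIso (hoMap f) :=
  (isIso_toHo_map_iff (X := ⟨K, ‹_›⟩) (Y := ⟨L, ‹_›⟩) (ObjectProperty.homMk f)).symm

theorem hoMap_comp (f : K ⟶ L) (g : L ⟶ M) : hoMap (f ≫ g) = hoMap f ≫ hoMap g :=
  toHo.map_comp (X := ⟨K, ‹_›⟩) (Y := ⟨L, ‹_›⟩) (Z := ⟨M, ‹_›⟩) (ObjectProperty.homMk f)
    (ObjectProperty.homMk g)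

theorem isHomotopyEquiv_comp {f : K ⟶ L} {g : L ⟶ M} (hf : IsHomotopyEquiv f)
    (hg : IsHomotopyEquiv g) : IsHomotopyEquiv (f ≫ g) := by
  rw [isHomotopyEquiv_iff] at *
  rw [hoMap_comp]
  infer_instance

theorem isHomotopyEquiv_comp_iff_left {f : K ⟶ L} {g : L ⟶ M} (hf : IsHomotopyEquiv f) :
    IsHomotopyEquiv (f ≫ g) ↔ IsHomotopyEquiv g := by
  rw [isHomotopyEquiv_iff] at *
  rw [isHomotopyEquiv_iff, hoMap_comp]
  exact isIso_comp_left_iff _ _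

theorem isHomotopyEquiv_comp_iff_right {f : K ⟶ L} {g : L ⟶ M} (hg : IsHomotopyEquiv g) :
    IsHomotopyEquiv (f ≫ g) ↔ IsHomotopyEquiv f := by
  rw [isHomotopyEquiv_iff] at *
  rw [isHomotopyEquiv_iff, hoMap_comp]
  exact isIso_comp_right_iff _ _

end Equivalences

theorem isHomotopyEquiv_of_isIso {K L : SSet.{u}} (f : K ⟶ L) [IsIso f] : IsHomotopyEquiv f :=
  ⟨inv f, by rw [IsIso.hom_inv_id]; exact Homotopic.refl _,
    by rw [IsIso.inv_hom_id]; exact Homotopic.refl _⟩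

/-- In contrast to `isHomotopyEquiv_comp_iff_right`, no Kan condition is needed. -/
theorem isHomotopyEquiv_comp_isIso_iff {K L M : SSet.{u}} (f : K ⟶ L) (g : L ⟶ M) [IsIso g] :
    IsHomotopyEquiv (f ≫ g) ↔ IsHomotopyEquiv f := by
  constructor
  · rintro ⟨h, h₁, h₂⟩
    refine ⟨g ≫ h, by rwa [Category.assoc] at h₁, ?_⟩
    have := Homotopic.precomp (Homotopic.postcomp h₂ (inv g)) g
    simp only [Category.assoc, Category.id_comp, Category.comp_id, IsIso.hom_inv_id] at this ⊢
    exact this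
  · rintro ⟨h, h₁, h₂⟩
    refine ⟨inv g ≫ h, by simpa using h₁, ?_⟩
    have := Homotopic.precomp (Homotopic.postcomp h₂ g) (inv g)
    simp only [Category.assoc, Category.id_comp, IsIso.inv_hom_id] at this ⊢
    exact this

/-! ### Trivial fibrations -/

section TrivialFibration

open SSet modelCategoryQuillen

/-- A trivial fibration: a map with the right lifting property against all monomorphisms. -/
def TrivFib {K L : SSet.{u}} (p : K ⟶ L) : Prop := (MorphismProperty.monomorphisms SSet.{u}).rlp p

theorem TrivFib.hasLift {K L : SSet.{u}} {p : K ⟶ L} (hp : TrivFib p) {A B : SSet.{u}} (i : A ⟶ B)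
    [Mono i] : HasLiftingProperty i p :=
  hp i inferInstance

theorem TrivFib.exists_lift {K L : SSet.{u}} {p : K ⟶ L} (hp : TrivFib p) {A B : SSet.{u}}
    (i : A ⟶ B) [Mono i] (f : A ⟶ K) (g : B ⟶ L) (w : f ≫ p = i ≫ g) :
    ∃ l : B ⟶ K, i ≫ l = f ∧ l ≫ p = g := by
  have := hp.hasLift i
  have sq : CommSq f i p g := ⟨w⟩
  exact ⟨sq.lift, sq.fac_left, sq.fac_right⟩

/-- It suffices to lift against the inclusions of boundaries of simplices. -/
theorem trivFib_of_boundary {K L : SSet.{u}} {p : K ⟶ L}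
    (h : ∀ (n : ℕ) (f : (∂Δ[n] : SSet.{u}) ⟶ K) (g : Δ[n] ⟶ L), f ≫ p = ∂Δ[n].ι ≫ g →
      ∃ l : Δ[n] ⟶ K, ∂Δ[n].ι ≫ l = f ∧ l ≫ p = g) : TrivFib p := by
  rw [TrivFib, rlp_monomorphisms]
  rintro _ _ _ ⟨n⟩
  refine ⟨fun {f g} sq ↦ ?_⟩
  obtain ⟨l, h₁, h₂⟩ := h n f g sq.w
  exact ⟨⟨⟨l, h₁, h₂⟩⟩⟩

/-- A simplex of `∂Δ[1]` is constant. -/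
theorem stdVal_eq_of_mem_boundary {n : SimplexCategory} {t : (Δ[1] : SSet.{u}).obj (op n)}
    (ht : t ∈ (∂Δ[1] : (Δ[1] : SSet.{u}).Subcomplex).obj (op n)) (a b : Fin (n.len + 1)) :
    stdVal t a = stdVal t b := by
  by_contra hab
  refine ht fun c ↦ ?_
  change ∃ a, stdVal t a = c
  by_cases h : stdVal t a = c
  · exact ⟨a, h⟩
  · exact ⟨b, by omega⟩

/-- The map `X ⊗ ∂Δ[1] ⟶ Y` given by two maps `X ⟶ Y`. -/
def endsDesc {X Y : SSet.{u}} (f g : X ⟶ Y) : X ⊗ (∂Δ[1] : SSet.{u}) ⟶ Y :=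
  mkHom (fun n p ↦ if stdVal p.2.1 0 = 0 then f.app _ p.1 else g.app _ p.1) (by
    rintro m n k ⟨x, t, ht⟩
    have : stdVal ((Δ[1] : SSet.{u}).map k.op t) 0 = stdVal t 0 := by
      rw [stdVal_map]
      exact stdVal_eq_of_mem_boundary ht _ _
    change (if stdVal ((Δ[1] : SSet.{u}).map k.op t) 0 = 0 then f.app _ (X.map k.op x)
      else g.app _ (X.map k.op x)) = Y.map k.op (if stdVal t 0 = 0 then f.app _ x else g.app _ x)
    rw [this]
    split_ifs
    · exact sset_naturality _ _ _
    · exact sset_naturality _ _ _)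

theorem eq_endsDesc {X Y : SSet.{u}} (h : X ⊗ Δ[1] ⟶ Y) :
    X ◁ ∂Δ[1].ι ≫ h = endsDesc (ι₀ ≫ h) (ι₁ ≫ h) := by
  apply sset_hom_ext
  rintro n ⟨x, t, ht⟩
  have hc := stdVal_eq_of_mem_boundary ht
  change h.app _ (x, t) = if stdVal t 0 = 0 then h.app _ (x, _) else h.app _ (x, _)
  split_ifs with h0
  · congr 2
    exact stdVal_ext fun a ↦ (hc a 0).trans h0
  · congr 2
    exact stdVal_ext fun a ↦ (hc a 0).trans (Fin.eq_one_of_ne_zero _ h0)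

theorem endsDesc_injective {X Y : SSet.{u}} {f g f' g' : X ⟶ Y}
    (h : endsDesc f g = endsDesc f' g') : f = f' ∧ g = g' := by
  have key (n : SimplexCategory) (x : X.obj (op n)) (i : Fin 2) :
      (if i = 0 then f.app _ x else g.app _ x) = if i = 0 then f'.app _ x else g'.app _ x := by
    have ht : stdMk (fun _ : Fin (n.len + 1) ↦ i) (fun _ _ _ ↦ le_rfl) ∈
        (∂Δ[1] : (Δ[1] : SSet.{u}).Subcomplex).obj (op n) := by
      intro hs
      obtain ⟨a, ha⟩ := hs (1 - i)
      change i = 1 - i at ha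
      omega
    exact congrArg (fun k ↦ k.app (op n) (x, ⟨_, ht⟩)) h
  exact ⟨sset_hom_ext fun n x ↦ by simpa using key n x 0,
    sset_hom_ext fun n x ↦ by simpa using key n x 1⟩

theorem endsDesc_comp {X Y Z : SSet.{u}} (f g : X ⟶ Y) (k : Y ⟶ Z) :
    endsDesc f g ≫ k = endsDesc (f ≫ k) (g ≫ k) := by
  apply sset_hom_ext
  rintro n ⟨x, t, ht⟩
  change k.app _ (if stdVal t 0 = 0 then f.app _ x else g.app _ x) =
    if stdVal t 0 = 0 then k.app _ (f.app _ x) else k.app _ (g.app _ x)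
  split_ifs <;> rfl

theorem comp_endsDesc {X Y Z : SSet.{u}} (k : Z ⟶ X) (f g : X ⟶ Y) :
    k ▷ _ ≫ endsDesc f g = endsDesc (k ≫ f) (k ≫ g) := rfl

instance whiskerLeft_mono {A B : SSet.{u}} (X : SSet.{u}) (i : A ⟶ B) [Mono i] : Mono (X ◁ i) := by
  rw [NatTrans.mono_iff_mono_app]
  intro n
  rw [mono_iff_injective]
  rintro ⟨x, a⟩ ⟨y, b⟩ h
  have hi := (mono_iff_injective _).1 ((NatTrans.mono_iff_mono_app i).1 inferInstance n)
  exact Prod.ext (Prod.ext_iff.1 h).1 (hi (Prod.ext_iff.1 h).2)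

instance whiskerRight_mono {A B : SSet.{u}} (X : SSet.{u}) (i : A ⟶ B) [Mono i] : Mono (i ▷ X) := by
  rw [NatTrans.mono_iff_mono_app]
  intro n
  rw [mono_iff_injective]
  rintro ⟨x, a⟩ ⟨y, b⟩ h
  have hi := (mono_iff_injective _).1 ((NatTrans.mono_iff_mono_app i).1 inferInstance n)
  exact Prod.ext (hi (Prod.ext_iff.1 h).1) (Prod.ext_iff.1 h).2

theorem TrivFib.isHomotopyEquiv {K L : SSet.{u}} {p : K ⟶ L} (hp : TrivFib p) :
    IsHomotopyEquiv p := by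
  obtain ⟨s, -, hs⟩ := hp.exists_lift (Limits.initial.to L) (Limits.initial.to K) (𝟙 L)
    (Subsingleton.elim _ _)
  obtain ⟨h, h₁, -⟩ := hp.exists_lift (K ◁ ∂Δ[1].ι) (endsDesc (p ≫ s) (𝟙 K)) (fst _ _ ≫ p) (by
    rw [eq_endsDesc, endsDesc_comp]
    simp [hs])
  rw [eq_endsDesc] at h₁
  obtain ⟨h₀, h₁⟩ := endsDesc_injective h₁
  exact ⟨s, (homotopic_iff _ _).2 ⟨h, h₀, h₁⟩, by rw [hs]; exact Homotopic.refl _⟩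

theorem exists_homotopy_lift {X E B : SSet.{u}} (p : E ⟶ B) [Fibration p] (f : X ⟶ E)
    (h : X ⊗ Δ[1] ⟶ B) (h₀ : ι₀ ≫ h = f ≫ p) :
    ∃ H : X ⊗ Δ[1] ⟶ E, ι₀ ≫ H = f ∧ H ≫ p = h := by
  obtain ⟨e, he, he'⟩ := exists_edge_lift ((ihom X).map p) 0 1 (by simp) (vert f)
    (MonoidalClosed.curry h) (by rw [vert_map, ((joined_vert_iff h (f ≫ p) (f ≫ p)).1.2 h₀)])
  obtain ⟨H, rfl⟩ : ∃ h, MonoidalClosed.curry h = e :=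
    ⟨MonoidalClosed.uncurry e, MonoidalClosed.curry_uncurry e⟩
  refine ⟨H, (joined_vert_iff H f f).1.1 he, ?_⟩
  rw [← MonoidalClosed.curry_natural_right] at he'
  exact MonoidalClosed.curry_injective he'

/-- A fibration between Kan complexes that is a homotopy equivalence has a section that is
homotopic to the identity over the base. -/
theorem exists_vertical_homotopy {E B : SSet.{u}} [KanComplex E] [KanComplex B] (p : E ⟶ B)
    [Fibration p] (hp : IsHomotopyEquiv p) :
    ∃ (s : B ⟶ E) (V : E ⊗ Δ[1] ⟶ E), s ≫ p = 𝟙 B ∧ ι₀ ≫ V = 𝟙 E ∧ ι₁ ≫ V = p ≫ s ∧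
      V ≫ p = fst _ _ ≫ p := by
  obtain ⟨g, hg₁, hg₂⟩ := hp
  obtain ⟨h, h₀, h₁⟩ := (homotopic_iff _ _).1 hg₂
  obtain ⟨G, G₀, hG⟩ := exists_homotopy_lift p g h h₀
  obtain ⟨s, hs⟩ : ∃ s, s = ι₁ ≫ G := ⟨_, rfl⟩
  have hsp : s ≫ p = 𝟙 B := by rw [hs, Category.assoc, hG, h₁]
  have hgs : Homotopic g s := (homotopic_iff _ _).2 ⟨G, G₀, hs.symm⟩
  obtain ⟨H, H₀, H₁⟩ := (homotopic_iff _ _).1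
    (((hgs.precomp p).symm.trans hg₁).symm : Homotopic (𝟙 E) (p ≫ s))
  -- `H` and its image under `p ≫ s` lie over the same homotopy, and share their end
  have e₀ := joined_vert_iff H (𝟙 E) (p ≫ s)
  have e₁ := joined_vert_iff (H ≫ p ≫ s) (p ≫ s) (p ≫ s)
  have hps : p ≫ s ≫ p = p := by rw [hsp, Category.comp_id]
  obtain ⟨φ, hφ, hφ'⟩ := exists_triangle_lift ((ihom E).map p) 2
    ![MonoidalClosed.curry (H ≫ p ≫ s), MonoidalClosed.curry H, MonoidalClosed.curry H]
    (stdSimplex.σ 0 ≫ MonoidalClosed.curry (H ≫ p)) (by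
      intro j hj
      fin_cases j
      · change MonoidalClosed.curry (H ≫ p ≫ s) ≫ _ = stdSimplex.δ 0 ≫ _
        rw [← MonoidalClosed.curry_natural_right, ← Category.assoc (stdSimplex.δ 0), δ_zero_σ_zero,
          Category.id_comp, Category.assoc, Category.assoc, hsp, Category.comp_id]
      · change MonoidalClosed.curry H ≫ _ = stdSimplex.δ 1 ≫ _
        rw [← MonoidalClosed.curry_natural_right, ← Category.assoc (stdSimplex.δ 1), δ_one_σ_zero,
          Category.id_comp]
      · exact absurd rfl hj) (fun _ _ ↦ by
        change stdSimplex.δ 0 ≫ MonoidalClosed.curry (H ≫ p ≫ s) =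
          stdSimplex.δ 0 ≫ MonoidalClosed.curry H
        rw [e₁.2.2 (by rw [← Category.assoc, H₁, Category.assoc, reassoc_of% hps]), e₀.2.2 H₁])
    (by simp) (by simp)
  have f0 : stdSimplex.δ 0 ≫ φ = MonoidalClosed.curry (H ≫ p ≫ s) := hφ 0 (by simp)
  have f1 : stdSimplex.δ 1 ≫ φ = MonoidalClosed.curry H := hφ 1 (by simp)
  obtain ⟨V, hV⟩ : ∃ V, MonoidalClosed.curry V = stdSimplex.δ 2 ≫ φ :=
    ⟨MonoidalClosed.uncurry _, MonoidalClosed.curry_uncurry _⟩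
  have e₂ := joined_vert_iff V (𝟙 E) (p ≫ s)
  refine ⟨s, V, hsp, e₂.1.1 ?_, e₂.2.1 ?_, ?_⟩
  · rw [hV, ← Category.assoc, vertex_zero, Category.assoc, f1, e₀.1.2 H₀]
  · rw [hV, ← Category.assoc, vertex_one, Category.assoc, f0, e₁.1.2 (by rw [← Category.assoc, H₀,
      Category.id_comp])]
  · apply MonoidalClosed.curry_injective
    rw [MonoidalClosed.curry_natural_right, hV, Category.assoc, hφ', ← Category.assoc,
      δ_two_σ_zero, Category.assoc, (joined_vert_iff (H ≫ p) p p).1.2 (by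
        rw [← Category.assoc, H₀, Category.id_comp]), vert, ← MonoidalClosed.curry_natural_left,
      whiskerLeft_fst_assoc]

/-- Relative homotopy lifting: an edge of the mapping space out of `K` can be lifted along a
fibration, with prescribed end and prescribed restriction to a subobject `A`, because the
pullback-hom of a monomorphism and a fibration is a fibration. -/
theorem exists_edge_lift_ihom {A K E B : SSet.{u}} (i : A ⟶ K) [Mono i] (p : E ⟶ B) [Fibration p]
    (x : Δ[0] ⟶ (ihom K).obj E) (e₁ : Δ[1] ⟶ (ihom A).obj E) (e₂ : Δ[1] ⟶ (ihom K).obj B)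
    (w : e₁ ≫ (ihom A).map p = e₂ ≫ (MonoidalClosed.pre i).app B)
    (h₁ : x ≫ (MonoidalClosed.pre i).app E = stdSimplex.δ 0 ≫ e₁)
    (h₂ : x ≫ (ihom K).map p = stdSimplex.δ 0 ≫ e₂) :
    ∃ φ : Δ[1] ⟶ (ihom K).obj E, stdSimplex.δ 0 ≫ φ = x ∧
      φ ≫ (MonoidalClosed.pre i).app E = e₁ ∧ φ ≫ (ihom K).map p = e₂ := by
  have hP := IsPullback.of_hasPullback ((ihom A).map p) ((MonoidalClosed.pre i).app B)
  have hc : (MonoidalClosed.pre i).app E ≫ (ihom A).map p =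
      (ihom K).map p ≫ (MonoidalClosed.pre i).app B := by simp
  have : Fibration (hP.lift _ _ hc) :=
    fibration_pullbackObjObjπ (i := i) (p := p)
      ⟨_, _, _, hP, hP.lift _ _ hc, hP.lift_fst _ _ hc, hP.lift_snd _ _ hc⟩
  obtain ⟨φ, hφ, hφ'⟩ := exists_edge_lift (hP.lift _ _ hc) 1 0 (by simp) x (hP.lift e₁ e₂ w) (by
    apply hP.hom_ext
    · rw [Category.assoc, Category.assoc, hP.lift_fst, hP.lift_fst, h₁]
    · rw [Category.assoc, Category.assoc, hP.lift_snd, hP.lift_snd, h₂])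
  refine ⟨φ, hφ, ?_, ?_⟩
  · rw [← hP.lift_fst _ _ hc, ← Category.assoc, hφ', hP.lift_fst]
  · rw [← hP.lift_snd _ _ hc, ← Category.assoc, hφ', hP.lift_snd]

/-- A fibration between Kan complexes that is a homotopy equivalence is a trivial fibration: a
solution of the lifting problem up to a homotopy over the base is given by the section, and it is
corrected by relative homotopy lifting. -/
theorem trivFib_of_fibration {E B : SSet.{u}} [KanComplex E] [KanComplex B] (p : E ⟶ B)
    [Fibration p] (hp : IsHomotopyEquiv p) : TrivFib p := by
  obtain ⟨s, V, hs, V₀, V₁, hV⟩ := exists_vertical_homotopy p hp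
  intro A K i (hi : Mono i)
  refine ⟨fun {a k} sq ↦ ?_⟩
  obtain ⟨e, he, h₁, h₂⟩ := exists_edge_lift_ihom i p (vert (k ≫ s))
    (MonoidalClosed.curry (a ▷ _ ≫ V)) (MonoidalClosed.curry (fst _ _ ≫ k)) (by
      rw [← MonoidalClosed.curry_natural_right, MonoidalClosed.curry_pre_app, Category.assoc, hV,
        whiskerRight_fst_assoc, whiskerRight_fst_assoc, sq.w]) (by
      rw [(joined_vert_iff (a ▷ _ ≫ V) (i ≫ k ≫ s) (i ≫ k ≫ s)).2.2 (by
        rw [ι₁_comp_assoc, V₁, sq.w_assoc]), vert, MonoidalClosed.curry_pre_app, vert,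
        whiskerRight_fst_assoc]) (by
      rw [vert_map, Category.assoc, hs, Category.comp_id,
        (joined_vert_iff (fst _ _ ≫ k) k k).2.2 (by simp)])
  obtain ⟨H, rfl⟩ : ∃ h, MonoidalClosed.curry h = e :=
    ⟨MonoidalClosed.uncurry e, MonoidalClosed.curry_uncurry e⟩
  rw [MonoidalClosed.curry_pre_app] at h₁
  rw [← MonoidalClosed.curry_natural_right] at h₂
  replace h₁ := MonoidalClosed.curry_injective h₁
  replace h₂ := MonoidalClosed.curry_injective h₂
  refine ⟨⟨⟨ι₀ ≫ H, ?_, ?_⟩⟩⟩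
  · rw [← ι₀_comp_assoc, h₁, ι₀_comp_assoc, V₀, Category.comp_id]
  · rw [Category.assoc, h₂, ι₀_fst_assoc]

end TrivialFibration

/-! ### Extension of homotopies -/

section HomotopyExtension

open SSet modelCategoryQuillen

/-- Homotopy extension: a homotopy on a subobject extends, with prescribed start. -/
theorem exists_homotopy_extension {A B M : SSet.{u}} [KanComplex M] (i : A ⟶ B) [Mono i]
    (h : A ⊗ Δ[1] ⟶ M) (k : B ⟶ M) (w : ι₀ ≫ h = i ≫ k) :
    ∃ H : B ⊗ Δ[1] ⟶ M, ι₀ ≫ H = k ∧ i ▷ _ ≫ H = h := by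
  obtain ⟨e, he, he'⟩ := exists_edge_lift ((MonoidalClosed.pre i).app M) 0 1 (by simp) (vert k)
    (MonoidalClosed.curry h) (by
      rw [(joined_vert_iff h (i ≫ k) (i ≫ k)).1.2 w, vert, MonoidalClosed.curry_pre_app, vert,
        whiskerRight_fst_assoc])
  obtain ⟨H, rfl⟩ : ∃ h, MonoidalClosed.curry h = e :=
    ⟨MonoidalClosed.uncurry e, MonoidalClosed.curry_uncurry e⟩
  refine ⟨H, (joined_vert_iff H k k).1.1 he, ?_⟩
  rw [MonoidalClosed.curry_pre_app] at he'
  exact MonoidalClosed.curry_injective he'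

/-- Kan complexes have the extension property for pushout products of anodyne extensions and
monomorphisms. -/
theorem exists_tensor_lift_of_anodyne {A B M X Y : SSet.{u}} [KanComplex M] (i : A ⟶ B)
    (hi : anodyneExtensions i) (j : X ⟶ Y) [Mono j] (h : A ⊗ Y ⟶ M) (k : B ⊗ X ⟶ M)
    (w : A ◁ j ≫ h = i ▷ X ≫ k) : ∃ H : B ⊗ Y ⟶ M, i ▷ Y ≫ H = h ∧ B ◁ j ≫ H = k := by
  have sq : CommSq (MonoidalClosed.curry ((β_ _ _).hom ≫ h)) i ((MonoidalClosed.pre j).app M)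
      (MonoidalClosed.curry ((β_ _ _).hom ≫ k)) := ⟨by
    rw [MonoidalClosed.curry_pre_app, ← MonoidalClosed.curry_natural_left]
    congr 1
    rw [BraidedCategory.braiding_naturality_left_assoc,
      BraidedCategory.braiding_naturality_right_assoc, w]⟩
  have : HasLiftingProperty i ((MonoidalClosed.pre j).app M) := hi _ (mem_fibrations _)
  refine ⟨(β_ _ _).hom ≫ MonoidalClosed.uncurry sq.lift, ?_, ?_⟩
  · rw [BraidedCategory.braiding_naturality_left_assoc, ← MonoidalClosed.uncurry_natural_left,
      sq.fac_left, MonoidalClosed.uncurry_curry, SymmetricCategory.symmetry_assoc]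
  · have := congrArg MonoidalClosed.uncurry sq.fac_right
    rw [BraidedCategory.braiding_naturality_right_assoc, MonoidalClosed.uncurry_curry,
      MonoidalClosed.uncurry_pre_app] at *
    rw [this, SymmetricCategory.symmetry_assoc]

theorem exists_homotopy_extension_of_anodyne {A B M : SSet.{u}} [KanComplex M] (i : A ⟶ B)
    (hi : anodyneExtensions i) (h : A ⊗ Δ[1] ⟶ M) (k₀ k₁ : B ⟶ M) (w₀ : ι₀ ≫ h = i ≫ k₀)
    (w₁ : ι₁ ≫ h = i ≫ k₁) :
    ∃ H : B ⊗ Δ[1] ⟶ M, i ▷ _ ≫ H = h ∧ ι₀ ≫ H = k₀ ∧ ι₁ ≫ H = k₁ := by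
  obtain ⟨H, h₁, h₂⟩ := exists_tensor_lift_of_anodyne i hi ∂Δ[1].ι h (endsDesc k₀ k₁) (by
    rw [eq_endsDesc, w₀, w₁, comp_endsDesc])
  rw [eq_endsDesc] at h₂
  exact ⟨H, h₁, endsDesc_injective h₂⟩

end HomotopyExtension

/-! ### Lifting against pushout products -/

section

open SSet

/-- Lifting against the union of two monomorphisms with common target. -/
theorem TrivFib.exists_lift_union {K L : SSet.{u}} {p : K ⟶ L} (hp : TrivFib p)
    {A B C : SSet.{u}} (i : A ⟶ C) [Mono i] (j : B ⟶ C) [Mono j] (h : A ⟶ K) (k : B ⟶ K) (l : C ⟶ L)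
    (w : ∀ (n : SimplexCategory) (a : A.obj (op n)) (b : B.obj (op n)),
      i.app _ a = j.app _ b → h.app _ a = k.app _ b)
    (w₁ : h ≫ p = i ≫ l) (w₂ : k ≫ p = j ≫ l) :
    ∃ m : C ⟶ K, i ≫ m = h ∧ j ≫ m = k ∧ m ≫ p = l := by
  classical
  have hi (n : SimplexCategory) : Function.Injective (i.app (op n)) :=
    (mono_iff_injective _).1 ((NatTrans.mono_iff_mono_app i).1 inferInstance _)
  have hj (n : SimplexCategory) : Function.Injective (j.app (op n)) :=
    (mono_iff_injective _).1 ((NatTrans.mono_iff_mono_app j).1 inferInstance _)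
  let U : C.Subcomplex := Subcomplex.range i ⊔ Subcomplex.range j
  have hU (n : SimplexCategory) (x : U.toSSet.obj (op n)) (hx : ¬ ∃ a, i.app _ a = x.1) :
      ∃ b, j.app _ b = x.1 := x.2.resolve_left hx
  let f (n : SimplexCategory) (x : U.toSSet.obj (op n)) : K.obj (op n) :=
    if hx : ∃ a, i.app _ a = x.1 then h.app _ hx.choose else k.app _ (hU n x hx).choose
  have hf₁ (n : SimplexCategory) (x : U.toSSet.obj (op n)) (a) (ha : i.app _ a = x.1) :
      f n x = h.app _ a := by
    have hx : ∃ a, i.app _ a = x.1 := ⟨a, ha⟩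
    simp only [f, dif_pos hx]
    rw [hi n (hx.choose_spec.trans ha.symm)]
  have hf₂ (n : SimplexCategory) (x : U.toSSet.obj (op n)) (b) (hb : j.app _ b = x.1) :
      f n x = k.app _ b := by
    by_cases hx : ∃ a, i.app _ a = x.1
    · obtain ⟨a, ha⟩ := hx
      rw [hf₁ n x a ha, w n a b (ha.trans hb.symm)]
    · simp only [f, dif_neg hx]
      rw [hj n ((hU n x hx).choose_spec.trans hb.symm)]
  let F : U.toSSet ⟶ K := mkHom f (by
    intro m n g x
    obtain ⟨a, ha⟩ | ⟨b, hb⟩ := x.2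
    · rw [hf₁ n x a ha, hf₁ m _ (A.map g.op a) (by rw [sset_naturality, ha]; rfl), sset_naturality]
    · rw [hf₂ n x b hb, hf₂ m _ (B.map g.op b) (by rw [sset_naturality, hb]; rfl), sset_naturality])
  obtain ⟨m, hm, hm'⟩ := hp.exists_lift U.ι F l (by
    apply sset_hom_ext
    intro n x
    obtain ⟨a, ha⟩ | ⟨b, hb⟩ := x.2
    · change p.app _ (f n x) = l.app _ x.1
      rw [hf₁ n x a ha, ← ha]
      exact congrArg (fun q ↦ q.app _ a) w₁
    · change p.app _ (f n x) = l.app _ x.1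
      rw [hf₂ n x b hb, ← hb]
      exact congrArg (fun q ↦ q.app _ b) w₂)
  refine ⟨m, ?_, ?_, hm'⟩
  · apply sset_hom_ext
    intro n a
    exact (congrArg (fun q ↦ q.app (op n) ⟨i.app _ a, Or.inl ⟨a, rfl⟩⟩) hm).trans (hf₁ _ _ _ rfl)
  · apply sset_hom_ext
    intro n b
    exact (congrArg (fun q ↦ q.app (op n) ⟨j.app _ b, Or.inr ⟨b, rfl⟩⟩) hm).trans (hf₂ _ _ _ rfl)

/-- Trivial fibrations lift against pushout products of monomorphisms. -/
theorem TrivFib.exists_tensor_lift {K L : SSet.{u}} {p : K ⟶ L} (hp : TrivFib p)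
    {A B X Y : SSet.{u}} (i : A ⟶ B) [Mono i] (j : X ⟶ Y) [Mono j] (h : A ⊗ Y ⟶ K) (k : B ⊗ X ⟶ K)
    (l : B ⊗ Y ⟶ L) (w : A ◁ j ≫ h = i ▷ X ≫ k) (w₁ : h ≫ p = i ▷ Y ≫ l)
    (w₂ : k ≫ p = B ◁ j ≫ l) :
    ∃ H : B ⊗ Y ⟶ K, i ▷ Y ≫ H = h ∧ B ◁ j ≫ H = k ∧ H ≫ p = l := by
  refine hp.exists_lift_union (i ▷ Y) (B ◁ j) h k l ?_ w₁ w₂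
  rintro n ⟨a, y⟩ ⟨b, x⟩ e
  obtain rfl : i.app _ a = b := (Prod.ext_iff.1 e).1
  obtain rfl : y = j.app _ x := (Prod.ext_iff.1 e).2
  exact congrArg (fun q ↦ q.app (op n) (a, x)) w

end

/-! ### Homotopy pullbacks -/

section HoPullback

open SSet modelCategoryQuillen

variable {K L M : SSet.{u}}

/-- The homotopy pullback of `f : K ⟶ M` and `g : L ⟶ M`: an `n`-simplex consists of `n`-simplices
of `K` and `L`, and a path between their images in `M`. -/
def hoPullback (f : K ⟶ M) (g : L ⟶ M) : SSet.{u} :=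
  mkSSet
    (fun n ↦ { p : (K.obj (op n) × L.obj (op n)) × (SSet.stdSimplex.obj n ⊗ Δ[1] ⟶ M) //
      ι₀ ≫ p.2 = yonedaEquiv.symm p.1.1 ≫ f ∧ ι₁ ≫ p.2 = yonedaEquiv.symm p.1.2 ≫ g })
    (fun φ p ↦ ⟨((K.map φ.op p.1.1.1, L.map φ.op p.1.1.2), SSet.stdSimplex.map φ ▷ Δ[1] ≫ p.1.2), by
      rw [ι₀_comp_assoc, ι₁_comp_assoc, p.2.1, p.2.2, yonedaEquiv_symm_map, yonedaEquiv_symm_map]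
      exact ⟨(Category.assoc _ _ _).symm, (Category.assoc _ _ _).symm⟩⟩)
    (fun n p ↦ Subtype.ext (Prod.ext (Prod.ext (sset_map_id _) (sset_map_id _)) (by
      change SSet.stdSimplex.map (𝟙 n) ▷ _ ≫ _ = _
      rw [stdSimplex_map_id, id_whiskerRight, Category.id_comp])))
    (fun φ ψ p ↦ Subtype.ext (Prod.ext (Prod.ext (sset_map_comp _ _ _).symm
      (sset_map_comp _ _ _).symm) (by
      change SSet.stdSimplex.map (φ ≫ ψ) ▷ _ ≫ _ = _ ≫ _ ≫ _
      rw [stdSimplex_map_comp, comp_whiskerRight, Category.assoc])))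

namespace hoPullback

variable (f : K ⟶ M) (g : L ⟶ M)

/-- The first projection of a homotopy pullback. -/
def fst : hoPullback f g ⟶ K := mkHom (fun _ p ↦ p.1.1.1) (fun _ _ ↦ rfl)

/-- The second projection of a homotopy pullback. -/
def snd : hoPullback f g ⟶ L := mkHom (fun _ p ↦ p.1.1.2) (fun _ _ ↦ rfl)

/-- The homotopy between the two maps of a homotopy pullback to the base. -/
def path : hoPullback f g ⊗ Δ[1] ⟶ M :=
  mkHom (fun n q ↦ q.1.1.2.app (op n) (SSet.stdSimplex.objEquiv.symm (𝟙 n), q.2)) (by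
    rintro m n φ ⟨p, t⟩
    exact sset_naturality p.1.2 φ (SSet.stdSimplex.objEquiv.symm (𝟙 n), t))

variable {f g}

theorem path_app {m n : SimplexCategory} (p : (hoPullback f g).obj (op n)) (s : m ⟶ n)
    (t : (Δ[1] : SSet.{u}).obj (op m)) :
    p.1.2.app (op m) (SSet.stdSimplex.objEquiv.symm s, t) =
      (path f g).app (op m) ((hoPullback f g).map s.op p, t) := by
  change _ = p.1.2.app (op m) (SSet.stdSimplex.objEquiv.symm (𝟙 m ≫ s), t)
  rw [Category.id_comp]

variable (f g) in
theorem ι₀_path : ι₀ ≫ path f g = fst f g ≫ f := by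
  apply sset_hom_ext
  intro n p
  have := congrArg (fun k ↦ k.app (op n) (SSet.stdSimplex.objEquiv.symm (𝟙 n))) p.2.1
  refine this.trans ?_
  change f.app _ (K.map (𝟙 n).op _) = _
  rw [sset_map_id]
  rfl

variable (f g) in
theorem ι₁_path : ι₁ ≫ path f g = snd f g ≫ g := by
  apply sset_hom_ext
  intro n p
  have := congrArg (fun k ↦ k.app (op n) (SSet.stdSimplex.objEquiv.symm (𝟙 n))) p.2.2
  refine this.trans ?_
  change g.app _ (L.map (𝟙 n).op _) = _
  rw [sset_map_id]
  rfl

theorem hom_ext {T : SSet.{u}} {a b : T ⟶ hoPullback f g} (h₁ : a ≫ fst f g = b ≫ fst f g)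
    (h₂ : a ≫ snd f g = b ≫ snd f g) (h₃ : a ▷ _ ≫ path f g = b ▷ _ ≫ path f g) : a = b := by
  apply sset_hom_ext
  intro n x
  refine Subtype.ext (Prod.ext (Prod.ext ?_ ?_) ?_)
  · exact congrArg (fun k ↦ k.app (op n) x) h₁
  · exact congrArg (fun k ↦ k.app (op n) x) h₂
  · apply sset_hom_ext
    rintro m ⟨s, t⟩
    obtain ⟨s, rfl⟩ := SSet.stdSimplex.objEquiv.symm.surjective s
    refine (path_app (a.app _ x) s t).trans (Eq.trans ?_ (path_app (b.app _ x) s t).symm)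
    rw [← sset_naturality, ← sset_naturality]
    exact congrArg (fun k ↦ k.app (op m) (T.map s.op x, t)) h₃

/-- The universal property of the homotopy pullback. -/
def lift {T : SSet.{u}} (a : T ⟶ K) (b : T ⟶ L) (h : T ⊗ Δ[1] ⟶ M) (h₀ : ι₀ ≫ h = a ≫ f)
    (h₁ : ι₁ ≫ h = b ≫ g) : T ⟶ hoPullback f g :=
  mkHom (fun n x ↦ ⟨((a.app _ x, b.app _ x), yonedaEquiv.symm x ▷ _ ≫ h), by
      rw [ι₀_comp_assoc, ι₁_comp_assoc, h₀, h₁, ← yonedaEquiv_symm_comp, ← yonedaEquiv_symm_comp,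
        Category.assoc, Category.assoc]
      exact ⟨rfl, rfl⟩⟩) (by
    intro m n φ x
    refine Subtype.ext (Prod.ext (Prod.ext (sset_naturality _ _ _) (sset_naturality _ _ _)) ?_)
    change yonedaEquiv.symm (T.map φ.op x) ▷ _ ≫ h = SSet.stdSimplex.map φ ▷ _ ≫ _ ≫ _
    rw [yonedaEquiv_symm_map, comp_whiskerRight, Category.assoc]
    rfl)

section

variable {T : SSet.{u}} (a : T ⟶ K) (b : T ⟶ L) (h : T ⊗ Δ[1] ⟶ M) (h₀ : ι₀ ≫ h = a ≫ f)
    (h₁ : ι₁ ≫ h = b ≫ g)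

@[simp]
theorem lift_fst : lift a b h h₀ h₁ ≫ fst f g = a := rfl

@[simp]
theorem lift_snd : lift a b h h₀ h₁ ≫ snd f g = b := rfl

@[simp]
theorem lift_path : lift a b h h₀ h₁ ▷ _ ≫ path f g = h := by
  apply sset_hom_ext
  rintro n ⟨x, t⟩
  change h.app _ (T.map (𝟙 n).op x, t) = _
  rw [sset_map_id]

end

/-- The mapping path object of a map is equivalent to its source. -/
theorem fst_trivFib [KanComplex M] (f : K ⟶ M) : TrivFib (fst f (𝟙 M)) := by
  intro A B i (hi : Mono i)
  refine ⟨fun {a k} sq ↦ ?_⟩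
  obtain ⟨H, h₁, h₂⟩ := exists_homotopy_extension i (a ▷ _ ≫ path _ _) (k ≫ f) (by
    rw [ι₀_comp_assoc, ι₀_path, sq.w_assoc])
  refine ⟨⟨⟨lift k (ι₁ ≫ H) H h₁ (by simp), hom_ext ?_ ?_ ?_, rfl⟩⟩⟩
  · rw [Category.assoc, lift_fst, sq.w]
  · rw [Category.assoc, lift_snd, ← ι₁_comp_assoc, h₂, ι₁_comp_assoc, ι₁_path, Category.comp_id]
  · rw [comp_whiskerRight, Category.assoc, lift_path, h₂]

theorem snd_fibration [KanComplex K] [KanComplex M] (f : K ⟶ M) (g : L ⟶ M) :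
    Fibration (snd f g) := by
  rw [fibration_iff]
  intro A B i hi
  replace hi : anodyneExtensions i := by
    rw [anodyneExtensions_eq_llp_rlp]
    exact MorphismProperty.le_llp_rlp _ _ hi
  refine ⟨fun {a b} sq ↦ ?_⟩
  have : HasLiftingProperty i (Limits.terminal.from K) := hi _ (mem_fibrations _)
  have sq' : CommSq (a ≫ fst f g) i (Limits.terminal.from K) (Limits.terminal.from B) :=
    ⟨Subsingleton.elim _ _⟩
  obtain ⟨H, h, h₁, h₂⟩ := exists_homotopy_extension_of_anodyne i hi (a ▷ _ ≫ path f g)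
    (sq'.lift ≫ f) (b ≫ g) (by rw [ι₀_comp_assoc, ι₀_path, sq'.fac_left_assoc, Category.assoc])
    (by rw [ι₁_comp_assoc, ι₁_path, sq.w_assoc])
  refine ⟨⟨⟨lift sq'.lift b H h₁ h₂, hom_ext ?_ ?_ ?_, rfl⟩⟩⟩
  · rw [Category.assoc, lift_fst, sq'.fac_left]
  · rw [Category.assoc, lift_snd, sq.w]
  · rw [comp_whiskerRight, Category.assoc, lift_path, h]

instance [KanComplex K] [KanComplex L] [KanComplex M] (f : K ⟶ M) (g : L ⟶ M) :
    KanComplex (hoPullback f g) := by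
  have := snd_fibration f g
  exact isFibrant_of_fibration (snd f g)

/-- Functoriality of the homotopy pullback. -/
def map {K' L' M' : SSet.{u}} {f : K ⟶ M} {g : L ⟶ M} {f' : K' ⟶ M'} {g' : L' ⟶ M'} (a : K ⟶ K')
    (b : L ⟶ L') (c : M ⟶ M') (h₁ : f ≫ c = a ≫ f') (h₂ : g ≫ c = b ≫ g') :
    hoPullback f g ⟶ hoPullback f' g' :=
  lift (fst f g ≫ a) (snd f g ≫ b) (path f g ≫ c)
    (by rw [← Category.assoc, ι₀_path, Category.assoc, h₁, Category.assoc])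
    (by rw [← Category.assoc, ι₁_path, Category.assoc, h₂, Category.assoc])

section Map

variable {K' L' M' : SSet.{u}} {f : K ⟶ M} {g : L ⟶ M} {f' : K' ⟶ M'} {g' : L' ⟶ M'} (a : K ⟶ K')
    (b : L ⟶ L') (c : M ⟶ M') (h₁ : f ≫ c = a ≫ f') (h₂ : g ≫ c = b ≫ g')

@[simp]
theorem map_fst : map a b c h₁ h₂ ≫ fst f' g' = fst f g ≫ a := rfl

@[simp]
theorem map_snd : map a b c h₁ h₂ ≫ snd f' g' = snd f g ≫ b := rfl

@[simp]
theorem map_path : map a b c h₁ h₂ ▷ _ ≫ path f' g' = path f g ≫ c := lift_path _ _ _ _ _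

theorem map_id : map (𝟙 K) (𝟙 L) (𝟙 M) (by simp) (by simp) = 𝟙 (hoPullback f g) :=
  hom_ext (by simp) (by simp) (by simp)

theorem map_comp {K'' L'' M'' : SSet.{u}} {f'' : K'' ⟶ M''} {g'' : L'' ⟶ M''} (a' : K' ⟶ K'')
    (b' : L' ⟶ L'') (c' : M' ⟶ M'') (h₁' : f' ≫ c' = a' ≫ f'') (h₂' : g' ≫ c' = b' ≫ g'') :
    map a b c h₁ h₂ ≫ map a' b' c' h₁' h₂' =
      map (a ≫ a') (b ≫ b') (c ≫ c') (by rw [reassoc_of% h₁, h₁', Category.assoc])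
        (by rw [reassoc_of% h₂, h₂', Category.assoc]) := by
  refine hom_ext ?_ ?_ ?_
  · rfl
  · rfl
  · rw [comp_whiskerRight, Category.assoc, map_path, map_path, ← Category.assoc, map_path,
      Category.assoc]

variable {a b c} in
theorem map_trivFib (ha : TrivFib a) (hb : TrivFib b) (hc : TrivFib c) :
    TrivFib (map a b c h₁ h₂) := by
  intro A B i (hi : Mono i)
  refine ⟨fun {x y} sq ↦ ?_⟩
  obtain ⟨k, hk, hk'⟩ := ha.exists_lift i (x ≫ fst f g) (y ≫ fst f' g') (by
    rw [← sq.w_assoc]; rfl)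
  obtain ⟨l, hl, hl'⟩ := hb.exists_lift i (x ≫ snd f g) (y ≫ snd f' g') (by
    rw [← sq.w_assoc]; rfl)
  obtain ⟨H, hH, hH', hH''⟩ := hc.exists_tensor_lift i ∂Δ[1].ι (x ▷ _ ≫ path f g)
    (endsDesc (k ≫ f) (l ≫ g)) (y ▷ _ ≫ path f' g') (by
      rw [eq_endsDesc, comp_endsDesc, ι₀_comp_assoc, ι₁_comp_assoc, ι₀_path, ι₁_path,
        reassoc_of% hk, reassoc_of% hl]) (by
      rw [Category.assoc, ← map_path a b c h₁ h₂, ← comp_whiskerRight_assoc, sq.w,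
        comp_whiskerRight_assoc]) (by
      rw [eq_endsDesc, endsDesc_comp, ι₀_comp_assoc, ι₁_comp_assoc, ι₀_path, ι₁_path,
        Category.assoc, h₁, reassoc_of% hk', Category.assoc, h₂, reassoc_of% hl'])
  rw [eq_endsDesc] at hH'
  obtain ⟨e₀, e₁⟩ := endsDesc_injective hH'
  refine ⟨⟨⟨lift k l H e₀ e₁, hom_ext ?_ ?_ ?_, hom_ext ?_ ?_ ?_⟩⟩⟩
  · rw [Category.assoc, lift_fst, hk]
  · rw [Category.assoc, lift_snd, hl]
  · rw [comp_whiskerRight, Category.assoc, lift_path, hH]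
  · rw [Category.assoc, map_fst, ← Category.assoc, lift_fst, hk']
  · rw [Category.assoc, map_snd, ← Category.assoc, lift_snd, hl']
  · rw [comp_whiskerRight, Category.assoc, map_path, ← Category.assoc, lift_path, hH'']

end Map

end hoPullback

end HoPullback

section

open SSet modelCategoryQuillen

/-- The minimum map `Δ[1] × Δ[1] ⟶ Δ[1]`. -/
def minMap : (Δ[1] : SSet.{u}) ⊗ Δ[1] ⟶ Δ[1] :=
  mkHom (fun _ p ↦ stdMk (fun a ↦ min (stdVal p.1 a) (stdVal p.2 a))
    fun _ _ hab ↦ min_le_min (stdVal_mono _ hab) (stdVal_mono _ hab)) (by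
    rintro m n f ⟨s, t⟩
    exact stdVal_ext fun a ↦ rfl)

end

namespace hoPullback

open SSet modelCategoryQuillen

variable {K L M : SSet.{u}}

/-- The map to a homotopy pullback given by a strictly commuting square. -/
def ofComm {T : SSet.{u}} (f : K ⟶ M) (g : L ⟶ M) (a : T ⟶ K) (b : T ⟶ L) (w : a ≫ f = b ≫ g) :
    T ⟶ hoPullback f g :=
  lift a b (CartesianMonoidalCategory.fst _ _ ≫ a ≫ f) (by simp) (by simp [w])

theorem ofComm_fst {T : SSet.{u}} (f : K ⟶ M) (g : L ⟶ M) (a : T ⟶ K) (b : T ⟶ L)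
    (w : a ≫ f = b ≫ g) : ofComm f g a b w ≫ fst f g = a := lift_fst _ _ _ _ _

theorem ofComm_snd {T : SSet.{u}} (f : K ⟶ M) (g : L ⟶ M) (a : T ⟶ K) (b : T ⟶ L)
    (w : a ≫ f = b ≫ g) : ofComm f g a b w ≫ snd f g = b := lift_snd _ _ _ _ _

theorem comp_ofComm {T T' : SSet.{u}} (f : K ⟶ M) (g : L ⟶ M) (k : T' ⟶ T) (a : T ⟶ K) (b : T ⟶ L)
    (w : a ≫ f = b ≫ g) : k ≫ ofComm f g a b w =
      ofComm f g (k ≫ a) (k ≫ b) (by rw [Category.assoc, w, Category.assoc]) := by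
  refine hom_ext (by rw [Category.assoc, ofComm_fst, ofComm_fst])
    (by rw [Category.assoc, ofComm_snd, ofComm_snd]) ?_
  rw [comp_whiskerRight, Category.assoc, ofComm, lift_path, ofComm, lift_path,
    whiskerRight_fst_assoc, Category.assoc]

theorem ofComm_map {T K' L' M' : SSet.{u}} {f : K ⟶ M} {g : L ⟶ M} {f' : K' ⟶ M'} {g' : L' ⟶ M'}
    (a : K ⟶ K') (b : L ⟶ L') (c : M ⟶ M') (h₁ : f ≫ c = a ≫ f') (h₂ : g ≫ c = b ≫ g')
    (x : T ⟶ K) (y : T ⟶ L) (w : x ≫ f = y ≫ g) :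
    ofComm f g x y w ≫ map a b c h₁ h₂ = ofComm f' g' (x ≫ a) (y ≫ b)
      (by rw [Category.assoc, ← h₁, ← Category.assoc, w, Category.assoc, h₂, Category.assoc]) := by
  refine hom_ext
    (by rw [Category.assoc, map_fst, ← Category.assoc, ofComm_fst, ofComm_fst])
    (by rw [Category.assoc, map_snd, ← Category.assoc, ofComm_snd, ofComm_snd]) ?_
  rw [comp_whiskerRight, Category.assoc, map_path, ofComm, ← Category.assoc, lift_path, ofComm,
    lift_path, Category.assoc, Category.assoc, Category.assoc, h₁]

/-- The strict pullback along a fibration is equivalent to the homotopy pullback. -/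
theorem isHomotopyEquiv_ofComm_of_isPullback {P : SSet.{u}} {p : P ⟶ K} {q : P ⟶ L} {f : K ⟶ M}
    {g : L ⟶ M} (hP : IsPullback p q f g) [Fibration g] :
    IsHomotopyEquiv (ofComm f g p q hP.w) := by
  obtain ⟨i, hi⟩ : ∃ i, i = ofComm f g p q hP.w := ⟨_, rfl⟩
  have hif : i ≫ fst f g = p := by rw [hi]; rfl
  have hig : i ≫ snd f g = q := by rw [hi]; rfl
  have hip : i ▷ _ ≫ path f g = CartesianMonoidalCategory.fst _ _ ≫ p ≫ f := by
    rw [hi, ofComm, lift_path]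
  have : Mono i := ⟨fun a b h ↦ hP.hom_ext
    (by rw [← hif, ← Category.assoc, h, Category.assoc])
    (by rw [← hig, ← Category.assoc, h, Category.assoc])⟩
  -- lift the path to `L`, backwards from its end, constantly over `P`
  obtain ⟨e, he, h₁, h₂⟩ := exists_edge_lift_ihom i g (vert (snd f g))
    (MonoidalClosed.curry (CartesianMonoidalCategory.fst _ _ ≫ q))
    (MonoidalClosed.curry (path f g)) (by
      rw [← MonoidalClosed.curry_natural_right, MonoidalClosed.curry_pre_app, hip, Category.assoc,
        hP.w]) (by
      rw [(joined_vert_iff (CartesianMonoidalCategory.fst _ _ ≫ q) q q).2.2 (by simp), vert,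
        MonoidalClosed.curry_pre_app, vert, whiskerRight_fst_assoc, hig]) (by
      rw [vert_map, ((joined_vert_iff (path f g) (snd f g ≫ g) _).2.2 (ι₁_path f g))])
  obtain ⟨H, rfl⟩ : ∃ h, MonoidalClosed.curry h = e :=
    ⟨MonoidalClosed.uncurry e, MonoidalClosed.curry_uncurry e⟩
  rw [MonoidalClosed.curry_pre_app] at h₁
  rw [← MonoidalClosed.curry_natural_right] at h₂
  replace h₁ := MonoidalClosed.curry_injective h₁
  replace h₂ := MonoidalClosed.curry_injective h₂
  replace he := (joined_vert_iff H (snd f g) (snd f g)).2.1 he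
  have hr : fst f g ≫ f = (ι₀ ≫ H) ≫ g := by rw [Category.assoc, h₂, ι₀_path]
  rw [← hi]
  refine ⟨hP.lift (fst f g) (ι₀ ≫ H) hr, ?_, ?_⟩
  · have : i ≫ hP.lift (fst f g) (ι₀ ≫ H) hr = 𝟙 P := hP.hom_ext
      (by rw [Category.assoc, hP.lift_fst, hif, Category.id_comp])
      (by rw [Category.assoc, hP.lift_snd, ← ι₀_comp_assoc, h₁, ι₀_fst_assoc, Category.id_comp])
    rw [this]
    exact Homotopic.refl _
  · -- at time `s`, follow the path until time `s` only
    refine (homotopic_iff _ _).2 ⟨lift (CartesianMonoidalCategory.fst _ _ ≫ fst f g) H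
      ((α_ _ _ _).hom ≫ _ ◁ minMap ≫ path f g) ?_ ?_, hom_ext ?_ ?_ ?_, hom_ext ?_ ?_ ?_⟩
    · rw [Category.assoc, ← ι₀_path]
      apply sset_hom_ext
      rintro n ⟨x, s⟩
      change (path f g).app _ (x, _) = (path f g).app _ (x, _)
      congr 2
      exact stdVal_ext fun a ↦ min_eq_right (Fin.zero_le _)
    · rw [h₂]
      apply sset_hom_ext
      rintro n ⟨x, s⟩
      change (path f g).app _ (x, _) = (path f g).app _ (x, _)
      congr 2
      exact stdVal_ext fun a ↦ min_eq_left (Fin.le_last _)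
    · rw [Category.assoc, lift_fst, ι₀_fst_assoc, Category.assoc, hif, hP.lift_fst]
    · rw [Category.assoc, lift_snd, Category.assoc, hig, hP.lift_snd]
    · rw [comp_whiskerRight, Category.assoc, lift_path, comp_whiskerRight, Category.assoc, hip,
        whiskerRight_fst_assoc, hP.lift_fst_assoc, ← ι₀_path]
      apply sset_hom_ext
      rintro n ⟨x, s⟩
      change (path f g).app _ (x, _) = (path f g).app _ (x, _)
      congr 2
    · rw [Category.assoc, lift_fst, ι₁_fst_assoc, Category.id_comp]
    · rw [Category.assoc, lift_snd, he, Category.id_comp]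
    · rw [comp_whiskerRight, Category.assoc, lift_path, id_whiskerRight, Category.id_comp]
      apply sset_hom_ext
      rintro n ⟨x, s⟩
      change (path f g).app _ (x, _) = (path f g).app _ (x, _)
      congr 2
      exact stdVal_ext fun a ↦ min_eq_right (Fin.le_last _)

end hoPullback

/-! ### Mapping path objects -/

section MappingPath

open SSet modelCategoryQuillen

variable {K L : SSet.{u}}

/-- The inclusion of the source of a map in its mapping path object, as constant paths. -/
def constPath (f : K ⟶ L) : K ⟶ hoPullback f (𝟙 L) :=
  hoPullback.ofComm _ _ (𝟙 K) f (by simp)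

theorem constPath_fst (f : K ⟶ L) : constPath f ≫ hoPullback.fst f (𝟙 L) = 𝟙 K := rfl

theorem constPath_snd (f : K ⟶ L) : constPath f ≫ hoPullback.snd f (𝟙 L) = f := rfl

theorem isHomotopyEquiv_constPath [KanComplex K] [KanComplex L] (f : K ⟶ L) :
    IsHomotopyEquiv (constPath f) := by
  rw [← isHomotopyEquiv_comp_iff_right (hoPullback.fst_trivFib f).isHomotopyEquiv, constPath_fst]
  exact isHomotopyEquiv_of_isIso _

theorem mappingPath_snd_trivFib [KanComplex K] [KanComplex L] (f : K ⟶ L)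
    (hf : IsHomotopyEquiv f) : TrivFib (hoPullback.snd f (𝟙 L)) := by
  have := hoPullback.snd_fibration f (𝟙 L)
  refine trivFib_of_fibration _ ?_
  rwa [← isHomotopyEquiv_comp_iff_left (isHomotopyEquiv_constPath f), constPath_snd]

/-- The map of mapping path objects given by a commuting square. -/
def mappingPathMap {K' L' : SSet.{u}} {f : K ⟶ L} {f' : K' ⟶ L'} (a : K ⟶ K') (b : L ⟶ L')
    (w : f ≫ b = a ≫ f') : hoPullback f (𝟙 L) ⟶ hoPullback f' (𝟙 L') :=
  hoPullback.map a b b w (by simp)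

theorem constPath_map {K' L' : SSet.{u}} {f : K ⟶ L} {f' : K' ⟶ L'} (a : K ⟶ K') (b : L ⟶ L')
    (w : f ≫ b = a ≫ f') : constPath f ≫ mappingPathMap a b w = a ≫ constPath f' := by
  rw [constPath, constPath, mappingPathMap, hoPullback.ofComm_map, hoPullback.comp_ofComm]
  congr 1

theorem mappingPathMap_fst {K' L' : SSet.{u}} {f : K ⟶ L} {f' : K' ⟶ L'} (a : K ⟶ K')
    (b : L ⟶ L') (w : f ≫ b = a ≫ f') :
    mappingPathMap a b w ≫ hoPullback.fst f' (𝟙 L') = hoPullback.fst f (𝟙 L) ≫ a := rfl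

theorem mappingPathMap_snd {K' L' : SSet.{u}} {f : K ⟶ L} {f' : K' ⟶ L'} (a : K ⟶ K')
    (b : L ⟶ L') (w : f ≫ b = a ≫ f') :
    mappingPathMap a b w ≫ hoPullback.snd f' (𝟙 L') = hoPullback.snd f (𝟙 L) ≫ b := rfl

variable {M K' L' M' : SSet.{u}}

/-- Homotopy pullbacks of Kan complexes are invariant under homotopy equivalence. -/
theorem hoPullback.map_isHomotopyEquiv [KanComplex K] [KanComplex L] [KanComplex M]
    [KanComplex K'] [KanComplex L'] [KanComplex M'] {f : K ⟶ M} {g : L ⟶ M} {f' : K' ⟶ M'}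
    {g' : L' ⟶ M'} {a : K ⟶ K'} {b : L ⟶ L'} {c : M ⟶ M'} (h₁ : f ≫ c = a ≫ f')
    (h₂ : g ≫ c = b ≫ g') (ha : IsHomotopyEquiv a) (hb : IsHomotopyEquiv b)
    (hc : IsHomotopyEquiv c) : IsHomotopyEquiv (hoPullback.map a b c h₁ h₂) := by
  -- factor through the homotopy pullback of the mapping path objects of `a`, `b`, `c`
  have e₁ := constPath_map f f' h₁.symm
  have e₂ := constPath_map g g' h₂.symm
  have t₁ := hoPullback.map_trivFib (mappingPathMap_fst f f' h₁.symm)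
    (mappingPathMap_fst g g' h₂.symm) (hoPullback.fst_trivFib a) (hoPullback.fst_trivFib b)
    (hoPullback.fst_trivFib c)
  have t₂ := hoPullback.map_trivFib (mappingPathMap_snd f f' h₁.symm)
    (mappingPathMap_snd g g' h₂.symm) (mappingPath_snd_trivFib a ha)
    (mappingPath_snd_trivFib b hb) (mappingPath_snd_trivFib c hc)
  have hs : IsHomotopyEquiv
      (hoPullback.map (constPath a) (constPath b) (constPath c) e₁.symm e₂.symm) := by
    rw [← isHomotopyEquiv_comp_iff_right t₁.isHomotopyEquiv, hoPullback.map_comp]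
    convert isHomotopyEquiv_of_isIso (𝟙 (hoPullback f g))
    exact hoPullback.map_id
  have := isHomotopyEquiv_comp hs t₂.isHomotopyEquiv
  rwa [hoPullback.map_comp] at this

end MappingPath

/-! ### Weights of chains -/

section ChainWeight

variable {I : Type} [SmallCategory I]

/-- The chains of objects of `I` that satisfy `P`, as a simplicial set. For a thin category `I`,
this is the nerve of the full subcategory of objects that satisfy `P`. -/
def chainNerve (P : I → Prop) : SSet.{u} :=
  mkSSet
    (fun n ↦ ULift.{u} { c : Fin (n.len + 1) → I //
      (∀ a b, a ≤ b → Nonempty (c a ⟶ c b)) ∧ ∀ a, P (c a) })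
    (fun f c ↦ ⟨⟨c.down.1 ∘ f.toOrderHom, fun _ _ h ↦ c.down.2.1 _ _ (f.toOrderHom.monotone h),
      fun _ ↦ c.down.2.2 _⟩⟩)
    (fun _ _ ↦ rfl) (fun _ _ _ ↦ rfl)

/-- The weight on a thin category `I` whose value at `i` is the nerve of the category of objects
`x ⟶ i` over `i` such that `x` satisfies `P`. -/
def chainWeight (P : I → Prop) : I ⥤ SSet.{u} where
  obj i := mkSSet
    (fun n ↦ ULift.{u} { c : Fin (n.len + 1) → I //
      ((∀ a b, a ≤ b → Nonempty (c a ⟶ c b)) ∧ ∀ a, P (c a)) ∧ ∀ a, Nonempty (c a ⟶ i) })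
    (fun f c ↦ ⟨⟨c.down.1 ∘ f.toOrderHom, ⟨fun _ _ h ↦ c.down.2.1.1 _ _ (f.toOrderHom.monotone h),
      fun _ ↦ c.down.2.1.2 _⟩, fun _ ↦ c.down.2.2 _⟩⟩)
    (fun _ _ ↦ rfl) (fun _ _ _ ↦ rfl)
  map u := mkHom (fun _ c ↦ ⟨⟨c.down.1, c.down.2.1, fun a ↦ ⟨(c.down.2.2 a).some ≫ u⟩⟩⟩)
    (fun _ _ ↦ rfl)
  map_id _ := rfl
  map_comp _ _ := rfl

/-- The inclusion of weights of chains given by an implication of predicates. -/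
def chainWeightMap {P Q : I → Prop} (h : ∀ x, P x → Q x) :
    chainWeight.{u} P ⟶ chainWeight.{u} Q where
  app _ := mkHom (fun _ c ↦ ⟨⟨c.down.1, ⟨c.down.2.1.1, fun a ↦ h _ (c.down.2.1.2 a)⟩, c.down.2.2⟩⟩)
    (fun _ _ ↦ rfl)
  naturality _ _ _ := rfl

/-- The inclusion of nerves of chains given by an implication of predicates. -/
def chainNerveMap {P Q : I → Prop} (h : ∀ x, P x → Q x) : chainNerve.{u} P ⟶ chainNerve.{u} Q :=
  mkHom (fun _ c ↦ ⟨⟨c.down.1, c.down.2.1, fun a ↦ h _ (c.down.2.2 a)⟩⟩) (fun _ _ ↦ rfl)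

instance {P Q : I → Prop} (h : ∀ x, P x → Q x) : Mono (chainNerveMap.{u} h) := by
  rw [NatTrans.mono_iff_mono_app]
  intro n
  rw [mono_iff_injective]
  rintro ⟨x, _⟩ ⟨y, _⟩ h
  obtain rfl : x = y := congrArg (fun c ↦ c.down.1) h
  rfl

/-- A simplex of the relative nerve of `F`: a chain `c`, with compatible simplices of the values
`F i`, one for each face or degeneracy `f` of the chain whose last object maps to `i`. -/
structure RelSimplex (P : I → Prop) (F : I ⥤ SSet.{u}) (n : SimplexCategory) : Type u where
  /-- the chain -/
  c : Fin (n.len + 1) → I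
  mono : ∀ a b, a ≤ b → Nonempty (c a ⟶ c b)
  mem : ∀ a, P (c a)
  /-- the simplices of the values of `F` -/
  val : ∀ (i : I) (m : SimplexCategory) (f : m ⟶ n),
    Nonempty (c (f.toOrderHom (Fin.last m.len)) ⟶ i) → (F.obj i).obj (op m)
  map_val : ∀ (i : I) (l m : SimplexCategory) (g : l ⟶ m) (f : m ⟶ n) h h',
    (F.obj i).map g.op (val i m f h) = val i l (g ≫ f) h'
  val_map : ∀ (i j : I) (u : i ⟶ j) (m : SimplexCategory) (f : m ⟶ n) h h',
    (F.map u).app (op m) (val i m f h) = val j m f h'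

namespace RelSimplex

variable {P : I → Prop} {F : I ⥤ SSet.{u}} {n : SimplexCategory}

theorem val_congr (q : RelSimplex P F n) {i : I} {m : SimplexCategory} {f f' : m ⟶ n} (e : f = f')
    (h h') : q.val i m f h = q.val i m f' h' := by
  subst e; rfl

theorem val_congr' {q q' : RelSimplex P F n} (e : q = q') (i : I) (m : SimplexCategory) (f : m ⟶ n)
    (h h') : q.val i m f h = q'.val i m f h' := by
  subst e; rfl

theorem ext' {q q' : RelSimplex P F n} (hc : ∀ a, q.c a = q'.c a)
    (hv : ∀ i m f h h', q.val i m f h = q'.val i m f h') : q = q' := by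
  obtain ⟨c, _, _, v, _, _⟩ := q
  obtain ⟨c', _, _, v', _, _⟩ := q'
  obtain rfl : c = c' := funext hc
  obtain rfl : v = v' := by
    funext i m f h
    exact hv i m f h h
  rfl

/-- The action of a simplicial operator on simplices of the relative nerve. -/
@[simps c]
def pull {l : SimplexCategory} (g : l ⟶ n) (q : RelSimplex P F n) : RelSimplex P F l where
  c := q.c ∘ g.toOrderHom
  mono _ _ h := q.mono _ _ (g.toOrderHom.monotone h)
  mem _ := q.mem _
  val i m f h := q.val i m (f ≫ g) h
  map_val i k m f f' h h' := by
    rw [q.map_val i k m f (f' ≫ g) h (by rwa [← Category.assoc])]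
    exact val_congr q (Category.assoc _ _ _).symm _ _
  val_map _ _ _ _ _ _ _ := q.val_map _ _ _ _ _ _ _

end RelSimplex

/-- The relative nerve of a diagram of simplicial sets on a thin category, restricted to the objects
that satisfy `P`. Its sections over the nerve of chains are the maps from the weight of chains. -/
def relNerve (P : I → Prop) (F : I ⥤ SSet.{u}) : SSet.{u} :=
  mkSSet (RelSimplex P F) (fun g q ↦ q.pull g)
    (fun _ q ↦ RelSimplex.ext' (fun _ ↦ rfl) fun _ _ f _ _ ↦
      q.val_congr (Category.comp_id f) _ _)
    (fun f g q ↦ RelSimplex.ext' (fun _ ↦ rfl) fun _ _ e _ _ ↦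
      q.val_congr (Category.assoc e f g).symm _ _)

/-- The map of relative nerves given by a map of diagrams. -/
def relNerveMap (P : I → Prop) {E B : I ⥤ SSet.{u}} (p : E ⟶ B) : relNerve P E ⟶ relNerve P B :=
  mkHom (fun n (q : RelSimplex P E n) ↦ (
    { c := q.c
      mono := q.mono
      mem := q.mem
      val := fun i m f h ↦ (p.app i).app (op m) (q.val i m f h)
      map_val := fun i l m g f h h' ↦ by rw [← sset_naturality, q.map_val _ _ _ _ _ _ h']
      val_map := fun i j u m f h h' ↦ by
        rw [← q.val_map i j u m f h h']
        exact (congrArg (fun k ↦ k.app (op m) (q.val i m f h)) (p.naturality u)).symm } :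
      RelSimplex P B n)) (fun _ _ ↦ rfl)

end ChainWeight

/-! ### Lifting against weights of chains -/

section Lifting

open SSet

variable {I : Type} [SmallCategory I] [Quiver.IsThin I] {P : I → Prop} {E B : I ⥤ SSet.{u}}
  {p : E ⟶ B}

/-- Relative nerves take objectwise trivial fibrations to trivial fibrations. To lift a simplex with
prescribed boundary, only its value at the last object of its chain has to be chosen, by lifting
against `∂Δ[n] ⟶ Δ[n]`: the other values are given by the boundary, or are images of this one. -/
theorem relNerveMap_trivFib (hp : ∀ i, P i → TrivFib (p.app i)) : TrivFib (relNerveMap P p) := by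
  classical
  refine trivFib_of_boundary fun n f g w ↦ ?_
  obtain ⟨y, hy⟩ : ∃ y : RelSimplex P B ⦋n⦌, g = SSet.yonedaEquiv.symm y :=
    ⟨SSet.yonedaEquiv g, (Equiv.symm_apply_apply _ _).symm⟩
  subst hy
  -- the given simplices on the boundary
  let e (m : SimplexCategory) (s : (∂Δ[n] : SSet.{u}).obj (op m)) : RelSimplex P E m := f.app _ s
  have he (m l : SimplexCategory) (φ : l ⟶ m) (s : (∂Δ[n] : SSet.{u}).obj (op m)) :
      e l ((∂Δ[n] : SSet.{u}).map φ.op s) = (e m s).pull φ := sset_naturality f φ s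
  have hw (m : SimplexCategory) (s : (∂Δ[n] : SSet.{u}).obj (op m)) :
      (relNerveMap P p).app _ (e m s) = y.pull (stdSimplex.objEquiv s.1) :=
    congrArg (fun k ↦ k.app (op m) s) w
  have hc (m : SimplexCategory) (s : (∂Δ[n] : SSet.{u}).obj (op m)) (a : Fin (m.len + 1)) :
      (e m s).c a = y.c ((stdSimplex.objEquiv s.1).toOrderHom a) :=
    congrArg (fun q : RelSimplex P B m ↦ q.c a) (hw m s)
  have hv (m : SimplexCategory) (s : (∂Δ[n] : SSet.{u}).obj (op m)) (i : I) (h h') :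
      (p.app i).app (op m) ((e m s).val i m (𝟙 m) h) =
        y.val i m (stdSimplex.objEquiv s.1) h' := by
    refine (RelSimplex.val_congr' (hw m s) i m (𝟙 m) h (by
      change Nonempty (y.c ((stdSimplex.objEquiv s.1).toOrderHom _) ⟶ i)
      exact h')).trans ?_
    exact y.val_congr (Category.id_comp _) _ _
  let z := y.c (Fin.last n)
  have hz (a : Fin (n + 1)) : Nonempty (y.c a ⟶ z) := y.mono _ _ (Fin.le_last a)
  have hz' (m : SimplexCategory) (s : (∂Δ[n] : SSet.{u}).obj (op m)) (a : Fin (m.len + 1)) :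
      Nonempty ((e m s).c a ⟶ z) := by rw [hc]; exact hz _
  have hval (l m : SimplexCategory) (φ : l ⟶ m) (s : (∂Δ[n] : SSet.{u}).obj (op m)) (i : I) (h h') :
      (e l ((∂Δ[n] : SSet.{u}).map φ.op s)).val i l (𝟙 l) h =
        (E.obj i).map φ.op ((e m s).val i m (𝟙 m) h') := by
    rw [RelSimplex.val_congr' (he m l φ s) i l (𝟙 l) h (by rw [he] at h; exact h),
      (e m s).map_val i l m φ (𝟙 m) h' (by rw [he] at h; exact h)]
    exact (e m s).val_congr (by rw [Category.id_comp, Category.comp_id]) _ _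
  -- lift the top simplex in the value at the last object of the chain
  let t₀ : (∂Δ[n] : SSet.{u}) ⟶ E.obj z :=
    mkHom (fun m s ↦ (e m s).val z m (𝟙 m) (hz' m s _)) fun φ s ↦ hval _ _ φ s z _ _
  obtain ⟨t, ht, ht'⟩ := (hp z (y.mem _)).exists_lift ∂Δ[n].ι t₀
    (SSet.yonedaEquiv.symm (y.val z ⦋n⦌ (𝟙 _) (hz _))) (by
      apply sset_hom_ext
      intro m s
      refine (hv m s z (hz' m s _) (hz _)).trans ?_
      refine Eq.trans ?_ (y.map_val z m ⦋n⦌ (stdSimplex.objEquiv s.1) (𝟙 _) (hz _) (hz _)).symm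
      exact y.val_congr (Category.comp_id _).symm _ _)
  let T (m : SimplexCategory) (φ : m ⟶ ⦋n⦌) : (E.obj z).obj (op m) :=
    t.app (op m) (stdSimplex.objEquiv.symm φ)
  have hT (l m : SimplexCategory) (ψ : l ⟶ m) (φ : m ⟶ ⦋n⦌) :
      (E.obj z).map ψ.op (T m φ) = T l (ψ ≫ φ) :=
    (sset_naturality t ψ (stdSimplex.objEquiv.symm φ)).symm
  have hT₀ (m : SimplexCategory) (s : (∂Δ[n] : SSet.{u}).obj (op m)) (h) :
      T m (stdSimplex.objEquiv s.1) = (e m s).val z m (𝟙 m) h :=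
    congrArg (fun k ↦ k.app (op m) s) ht
  have hT' (m : SimplexCategory) (φ : m ⟶ ⦋n⦌) :
      (p.app z).app (op m) (T m φ) = y.val z m φ (hz _) := by
    refine (congrArg (fun k ↦ k.app (op m) (stdSimplex.objEquiv.symm φ)) ht').trans ?_
    refine (y.map_val z m ⦋n⦌ φ (𝟙 _) (hz _) (hz _)).trans ?_
    exact y.val_congr (Category.comp_id _) _ _
  have hbd (m : SimplexCategory) (φ : m ⟶ ⦋n⦌)
      (hφ : ¬ φ.toOrderHom (Fin.last m.len) = Fin.last n) :
      stdSimplex.objEquiv.symm φ ∈ (∂Δ[n] : (Δ[n] : SSet.{u}).Subcomplex).obj (op m) := by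
    intro hs
    obtain ⟨a, ha⟩ := hs (Fin.last n)
    change φ.toOrderHom a = Fin.last n at ha
    refine hφ (le_antisymm (Fin.le_last _) ?_)
    rw [← ha]
    exact φ.toOrderHom.monotone (Fin.le_last a)
  have hcz (i : I) (m : SimplexCategory) (φ : m ⟶ ⦋n⦌)
      (hφ : ¬ φ.toOrderHom (Fin.last m.len) = Fin.last n)
      (h : Nonempty (y.c (φ.toOrderHom (Fin.last m.len)) ⟶ i)) :
      Nonempty ((e m ⟨stdSimplex.objEquiv.symm φ, hbd m φ hφ⟩).c (Fin.last m.len) ⟶ i) :=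
    ⟨eqToHom (hc m ⟨stdSimplex.objEquiv.symm φ, hbd m φ hφ⟩ _) ≫ h.some⟩
  let v (i : I) (m : SimplexCategory) (φ : m ⟶ ⦋n⦌)
      (h : Nonempty (y.c (φ.toOrderHom (Fin.last m.len)) ⟶ i)) : (E.obj i).obj (op m) :=
    if hφ : φ.toOrderHom (Fin.last m.len) = Fin.last n then
      (E.map (show Nonempty (z ⟶ i) by rw [hφ] at h; exact h).some).app (op m) (T m φ)
    else (e m ⟨stdSimplex.objEquiv.symm φ, hbd m φ hφ⟩).val i m (𝟙 m) (hcz i m φ hφ h)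
  have v₁ (i : I) (m : SimplexCategory) (φ : m ⟶ ⦋n⦌) (h) (k : z ⟶ i) :
      v i m φ h = (E.map k).app (op m) (T m φ) := by
    simp only [v]
    split_ifs with hφ
    · rw [Subsingleton.elim k]
    · exact (((e m _).val_map z i k m (𝟙 m) (hz' _ _ _) _).symm).trans
        (congrArg _ (hT₀ m ⟨stdSimplex.objEquiv.symm φ, hbd m φ hφ⟩ _).symm)
  have v₂ (i : I) (m : SimplexCategory) (s : (∂Δ[n] : SSet.{u}).obj (op m)) (h h') :
      v i m (stdSimplex.objEquiv s.1) h = (e m s).val i m (𝟙 m) h' := by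
    by_cases hφ : (stdSimplex.objEquiv s.1).toOrderHom (Fin.last m.len) = Fin.last n
    · rw [v₁ i m _ h (show Nonempty (z ⟶ i) by rw [hφ] at h; exact h).some, hT₀ m s (hz' _ _ _),
        (e m _).val_map z i _ m (𝟙 m)]
    · simp only [v, dif_neg hφ]
      rfl
  let q : RelSimplex P E ⦋n⦌ :=
    { c := y.c
      mono := y.mono
      mem := y.mem
      val := v
      map_val := fun i l m ψ φ h h' ↦ by
        by_cases hφ : φ.toOrderHom (Fin.last m.len) = Fin.last n
        · have k : Nonempty (z ⟶ i) := by rw [hφ] at h; exact h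
          rw [v₁ i m φ h k.some, v₁ i l _ h' k.some, ← sset_naturality, hT]
        · have e₁ := v₂ i m ⟨stdSimplex.objEquiv.symm φ, hbd m φ hφ⟩ h (hcz i m φ hφ h)
          have hk' : Nonempty ((e l ((∂Δ[n] : SSet.{u}).map ψ.op
              ⟨stdSimplex.objEquiv.symm φ, hbd m φ hφ⟩)).c (Fin.last l.len) ⟶ i) := by
            rw [hc]; exact h'
          have e₂ := v₂ i l ((∂Δ[n] : SSet.{u}).map ψ.op
            ⟨stdSimplex.objEquiv.symm φ, hbd m φ hφ⟩) h' hk'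
          exact (congrArg _ e₁).trans ((hval l m ψ _ i _ _).symm.trans e₂.symm)
      val_map := fun i j k m φ h h' ↦ by
        by_cases hφ : φ.toOrderHom (Fin.last m.len) = Fin.last n
        · have k' : Nonempty (z ⟶ i) := by rw [hφ] at h; exact h
          rw [v₁ i m φ h k'.some, v₁ j m _ h' (k'.some ≫ k), Functor.map_comp]
          rfl
        · have e₁ := v₂ i m ⟨stdSimplex.objEquiv.symm φ, hbd m φ hφ⟩ h (hcz i m φ hφ h)
          have e₂ := v₂ j m ⟨stdSimplex.objEquiv.symm φ, hbd m φ hφ⟩ h' (hcz j m φ hφ h')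
          exact (congrArg _ e₁).trans (((e m _).val_map i j k m (𝟙 m) _ _).trans e₂.symm) }
  refine ⟨SSet.yonedaEquiv.symm (show (relNerve P E).obj (op ⦋n⦌) from q), ?_, ?_⟩
  · apply sset_hom_ext
    intro m s
    refine RelSimplex.ext' (fun a ↦ (hc m s a).symm) fun i l ψ h h' ↦ ?_
    change v i l (ψ ≫ stdSimplex.objEquiv s.1) h = (e m s).val i l ψ h'
    have hk : Nonempty ((e l ((∂Δ[n] : SSet.{u}).map ψ.op s)).c (Fin.last l.len) ⟶ i) := by
      rw [hc]; exact h
    refine (v₂ i l ((∂Δ[n] : SSet.{u}).map ψ.op s) h hk).trans ?_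
    rw [RelSimplex.val_congr' (he m l ψ s) i l (𝟙 l) hk (by rw [he] at hk; exact hk)]
    exact (e m s).val_congr (Category.id_comp _) _ _
  · apply SSet.yonedaEquiv.injective
    rw [SSet.yonedaEquiv_comp, Equiv.apply_symm_apply]
    refine Eq.trans ?_ (Equiv.apply_symm_apply SSet.yonedaEquiv _).symm
    refine RelSimplex.ext' (fun a ↦ rfl) fun i m φ h h' ↦ ?_
    change (p.app i).app (op m) (v i m φ h) = y.val i m φ h'
    by_cases hφ : φ.toOrderHom (Fin.last m.len) = Fin.last n
    · have k : Nonempty (z ⟶ i) := by rw [hφ] at h; exact h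
      rw [v₁ i m φ h k.some]
      refine (congrArg (fun r ↦ r.app (op m) (T m φ)) (p.naturality k.some)).trans ?_
      refine (congrArg _ (hT' m φ)).trans ?_
      exact y.val_map z i k.some m φ _ _
    · exact (congrArg _ (v₂ i m ⟨stdSimplex.objEquiv.symm φ, hbd m φ hφ⟩ h (hcz i m φ hφ h))).trans
        (hv m _ i _ _)

/-- The simplex of a weight of chains given by a chain `c`, a simplicial operator `f`, and an object
`i` under the last object of the resulting chain. -/
def restrictChain {P : I → Prop} {m n : SimplexCategory} (c : (chainNerve.{u} P).obj (op n))
    (f : m ⟶ n) (i : I) (h : Nonempty (c.down.1 (f.toOrderHom (Fin.last m.len)) ⟶ i)) :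
    ((chainWeight.{u} P).obj i).obj (op m) :=
  ⟨⟨c.down.1 ∘ f.toOrderHom, ⟨fun _ _ h ↦ c.down.2.1 _ _ (f.toOrderHom.monotone h),
    fun _ ↦ c.down.2.2 _⟩,
    fun a ↦ ⟨(c.down.2.1 _ _ (f.toOrderHom.monotone (Fin.le_last a))).some ≫ h.some⟩⟩⟩

/-- The chains as a section of the relative nerve given by a map from the weight of chains. -/
def relNerveSection {P Q : I → Prop} (hPQ : ∀ x, P x → Q x) (e : chainWeight.{u} P ⟶ E) :
    chainNerve.{u} P ⟶ relNerve Q E :=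
  mkHom (fun n c ↦ (
    { c := c.down.1
      mono := c.down.2.1
      mem := fun a ↦ hPQ _ (c.down.2.2 a)
      val := fun i m f h ↦ (e.app i).app (op m) (restrictChain c f i h)
      map_val := fun i _ _ g f h _ ↦ (sset_naturality (e.app i) g (restrictChain c f i h)).symm
      val_map := fun i j k m f h _ ↦
        (congrArg (fun r : (chainWeight.{u} P).obj i ⟶ E.obj j ↦
          r.app (op m) (restrictChain c f i h)) (e.naturality k)).symm } : RelSimplex Q E n))
    (fun _ _ ↦ rfl)

/-- The weight of chains has the left lifting property against maps of diagrams that are trivial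
fibrations at the objects of the chains, relatively to a smaller weight of chains. -/
theorem exists_chainWeight_lift {P Q : I → Prop} (hPQ : ∀ x, P x → Q x)
    (hp : ∀ i, Q i → TrivFib (p.app i)) (e : chainWeight.{u} P ⟶ E) (b : chainWeight.{u} Q ⟶ B)
    (w : e ≫ p = chainWeightMap hPQ ≫ b) :
    ∃ l : chainWeight.{u} Q ⟶ E, chainWeightMap hPQ ≫ l = e ∧ l ≫ p = b := by
  obtain ⟨s, hs, hs'⟩ := (relNerveMap_trivFib hp).exists_lift (chainNerveMap hPQ)
    (relNerveSection hPQ e) (relNerveSection (fun _ ↦ id) b) (by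
      apply sset_hom_ext
      intro n c
      refine RelSimplex.ext' (fun a ↦ rfl) fun i m f h h' ↦ ?_
      exact congrArg (fun k ↦ (k.app i).app (op m) (restrictChain c f i h)) w)
  let S (n : SimplexCategory) (c : (chainNerve.{u} Q).obj (op n)) : RelSimplex Q E n := s.app _ c
  have hS (m n : SimplexCategory) (f : m ⟶ n) (c : (chainNerve.{u} Q).obj (op n)) :
      S m ((chainNerve.{u} Q).map f.op c) = (S n c).pull f := sset_naturality s f c
  have hS' (n : SimplexCategory) (c : (chainNerve.{u} Q).obj (op n)) :
      (relNerveMap Q p).app _ (S n c) = (relNerveSection (fun _ ↦ id) b).app _ c :=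
    congrArg (fun k ↦ k.app (op n) c) hs'
  have hc (n : SimplexCategory) (c : (chainNerve.{u} Q).obj (op n)) (a) :
      (S n c).c a = c.down.1 a :=
    congrArg (fun q : RelSimplex Q B n ↦ q.c a) (hS' n c)
  have hl (i : I) (m n : SimplexCategory) (c : ((chainWeight.{u} Q).obj i).obj (op n)) (f : m ⟶ n) :
      Nonempty ((S n ⟨c.down.1, c.down.2.1⟩).c (f.toOrderHom (Fin.last m.len)) ⟶ i) :=
    ⟨eqToHom (hc n ⟨c.down.1, c.down.2.1⟩ _) ≫ (c.down.2.2 _).some⟩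
  let l : chainWeight.{u} Q ⟶ E :=
    { app := fun i ↦ mkHom (fun n c ↦ (S n ⟨c.down.1, c.down.2.1⟩).val i n (𝟙 n) (hl i n n c _)) (by
        intro m n f c
        refine Eq.trans ?_ ((S n ⟨c.down.1, c.down.2.1⟩).map_val i m n f (𝟙 n) (hl i n n c _)
          (hl i m n c (f ≫ 𝟙 n))).symm
        refine (RelSimplex.val_congr' (hS m n f ⟨c.down.1, c.down.2.1⟩) i m (𝟙 m) _
          (hl i m n c (𝟙 m ≫ f))).trans ?_
        exact (S n _).val_congr (by rw [Category.id_comp, Category.comp_id]) _ _)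
      naturality := fun i j k ↦ by
        apply sset_hom_ext
        intro n c
        exact ((S n ⟨c.down.1, c.down.2.1⟩).val_map i j k n (𝟙 n) (hl i n n c _)
          (hl j n n (((chainWeight.{u} Q).map k).app _ c) _)).symm }
  refine ⟨l, ?_, ?_⟩
  · apply NatTrans.ext
    funext i
    apply sset_hom_ext
    intro n c
    have := congrArg (fun k ↦ k.app (op n) ⟨c.down.1, c.down.2.1⟩) hs
    exact RelSimplex.val_congr' this i n (𝟙 n) (hl i n n (((chainWeightMap hPQ).app i).app _ c) _)
      (c.down.2.2 _)
  · apply NatTrans.ext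
    funext i
    apply sset_hom_ext
    intro n c
    exact RelSimplex.val_congr' (hS' n ⟨c.down.1, c.down.2.1⟩) i n (𝟙 n) (hl i n n c _)
      (c.down.2.2 _)

end Lifting

/-! ### Mapping spaces of diagrams -/

section MapSpace

open SSet

variable {I : Type} [SmallCategory I]

/-- The mapping space of diagrams of simplicial sets. Its `n`-simplices are the natural
transformations `W × Δ[n] ⟶ F`. -/
def mapSpace (W F : I ⥤ SSet.{u}) : SSet.{u} :=
  (SSet.stdSimplex ⋙ Functor.const I ⋙ tensorLeft W).op ⋙ yoneda.obj F

namespace mapSpace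

variable (W F : I ⥤ SSet.{u})

/-- The evaluation of the mapping space. -/
def eval : W ⊗ (Functor.const I).obj (mapSpace W F) ⟶ F where
  app i := mkHom (fun n (q : (W.obj i).obj (op n) × (mapSpace W F).obj (op n)) ↦
      ((show W ⊗ (Functor.const I).obj (SSet.stdSimplex.obj n) ⟶ F from q.2).app i).app (op n)
        (q.1, stdSimplex.objEquiv.symm (𝟙 n))) (by
    rintro m n g ⟨w, φ⟩
    exact sset_naturality
      ((show W ⊗ (Functor.const I).obj (SSet.stdSimplex.obj n) ⟶ F from φ).app i)
      g (w, stdSimplex.objEquiv.symm (𝟙 n)))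
  naturality i j u := by
    apply sset_hom_ext
    rintro n ⟨w, φ⟩
    exact congrArg (fun k : (W ⊗ (Functor.const I).obj (SSet.stdSimplex.obj n)).obj i ⟶ F.obj j ↦
      k.app (op n) (w, stdSimplex.objEquiv.symm (𝟙 n)))
      ((show W ⊗ (Functor.const I).obj (SSet.stdSimplex.obj n) ⟶ F from φ).naturality u)

variable {W F} {K : SSet.{u}}

/-- The map of diagrams that corresponds to a map to the mapping space. -/
def uncurry (a : K ⟶ mapSpace W F) : W ⊗ (Functor.const I).obj K ⟶ F :=
  W ◁ (Functor.const I).map a ≫ eval W F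

/-- The map to the mapping space that corresponds to a map of diagrams. -/
def curry (β : W ⊗ (Functor.const I).obj K ⟶ F) : K ⟶ mapSpace W F :=
  mkHom (fun _ x ↦ W ◁ (Functor.const I).map (SSet.yonedaEquiv.symm x) ≫ β) (by
    intro m n g x
    change _ = W ◁ (Functor.const I).map (SSet.stdSimplex.map g) ≫ _ ≫ _
    rw [yonedaEquiv_symm_map, CategoryTheory.Functor.map_comp, MonoidalCategory.whiskerLeft_comp,
      Category.assoc]
    rfl)

theorem uncurry_curry (β : W ⊗ (Functor.const I).obj K ⟶ F) : uncurry (curry β) = β := by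
  apply NatTrans.ext
  funext i
  apply sset_hom_ext
  rintro n ⟨w, x⟩
  change (β.app i).app (op n) (w, K.map (𝟙 n).op x) = _
  rw [sset_map_id]

theorem app_eq_eval {n m : SimplexCategory} (φ : (mapSpace W F).obj (op n)) (i : I)
    (w : (W.obj i).obj (op m)) (s : m ⟶ n) :
    ((show W ⊗ (Functor.const I).obj (SSet.stdSimplex.obj n) ⟶ F from φ).app i).app (op m)
      (w, stdSimplex.objEquiv.symm s) =
      ((eval W F).app i).app (op m) (w, (mapSpace W F).map s.op φ) := by
  change _ = ((show W ⊗ (Functor.const I).obj (SSet.stdSimplex.obj n) ⟶ F from φ).app i).app (op m)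
    (w, stdSimplex.objEquiv.symm (𝟙 m ≫ s))
  rw [Category.id_comp]

theorem uncurry_injective {a b : K ⟶ mapSpace W F} (h : uncurry a = uncurry b) : a = b := by
  apply sset_hom_ext
  intro n x
  refine NatTrans.ext (funext fun i ↦ sset_hom_ext ?_)
  rintro m ⟨w, s⟩
  obtain ⟨s, rfl⟩ := stdSimplex.objEquiv.symm.surjective s
  refine (app_eq_eval (a.app _ x) i w s).trans (Eq.trans ?_ (app_eq_eval (b.app _ x) i w s).symm)
  rw [← sset_naturality, ← sset_naturality]
  exact congrArg (fun k ↦ (k.app i).app (op m) (w, K.map s.op x)) h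

theorem uncurry_comp {K' : SSet.{u}} (k : K' ⟶ K) (a : K ⟶ mapSpace W F) :
    uncurry (k ≫ a) = W ◁ (Functor.const I).map k ≫ uncurry a := by
  rw [uncurry, uncurry, CategoryTheory.Functor.map_comp, MonoidalCategory.whiskerLeft_comp,
    Category.assoc]

/-- Functoriality of the mapping space in the weight. -/
def pre {W W' : I ⥤ SSet.{u}} (θ : W' ⟶ W) (F : I ⥤ SSet.{u}) : mapSpace W F ⟶ mapSpace W' F :=
  curry (θ ▷ _ ≫ eval W F)

theorem uncurry_pre {W' : I ⥤ SSet.{u}} (a : K ⟶ mapSpace W F) (θ : W' ⟶ W) :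
    uncurry (a ≫ pre θ F) = θ ▷ _ ≫ uncurry a := by
  rw [uncurry_comp, pre, uncurry_curry, uncurry, whisker_exchange_assoc]

theorem pre_comp {W' W'' : I ⥤ SSet.{u}} (θ : W' ⟶ W) (θ' : W'' ⟶ W') :
    pre θ F ≫ pre θ' F = pre (θ' ≫ θ) F := by
  apply uncurry_injective
  have := uncurry_pre (pre θ F) θ'
  rw [this, pre, pre, uncurry_curry, uncurry_curry, comp_whiskerRight, Category.assoc]

theorem pre_id : pre (𝟙 W) F = 𝟙 _ := by
  apply uncurry_injective
  rw [pre, uncurry_curry, uncurry, CategoryTheory.Functor.map_id,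
    MonoidalCategory.whiskerLeft_id, id_whiskerRight]

end mapSpace

end MapSpace

/-! ### Mapping spaces out of weights of chains -/

section ChainMapSpace

open SSet modelCategoryQuillen

/-- The pushout product of `i` with any monomorphism has the left lifting property against `p`. -/
def HasTensorLift {A K E B : SSet.{u}} (i : A ⟶ K) (p : E ⟶ B) : Prop :=
  ∀ {X Y : SSet.{u}} (m : X ⟶ Y) [Mono m] (h : A ⊗ Y ⟶ E) (k : K ⊗ X ⟶ E) (l : K ⊗ Y ⟶ B),
    A ◁ m ≫ h = i ▷ X ≫ k → h ≫ p = i ▷ Y ≫ l → k ≫ p = K ◁ m ≫ l →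
    ∃ H : K ⊗ Y ⟶ E, i ▷ Y ≫ H = h ∧ K ◁ m ≫ H = k ∧ H ≫ p = l

theorem HasTensorLift.trivFib {A K E B : SSet.{u}} {i : A ⟶ K} {p : E ⟶ B}
    (hip : HasTensorLift i p) {T : SSet.{u}} {f : T ⟶ (ihom A).obj E} {s : T ⟶ (ihom K).obj B}
    (hT : IsPullback f s ((ihom A).map p) ((MonoidalClosed.pre i).app B))
    (g : (ihom K).obj E ⟶ T) (h₁ : g ≫ f = (MonoidalClosed.pre i).app E)
    (h₂ : g ≫ s = (ihom K).map p) : TrivFib g := by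
  intro X Y m (hm : Mono m)
  refine ⟨fun {a b} sq ↦ ?_⟩
  obtain ⟨H, e₁, e₂, e₃⟩ := hip m (MonoidalClosed.uncurry (b ≫ f)) (MonoidalClosed.uncurry a)
    (MonoidalClosed.uncurry (b ≫ s)) (by
      rw [← MonoidalClosed.uncurry_natural_left, ← sq.w_assoc, h₁]
      apply MonoidalClosed.curry_injective
      rw [MonoidalClosed.curry_uncurry, ← MonoidalClosed.curry_pre_app,
        MonoidalClosed.curry_uncurry]) (by
      rw [← MonoidalClosed.uncurry_natural_right, Category.assoc, hT.w]
      apply MonoidalClosed.curry_injective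
      rw [MonoidalClosed.curry_uncurry, ← MonoidalClosed.curry_pre_app,
        MonoidalClosed.curry_uncurry, Category.assoc]) (by
      rw [← MonoidalClosed.uncurry_natural_right, ← MonoidalClosed.uncurry_natural_left,
        ← sq.w_assoc, h₂])
  refine ⟨⟨⟨MonoidalClosed.curry H, ?_, hT.hom_ext ?_ ?_⟩⟩⟩
  · rw [← MonoidalClosed.curry_natural_left, e₂, MonoidalClosed.curry_uncurry]
  · rw [Category.assoc, h₁, MonoidalClosed.curry_pre_app, e₁, MonoidalClosed.curry_uncurry]
  · rw [Category.assoc, h₂, ← MonoidalClosed.curry_natural_right, e₃,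
      MonoidalClosed.curry_uncurry]

variable {I : Type} [SmallCategory I]

section

variable {W F : I ⥤ SSet.{u}} {K : SSet.{u}}

/-- The components of a map of diagrams from a tensor product with a simplicial set. -/
def tapp (δ : W ⊗ (Functor.const I).obj K ⟶ F) (j : I) : W.obj j ⊗ K ⟶ F.obj j := δ.app j

theorem tapp_ext {δ δ' : W ⊗ (Functor.const I).obj K ⟶ F} (h : ∀ j, tapp δ j = tapp δ' j) :
    δ = δ' :=
  NatTrans.ext (funext h)

theorem tapp_naturality (δ : W ⊗ (Functor.const I).obj K ⟶ F) {i j : I} (f : i ⟶ j) :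
    W.map f ▷ K ≫ tapp δ j = tapp δ i ≫ F.map f := δ.naturality f

theorem tapp_comp {G : I ⥤ SSet.{u}} (δ : W ⊗ (Functor.const I).obj K ⟶ F) (p : F ⟶ G) (j : I) :
    tapp (δ ≫ p) j = tapp δ j ≫ p.app j := rfl

theorem tapp_whiskerRight {W' : I ⥤ SSet.{u}} (θ : W' ⟶ W)
    (δ : W ⊗ (Functor.const I).obj K ⟶ F) (j : I) :
    tapp (θ ▷ _ ≫ δ) j = θ.app j ▷ K ≫ tapp δ j := rfl

theorem tapp_whiskerLeft {A : SSet.{u}} (i : A ⟶ K)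
    (δ : W ⊗ (Functor.const I).obj K ⟶ F) (j : I) :
    tapp (W ◁ (Functor.const I).map i ≫ δ) j = W.obj j ◁ i ≫ tapp δ j := rfl

/-- The transpose of a component of a map of diagrams. -/
def capp (δ : W ⊗ (Functor.const I).obj K ⟶ F) (j : I) : W.obj j ⟶ (ihom K).obj (F.obj j) :=
  MonoidalClosed.curry ((β_ K (W.obj j)).hom ≫ tapp δ j)

theorem capp_comp {G : I ⥤ SSet.{u}} (δ : W ⊗ (Functor.const I).obj K ⟶ F) (p : F ⟶ G) (j : I) :
    capp (δ ≫ p) j = capp δ j ≫ (ihom K).map (p.app j) := by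
  rw [capp, capp, tapp_comp, ← MonoidalClosed.curry_natural_right, Category.assoc]

theorem capp_whiskerRight {W' : I ⥤ SSet.{u}} (θ : W' ⟶ W)
    (δ : W ⊗ (Functor.const I).obj K ⟶ F) (j : I) :
    capp (θ ▷ _ ≫ δ) j = θ.app j ≫ capp δ j := by
  rw [capp, capp, tapp_whiskerRight, ← MonoidalClosed.curry_natural_left,
    BraidedCategory.braiding_naturality_right_assoc]

theorem capp_whiskerLeft {A : SSet.{u}} (i : A ⟶ K)
    (δ : W ⊗ (Functor.const I).obj K ⟶ F) (j : I) :
    capp (W ◁ (Functor.const I).map i ≫ δ) j =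
      capp δ j ≫ (MonoidalClosed.pre i).app (F.obj j) := by
  rw [capp, capp, tapp_whiskerLeft, MonoidalClosed.curry_pre_app,
    BraidedCategory.braiding_naturality_left_assoc]

/-- Currying of maps of diagrams. -/
def curryNat (δ : W ⊗ (Functor.const I).obj K ⟶ F) : W ⟶ F ⋙ ihom K where
  app := capp δ
  naturality i j f := by
    change W.map f ≫ capp δ j = capp δ i ≫ (ihom K).map (F.map f)
    rw [capp, capp, ← MonoidalClosed.curry_natural_left, ← MonoidalClosed.curry_natural_right,
      BraidedCategory.braiding_naturality_right_assoc, tapp_naturality, Category.assoc]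

theorem curryNat_surjective (l : W ⟶ F ⋙ ihom K) :
    ∃ δ : W ⊗ (Functor.const I).obj K ⟶ F, curryNat δ = l := by
  let v (j : I) : W.obj j ⟶ (ihom K).obj (F.obj j) := l.app j
  refine ⟨{ app := fun j ↦ (β_ (W.obj j) K).hom ≫ MonoidalClosed.uncurry (v j), naturality := ?_ },
    ?_⟩
  · intro i j f
    have h : W.map f ≫ v j = v i ≫ (ihom K).map (F.map f) := l.naturality f
    change W.map f ▷ K ≫ (β_ _ _).hom ≫ MonoidalClosed.uncurry (v j) =
      ((β_ _ _).hom ≫ MonoidalClosed.uncurry (v i)) ≫ F.map f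
    rw [BraidedCategory.braiding_naturality_left_assoc, ← MonoidalClosed.uncurry_natural_left, h,
      MonoidalClosed.uncurry_natural_right, Category.assoc]
  · apply NatTrans.ext
    funext j
    change MonoidalClosed.curry ((β_ _ _).hom ≫ (β_ _ _).hom ≫ MonoidalClosed.uncurry (v j)) = v j
    rw [SymmetricCategory.symmetry_assoc, MonoidalClosed.curry_uncurry]

theorem capp_ext {δ δ' : W ⊗ (Functor.const I).obj K ⟶ F} (h : ∀ j, capp δ j = capp δ' j) :
    δ = δ' := by
  refine tapp_ext fun j ↦ ?_
  have := MonoidalClosed.curry_injective (h j)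
  rwa [cancel_epi] at this

end

variable [Quiver.IsThin I]

/-- The weight of chains has the left lifting property against a map of diagrams, relatively to a
smaller weight of chains and a map `i` of simplicial sets, if the components of the map of diagrams
at the objects of the chains lift against the pushout products of `i` with monomorphisms. -/
theorem exists_chainWeight_tensor_lift {P Q : I → Prop} (hPQ : ∀ x, P x → Q x)
    {F G : I ⥤ SSet.{u}} (p : F ⟶ G) {A K : SSet.{u}} (i : A ⟶ K)
    (hip : ∀ j, Q j → HasTensorLift i (p.app j))
    (α : chainWeight Q ⊗ (Functor.const I).obj A ⟶ F)
    (δ : chainWeight P ⊗ (Functor.const I).obj K ⟶ F)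
    (β : chainWeight Q ⊗ (Functor.const I).obj K ⟶ G)
    (w : chainWeightMap hPQ ▷ _ ≫ α = _ ◁ (Functor.const I).map i ≫ δ)
    (w₁ : α ≫ p = _ ◁ (Functor.const I).map i ≫ β) (w₂ : δ ≫ p = chainWeightMap hPQ ▷ _ ≫ β) :
    ∃ H : chainWeight Q ⊗ (Functor.const I).obj K ⟶ F,
      _ ◁ (Functor.const I).map i ≫ H = α ∧ chainWeightMap hPQ ▷ _ ≫ H = δ ∧ H ≫ p = β := by
  have hP := IsPullback.of_hasPullback (Functor.whiskerRight p (ihom A))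
    (Functor.whiskerLeft G (MonoidalClosed.pre i))
  have hc : Functor.whiskerLeft F (MonoidalClosed.pre i) ≫ Functor.whiskerRight p (ihom A) =
      Functor.whiskerRight p (ihom K) ≫ Functor.whiskerLeft G (MonoidalClosed.pre i) := by
    apply NatTrans.ext
    funext j
    exact ((MonoidalClosed.pre i).naturality (p.app j)).symm
  have hg (j : I) (hj : Q j) : TrivFib ((hP.lift _ _ hc).app j) :=
    HasTensorLift.trivFib (hip j hj) (hP.map ((evaluation I SSet.{u}).obj j)) _
      (congrArg (fun k ↦ k.app j) (hP.lift_fst _ _ hc))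
      (congrArg (fun k ↦ k.app j) (hP.lift_snd _ _ hc))
  obtain ⟨l, hl, hl'⟩ := exists_chainWeight_lift hPQ hg (curryNat δ)
    (hP.lift (curryNat α) (curryNat β) (by
      apply NatTrans.ext
      funext j
      exact (capp_comp α p j).symm.trans
        ((congrArg (fun k ↦ capp k j) w₁).trans (capp_whiskerLeft i β j)))) (by
    apply hP.hom_ext
    · rw [Category.assoc, Category.assoc, hP.lift_fst, hP.lift_fst]
      apply NatTrans.ext
      funext j
      exact (capp_whiskerLeft i δ j).symm.trans
        ((congrArg (fun k ↦ capp k j) w.symm).trans (capp_whiskerRight (chainWeightMap hPQ) α j))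
    · rw [Category.assoc, Category.assoc, hP.lift_snd, hP.lift_snd]
      apply NatTrans.ext
      funext j
      exact (capp_comp δ p j).symm.trans
        ((congrArg (fun k ↦ capp k j) w₂).trans (capp_whiskerRight (chainWeightMap hPQ) β j)))
  obtain ⟨H, rfl⟩ := curryNat_surjective l
  refine ⟨H, capp_ext fun j ↦ ?_, capp_ext fun j ↦ ?_, capp_ext fun j ↦ ?_⟩
  · have h := congrArg (fun k ↦ k ≫ Limits.pullback.fst _ _) hl'
    simp only [Category.assoc] at h
    rw [hP.lift_fst, hP.lift_fst] at h
    exact (capp_whiskerLeft i H j).trans (congrArg (fun k ↦ k.app j) h)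
  · exact (capp_whiskerRight (chainWeightMap hPQ) H j).trans (congrArg (fun k ↦ k.app j) hl)
  · have h := congrArg (fun k ↦ k ≫ Limits.pullback.snd _ _) hl'
    simp only [Category.assoc] at h
    rw [hP.lift_snd, hP.lift_snd] at h
    exact (capp_comp H p j).trans (congrArg (fun k ↦ k.app j) h)

end ChainMapSpace

section ChainMapSpaceHomotopy

open SSet modelCategoryQuillen

variable {I : Type} [SmallCategory I]

/-- The mapping space out of the weight of chains of objects that satisfy `P`: a model for the
homotopy limit of the restriction of `F` to these objects. -/
abbrev chainMap (P : I → Prop) (F : I ⥤ SSet.{u}) : SSet.{u} := mapSpace (chainWeight P) F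

/-- Restriction of mapping spaces to smaller weights of chains. -/
abbrev chainRes {P Q : I → Prop} (h : ∀ x, P x → Q x) (F : I ⥤ SSet.{u}) :
    chainMap Q F ⟶ chainMap P F :=
  mapSpace.pre (chainWeightMap h) F

theorem chainRes_comp {P Q R : I → Prop} (h : ∀ x, P x → Q x) (h' : ∀ x, Q x → R x)
    (F : I ⥤ SSet.{u}) :
    chainRes h' F ≫ chainRes h F = chainRes (fun x hx ↦ h' x (h x hx)) F :=
  mapSpace.pre_comp _ _

theorem chainRes_self {P : I → Prop} (h : ∀ x, P x → P x) (F : I ⥤ SSet.{u}) :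
    chainRes h F = 𝟙 _ :=
  mapSpace.pre_id

/-- The map out of an empty weight. -/
def emptyWeightElim (K : SSet.{u}) (F : I ⥤ SSet.{u}) :
    chainWeight (fun _ : I ↦ False) ⊗ (Functor.const I).obj K ⟶ F where
  app i := mkHom (fun _ (q : ((chainWeight (fun _ : I ↦ False)).obj i ⊗ K).obj _) ↦
    (q.1.down.2.1.2 0).elim) (by rintro m n f ⟨q, x⟩; exact (q.down.2.1.2 0).elim)
  naturality i j f := by
    apply sset_hom_ext
    rintro n ⟨q, x⟩
    exact (q.down.2.1.2 0).elim

theorem emptyWeight_ext {K : SSet.{u}} {F : I ⥤ SSet.{u}}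
    (f g : chainWeight (fun _ : I ↦ False) ⊗ (Functor.const I).obj K ⟶ F) : f = g := by
  refine tapp_ext fun j ↦ sset_hom_ext ?_
  rintro n ⟨q, x⟩
  exact (q.down.2.1.2 0).elim

variable [Quiver.IsThin I] {F G : I ⥤ SSet.{u}}

/-- Relative extension of maps out of weights of chains along an anodyne extension. -/
theorem exists_chain_extension_of_anodyne {P Q : I → Prop} (hPQ : ∀ x, P x → Q x)
    (hF : ∀ i, KanComplex (F.obj i)) {A K : SSet.{u}} (i : A ⟶ K) (hi : anodyneExtensions i)
    (α : chainWeight Q ⊗ (Functor.const I).obj A ⟶ F)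
    (δ : chainWeight P ⊗ (Functor.const I).obj K ⟶ F)
    (w : chainWeightMap hPQ ▷ _ ≫ α = _ ◁ (Functor.const I).map i ≫ δ) :
    ∃ H : chainWeight Q ⊗ (Functor.const I).obj K ⟶ F,
      _ ◁ (Functor.const I).map i ≫ H = α ∧ chainWeightMap hPQ ▷ _ ≫ H = δ := by
  let p : F ⟶ (Functor.const I).obj (⊤_ SSet.{u}) :=
    { app := fun j ↦ Limits.terminal.from (F.obj j)
      naturality := fun _ _ _ ↦ Limits.terminal.hom_ext _ _ }
  have ht {X : I ⥤ SSet.{u}} (f g : X ⟶ (Functor.const I).obj (⊤_ SSet.{u})) : f = g :=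
    NatTrans.ext (funext fun _ ↦ Limits.terminal.hom_ext _ _)
  obtain ⟨H, h₁, h₂, -⟩ := exists_chainWeight_tensor_lift hPQ p i (fun j _ X Y m _ h k l e _ _ ↦ by
    have := hF j
    obtain ⟨H, h₁, h₂⟩ := exists_tensor_lift_of_anodyne i hi m h k e
    exact ⟨H, h₁, h₂, Limits.terminal.hom_ext _ _⟩) α δ
    { app := fun j ↦ Limits.terminal.from _, naturality := fun _ _ _ ↦ Limits.terminal.hom_ext _ _ }
    w (ht _ _) (ht _ _)
  exact ⟨H, h₁, h₂⟩

theorem chainRes_fibration {P Q : I → Prop} (hPQ : ∀ x, P x → Q x)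
    (hF : ∀ i, KanComplex (F.obj i)) : Fibration (chainRes hPQ F) := by
  rw [fibration_iff]
  intro A K i hi
  replace hi : anodyneExtensions i := by
    rw [anodyneExtensions_eq_llp_rlp]
    exact MorphismProperty.le_llp_rlp _ _ hi
  refine ⟨fun {a b} sq ↦ ?_⟩
  obtain ⟨H, h₁, h₂⟩ := exists_chain_extension_of_anodyne hPQ hF i hi (mapSpace.uncurry a)
    (mapSpace.uncurry b) (by rw [← mapSpace.uncurry_pre, sq.w, mapSpace.uncurry_comp])
  refine ⟨⟨⟨mapSpace.curry H, mapSpace.uncurry_injective ?_, mapSpace.uncurry_injective ?_⟩⟩⟩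
  · rw [mapSpace.uncurry_comp, mapSpace.uncurry_curry, h₁]
  · rw [mapSpace.uncurry_pre, mapSpace.uncurry_curry, h₂]

theorem chainMap_kanComplex (Q : I → Prop) (hF : ∀ i, KanComplex (F.obj i)) :
    KanComplex (chainMap Q F) := by
  have : Fibration (Limits.terminal.from (chainMap Q F)) := by
    rw [fibration_iff]
    intro A K i hi
    replace hi : anodyneExtensions i := by
      rw [anodyneExtensions_eq_llp_rlp]
      exact MorphismProperty.le_llp_rlp _ _ hi
    refine ⟨fun {a b} sq ↦ ?_⟩
    obtain ⟨H, h₁, -⟩ := exists_chain_extension_of_anodyne (P := fun _ ↦ False)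
      (fun _ ↦ False.elim) hF i hi (mapSpace.uncurry a) (emptyWeightElim _ _) (emptyWeight_ext _ _)
    refine ⟨⟨⟨mapSpace.curry H, mapSpace.uncurry_injective ?_, Limits.terminal.hom_ext _ _⟩⟩⟩
    rw [mapSpace.uncurry_comp, mapSpace.uncurry_curry, h₁]
  exact (isFibrant_iff _).2 this

end ChainMapSpaceHomotopy

section Union

open SSet

variable {I : Type} [SmallCategory I] {P Q : I → Prop} {F : I ⥤ SSet.{u}} {K : SSet.{u}}

open Classical in
/-- The value of two maps of diagrams, glued on a chain of objects that satisfy `P` or `Q`. -/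
def glueVal (hP : ∀ x y, (x ⟶ y) → P x → P y) (hQ : ∀ x y, (x ⟶ y) → Q x → Q y)
    (α : chainWeight P ⊗ (Functor.const I).obj K ⟶ F)
    (β : chainWeight Q ⊗ (Functor.const I).obj K ⟶ F) (i : I) (n : SimplexCategory)
    (q : ((chainWeight.{u} fun x ↦ P x ∨ Q x).obj i ⊗ K).obj (op n)) : (F.obj i).obj (op n) :=
  if h : P (q.1.down.1 0) then
    (tapp α i).app (op n) (⟨⟨q.1.down.1, ⟨q.1.down.2.1.1, fun a ↦
      hP _ _ (q.1.down.2.1.1 0 a (Fin.zero_le a)).some h⟩, q.1.down.2.2⟩⟩, q.2)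
  else
    (tapp β i).app (op n) (⟨⟨q.1.down.1, ⟨q.1.down.2.1.1, fun a ↦
      hQ _ _ (q.1.down.2.1.1 0 a (Fin.zero_le a)).some ((q.1.down.2.1.2 0).resolve_left h)⟩,
      q.1.down.2.2⟩⟩, q.2)

section

variable {hP : ∀ x y, (x ⟶ y) → P x → P y} {hQ : ∀ x y, (x ⟶ y) → Q x → Q y}
  {α : chainWeight P ⊗ (Functor.const I).obj K ⟶ F}
  {β : chainWeight Q ⊗ (Functor.const I).obj K ⟶ F}

theorem glueVal_left {i : I} {n : SimplexCategory} (c : ((chainWeight.{u} P).obj i).obj (op n))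
    (x : K.obj (op n)) :
    glueVal hP hQ α β i n (((chainWeightMap fun _ ↦ Or.inl).app i).app (op n) c, x) =
      (tapp α i).app (op n) (c, x) :=
  dif_pos (c.down.2.1.2 0)

theorem glueVal_right
    (w : chainWeightMap (P := fun x ↦ P x ∧ Q x) (fun _ ↦ And.left) ▷ _ ≫ α =
      chainWeightMap (P := fun x ↦ P x ∧ Q x) (fun _ ↦ And.right) ▷ _ ≫ β)
    {i : I} {n : SimplexCategory} (c : ((chainWeight.{u} Q).obj i).obj (op n))
    (x : K.obj (op n)) :
    glueVal hP hQ α β i n (((chainWeightMap fun _ ↦ Or.inr).app i).app (op n) c, x) =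
      (tapp β i).app (op n) (c, x) := by
  by_cases h : P (c.down.1 0)
  · refine (dif_pos h).trans ?_
    let c' : ((chainWeight.{u} fun x ↦ P x ∧ Q x).obj i).obj (op n) :=
      ⟨⟨c.down.1, ⟨c.down.2.1.1, fun a ↦
        ⟨hP _ _ (c.down.2.1.1 0 a (Fin.zero_le a)).some h, c.down.2.1.2 a⟩⟩, c.down.2.2⟩⟩
    exact congrArg (fun k ↦ (tapp k i).app (op n) (c', x)) w
  · exact dif_neg h

/-- Two maps of diagrams on weights of chains that agree on the chains they have in common, glued
to a map on the union of the weights. -/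
def glueChain (hP : ∀ x y, (x ⟶ y) → P x → P y) (hQ : ∀ x y, (x ⟶ y) → Q x → Q y)
    (α : chainWeight P ⊗ (Functor.const I).obj K ⟶ F)
    (β : chainWeight Q ⊗ (Functor.const I).obj K ⟶ F)
    (w : chainWeightMap (P := fun x ↦ P x ∧ Q x) (fun _ ↦ And.left) ▷ _ ≫ α =
      chainWeightMap (P := fun x ↦ P x ∧ Q x) (fun _ ↦ And.right) ▷ _ ≫ β) :
    chainWeight (fun x ↦ P x ∨ Q x) ⊗ (Functor.const I).obj K ⟶ F where
  app i := mkHom (glueVal hP hQ α β i) (by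
    rintro m n f ⟨⟨c, ⟨hc, hPQ⟩, hi⟩, x⟩
    by_cases h : P (c 0)
    · let c' : ((chainWeight.{u} P).obj i).obj (op n) := ⟨⟨c, ⟨hc, fun a ↦
        hP _ _ (hc 0 a (Fin.zero_le a)).some h⟩, hi⟩⟩
      refine (glueVal_left (hP := hP) (hQ := hQ) (((chainWeight.{u} P).obj i).map f.op c')
        (K.map f.op x)).trans ?_
      exact (sset_naturality (tapp α i) f (c', x)).trans
        (congrArg _ (glueVal_left (hP := hP) (hQ := hQ) c' x).symm)
    · let c' : ((chainWeight.{u} Q).obj i).obj (op n) := ⟨⟨c, ⟨hc, fun a ↦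
        hQ _ _ (hc 0 a (Fin.zero_le a)).some ((hPQ 0).resolve_left h)⟩, hi⟩⟩
      refine (glueVal_right (hP := hP) (hQ := hQ) w (((chainWeight.{u} Q).obj i).map f.op c')
        (K.map f.op x)).trans ?_
      exact (sset_naturality (tapp β i) f (c', x)).trans
        (congrArg _ (glueVal_right (hP := hP) (hQ := hQ) w c' x).symm))
  naturality i j f := by
    apply sset_hom_ext
    rintro n ⟨⟨c, ⟨hc, hPQ⟩, hi⟩, x⟩
    by_cases h : P (c 0)
    · let c' : ((chainWeight.{u} P).obj i).obj (op n) := ⟨⟨c, ⟨hc, fun a ↦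
        hP _ _ (hc 0 a (Fin.zero_le a)).some h⟩, hi⟩⟩
      refine (glueVal_left (hP := hP) (hQ := hQ) (((chainWeight.{u} P).map f).app _ c') x).trans ?_
      exact (congrArg (fun k ↦ k.app (op n) (c', x)) (tapp_naturality α f)).trans
        (congrArg (fun z ↦ (F.map f).app (op n) z) (glueVal_left (hP := hP) (hQ := hQ) c' x).symm)
    · let c' : ((chainWeight.{u} Q).obj i).obj (op n) := ⟨⟨c, ⟨hc, fun a ↦
        hQ _ _ (hc 0 a (Fin.zero_le a)).some ((hPQ 0).resolve_left h)⟩, hi⟩⟩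
      refine (glueVal_right (hP := hP) (hQ := hQ) w (((chainWeight.{u} Q).map f).app _ c')
        x).trans ?_
      exact (congrArg (fun k ↦ k.app (op n) (c', x)) (tapp_naturality β f)).trans
        (congrArg (fun z ↦ (F.map f).app (op n) z)
          (glueVal_right (hP := hP) (hQ := hQ) w c' x).symm)

end

/-- A chain of objects that satisfy `P` or `Q` consists of objects that satisfy `P`, or of objects
that satisfy `Q`. Hence mapping spaces out of weights of chains take unions to strict pullbacks. -/
theorem isPullback_chainRes (hP : ∀ x y, (x ⟶ y) → P x → P y) (hQ : ∀ x y, (x ⟶ y) → Q x → Q y)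
    (F : I ⥤ SSet.{u}) :
    IsPullback (chainRes (Q := fun x ↦ P x ∨ Q x) (fun _ ↦ Or.inl) F) (chainRes (fun _ ↦ Or.inr) F)
      (chainRes (P := fun x ↦ P x ∧ Q x) (fun _ ↦ And.left) F)
      (chainRes (P := fun x ↦ P x ∧ Q x) (fun _ ↦ And.right) F) := by
  refine IsPullback.of_isLimit' ⟨by rw [chainRes_comp, chainRes_comp]⟩
    (Limits.PullbackCone.IsLimit.mk _
      (fun s ↦ mapSpace.curry (glueChain hP hQ (mapSpace.uncurry s.fst) (mapSpace.uncurry s.snd) (by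
        rw [← mapSpace.uncurry_pre, ← mapSpace.uncurry_pre, s.condition]))) ?_ ?_ ?_)
  · intro s
    apply mapSpace.uncurry_injective
    rw [mapSpace.uncurry_pre, mapSpace.uncurry_curry]
    refine tapp_ext fun i ↦ sset_hom_ext ?_
    rintro n ⟨c, x⟩
    exact glueVal_left (hP := hP) (hQ := hQ) c x
  · intro s
    apply mapSpace.uncurry_injective
    rw [mapSpace.uncurry_pre, mapSpace.uncurry_curry]
    refine tapp_ext fun i ↦ sset_hom_ext ?_
    rintro n ⟨c, x⟩
    exact glueVal_right (hP := hP) (hQ := hQ) (by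
      rw [← mapSpace.uncurry_pre, ← mapSpace.uncurry_pre, s.condition]) c x
  · intro s m h₁ h₂
    apply mapSpace.uncurry_injective
    rw [mapSpace.uncurry_curry]
    refine tapp_ext fun i ↦ sset_hom_ext ?_
    rintro n ⟨⟨c, ⟨hc, hPQ⟩, hi⟩, x⟩
    by_cases h : P (c 0)
    · let c' : ((chainWeight.{u} P).obj i).obj (op n) := ⟨⟨c, ⟨hc, fun a ↦
        hP _ _ (hc 0 a (Fin.zero_le a)).some h⟩, hi⟩⟩
      refine Eq.trans ?_ (glueVal_left (hP := hP) (hQ := hQ) c' x).symm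
      rw [← h₁, mapSpace.uncurry_pre]
      rfl
    · let c' : ((chainWeight.{u} Q).obj i).obj (op n) := ⟨⟨c, ⟨hc, fun a ↦
        hQ _ _ (hc 0 a (Fin.zero_le a)).some ((hPQ 0).resolve_left h)⟩, hi⟩⟩
      refine Eq.trans ?_ (glueVal_right (hP := hP) (hQ := hQ) (by
        rw [← mapSpace.uncurry_pre, ← mapSpace.uncurry_pre, s.condition]) c' x).symm
      rw [← h₂, mapSpace.uncurry_pre]
      rfl

end Union

/-! ### Mapping spaces out of weights of chains with a first object -/

section Initial

open SSet

variable {I : Type} [SmallCategory I] [Quiver.IsThin I] {P : I → Prop} (j : I)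
  (hj : ∀ x, P x → Nonempty (j ⟶ x)) (F : I ⥤ SSet.{u})

theorem map_thin {i i' : I} (f g : i ⟶ i') : F.map f = F.map g := by rw [Subsingleton.elim f g]

/-- The map of diagrams underlying `fromValue`. -/
def fromValueNat : chainWeight P ⊗ (Functor.const I).obj (F.obj j) ⟶ F where
  app i := mkHom (fun n (q : ((chainWeight.{u} P).obj i ⊗ F.obj j).obj (op n)) ↦
      (F.map ((hj _ (q.1.down.2.1.2 0)).some ≫ (q.1.down.2.2 0).some)).app (op n) q.2) (by
    rintro m n f ⟨c, x⟩
    refine Eq.trans ?_ (sset_naturality _ f x)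
    exact congrArg (fun k : F.obj j ⟶ F.obj i ↦ k.app (op m) ((F.obj j).map f.op x))
      (map_thin F _ _))
  naturality i i' f := by
    apply sset_hom_ext
    rintro n ⟨c, x⟩
    refine Eq.trans ?_ (congrArg (fun k ↦ k.app (op n) x) (F.map_comp _ _))
    exact congrArg (fun k : F.obj j ⟶ F.obj i' ↦ k.app (op n) x) (map_thin F _ _)

theorem fromValueNat_app {i : I} {n : SimplexCategory} (c : ((chainWeight.{u} P).obj i).obj (op n))
    (x : (F.obj j).obj (op n)) (f : j ⟶ i) :
    (tapp (fromValueNat j hj F) i).app (op n) (c, x) = (F.map f).app (op n) x :=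
  congrArg (fun k : F.obj j ⟶ F.obj i ↦ k.app (op n) x) (map_thin F _ _)

/-- The map from the value at an object `j` under all objects that satisfy `P` to the mapping
space. -/
def fromValue : F.obj j ⟶ chainMap P F := mapSpace.curry (fromValueNat j hj F)

theorem fromValue_res {Q : I → Prop} (h : ∀ x, Q x → P x) :
    fromValue j hj F ≫ chainRes h F = fromValue j (fun x hx ↦ hj x (h x hx)) F := by
  apply mapSpace.uncurry_injective
  rw [mapSpace.uncurry_pre, fromValue, fromValue, mapSpace.uncurry_curry, mapSpace.uncurry_curry]
  rfl

theorem map_fromValue {j' : I} (f : j' ⟶ j) :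
    F.map f ≫ fromValue j hj F = fromValue j' (fun x hx ↦ ⟨f ≫ (hj x hx).some⟩) F := by
  apply mapSpace.uncurry_injective
  rw [mapSpace.uncurry_comp, fromValue, fromValue, mapSpace.uncurry_curry, mapSpace.uncurry_curry]
  refine tapp_ext fun i ↦ sset_hom_ext ?_
  rintro n ⟨c, x⟩
  have g := (hj _ (c.down.2.1.2 0)).some ≫ (c.down.2.2 0).some
  refine (fromValueNat_app j hj F c _ g).trans ?_
  refine Eq.trans ?_ (fromValueNat_app j' _ F c x (f ≫ g)).symm
  exact (congrArg (fun k ↦ k.app (op n) x) (F.map_comp f g)).symm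

variable {F}

/-- The chain that is constant at `j`. -/
def constChain (hP : P j) (i : I) (f : j ⟶ i) (n : SimplexCategory) :
    ((chainWeight.{u} P).obj i).obj (op n) :=
  ⟨⟨fun _ ↦ j, ⟨fun _ _ _ ↦ ⟨𝟙 _⟩, fun _ ↦ hP⟩, fun _ ↦ ⟨f⟩⟩⟩

/-- The chain that is `j` where `t` is zero and `c` where `t` is one. -/
def mixChain (hP : P j) (i : I) (n : SimplexCategory) (c : ((chainWeight.{u} P).obj i).obj (op n))
    (t : (Δ[1] : SSet.{u}).obj (op n)) : ((chainWeight.{u} P).obj i).obj (op n) :=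
  ⟨⟨fun a ↦ if stdVal t a = 0 then j else c.down.1 a, ⟨fun a b hab ↦ by
      by_cases hb : stdVal t b = 0
      · have ha : stdVal t a = 0 := le_antisymm (hb ▸ stdVal_mono t hab) (Fin.zero_le _)
        simp only [ha, hb, if_true]
        exact ⟨𝟙 _⟩
      · simp only [hb, if_false]
        split_ifs
        · exact hj _ (c.down.2.1.2 b)
        · exact c.down.2.1.1 a b hab,
    fun a ↦ by
      change P (if stdVal t a = 0 then j else c.down.1 a)
      split_ifs
      · exact hP
      · exact c.down.2.1.2 a⟩, fun a ↦ by
      change Nonempty ((if stdVal t a = 0 then j else c.down.1 a) ⟶ i)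
      split_ifs
      · exact ⟨(hj _ (c.down.2.1.2 a)).some ≫ (c.down.2.2 a).some⟩
      · exact c.down.2.2 a⟩⟩

/-- If `j` itself satisfies `P`, then every chain can be extended by `j` at its beginning. This
deforms the mapping space to the value at `j`. -/
theorem isHomotopyEquiv_fromValue (hP : P j) : IsHomotopyEquiv (fromValue j hj F) := by
  let e : chainMap P F ⟶ F.obj j :=
    mkHom (fun n φ ↦ (tapp (mapSpace.eval _ F) j).app (op n) (constChain j hP j (𝟙 j) n, φ))
      fun f φ ↦ sset_naturality (tapp (mapSpace.eval _ F) j) f (constChain j hP j (𝟙 j) _, φ)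
  have he (n : SimplexCategory) (x : (F.obj j).obj (op n)) (f : j ⟶ j) :
      (F.map f).app (op n) x = x := by
    rw [Subsingleton.elim f (𝟙 j), CategoryTheory.Functor.map_id]
    rfl
  refine ⟨e, ?_, ?_⟩
  · have : fromValue j hj F ≫ e = 𝟙 _ := by
      apply sset_hom_ext
      intro n x
      exact (congrArg (fun k ↦ (tapp k j).app (op n) (constChain j hP j (𝟙 j) n, x))
        (mapSpace.uncurry_curry (fromValueNat j hj F))).trans (he n x _)
    rw [this]
    exact Homotopic.refl _
  · refine (homotopic_iff _ _).2 ⟨mapSpace.curry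
      { app := fun i ↦ mkHom (fun n (q : ((chainWeight.{u} P).obj i ⊗ (chainMap P F ⊗ Δ[1])).obj
          (op n)) ↦ (tapp (mapSpace.eval _ F) i).app (op n)
          (mixChain j hj hP i n q.1 q.2.2, q.2.1)) ?_
        naturality := ?_ }, mapSpace.uncurry_injective ?_, mapSpace.uncurry_injective ?_⟩
    · rintro m n f ⟨c, φ, t⟩
      exact sset_naturality (tapp (mapSpace.eval _ F) i) f (mixChain j hj hP i n c t, φ)
    · intro i i' f
      apply sset_hom_ext
      rintro n ⟨c, φ, t⟩
      exact congrArg (fun k ↦ k.app (op n) (mixChain j hj hP i n c t, φ))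
        (tapp_naturality (mapSpace.eval (chainWeight P) F) f)
    · rw [mapSpace.uncurry_comp, mapSpace.uncurry_curry, mapSpace.uncurry_comp, fromValue,
        mapSpace.uncurry_curry]
      refine tapp_ext fun i ↦ sset_hom_ext ?_
      rintro n ⟨c, φ⟩
      have f := (hj _ (c.down.2.1.2 0)).some ≫ (c.down.2.2 0).some
      refine Eq.trans ?_ (fromValueNat_app j hj F c _ f).symm
      exact congrArg (fun k ↦ k.app (op n) (constChain j hP j (𝟙 j) n, φ))
        (tapp_naturality (mapSpace.eval (chainWeight P) F) f)
    · rw [mapSpace.uncurry_comp, mapSpace.uncurry_curry]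
      refine tapp_ext fun i ↦ sset_hom_ext ?_
      rintro n ⟨c, φ⟩
      rfl

end Initial

/-! ### Mapping spaces out of unions of weights of chains -/

section UnionHomotopy

open SSet modelCategoryQuillen

variable {I : Type} [SmallCategory I] {F : I ⥤ SSet.{u}}

theorem isIso_chainRes {P Q : I → Prop} (h : ∀ x, P x → Q x) (h' : ∀ x, Q x → P x) :
    IsIso (chainRes h F) :=
  ⟨chainRes h' F, by rw [chainRes_comp, chainRes_self], by rw [chainRes_comp, chainRes_self]⟩

theorem isHomotopyEquiv_chainRes_of_iff {P Q : I → Prop} (h : ∀ x, P x → Q x)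
    (h' : ∀ x, Q x → P x) : IsHomotopyEquiv (chainRes h F) :=
  have := isIso_chainRes (F := F) h h'
  isHomotopyEquiv_of_isIso _

/-- The map from the mapping space out of a union of weights to the homotopy pullback. -/
def unionMap (P Q : I → Prop) (F : I ⥤ SSet.{u}) : chainMap (fun x ↦ P x ∨ Q x) F ⟶
    hoPullback (chainRes (P := fun x ↦ P x ∧ Q x) (fun _ ↦ And.left) F)
      (chainRes (P := fun x ↦ P x ∧ Q x) (fun _ ↦ And.right) F) :=
  hoPullback.ofComm _ _ (chainRes (fun _ ↦ Or.inl) F) (chainRes (fun _ ↦ Or.inr) F)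
    (by rw [chainRes_comp, chainRes_comp])

variable [Quiver.IsThin I] {P Q : I → Prop}

theorem isHomotopyEquiv_unionMap (hF : ∀ i, KanComplex (F.obj i))
    (hP : ∀ x y, (x ⟶ y) → P x → P y) (hQ : ∀ x y, (x ⟶ y) → Q x → Q y) :
    IsHomotopyEquiv (unionMap P Q F) :=
  have := chainRes_fibration (P := fun x ↦ P x ∧ Q x) (fun _ ↦ And.right) hF
  hoPullback.isHomotopyEquiv_ofComm_of_isPullback (isPullback_chainRes hP hQ F)

/-- If the mapping spaces out of two weights of chains and out of their intersection are given by
values of the diagram, then the mapping space out of the union is given by the homotopy pullback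
of these values. -/
theorem isHomotopyEquiv_fromValue_union_iff (hF : ∀ i, KanComplex (F.obj i))
    (hP : ∀ x y, (x ⟶ y) → P x → P y) (hQ : ∀ x y, (x ⟶ y) → Q x → Q y) {j j₁ j₂ j₀ : I}
    (f : j ⟶ j₁) (g : j ⟶ j₂) (p : j₁ ⟶ j₀) (q : j₂ ⟶ j₀)
    (h : ∀ x, P x ∨ Q x → Nonempty (j ⟶ x))
    (h₁ : ∀ x, P x → Nonempty (j₁ ⟶ x)) (h₂ : ∀ x, Q x → Nonempty (j₂ ⟶ x))
    (h₀ : ∀ x, P x ∧ Q x → Nonempty (j₀ ⟶ x)) (e₁ : IsHomotopyEquiv (fromValue j₁ h₁ F))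
    (e₂ : IsHomotopyEquiv (fromValue j₂ h₂ F)) (e₀ : IsHomotopyEquiv (fromValue j₀ h₀ F)) :
    IsHomotopyEquiv (fromValue j h F) ↔
      IsHomotopyEquiv (hoPullback.ofComm (F.map p) (F.map q) (F.map f) (F.map g)
        (by rw [← F.map_comp, ← F.map_comp]; exact map_thin F _ _)) := by
  have := hF
  have := chainMap_kanComplex (F := F) (fun x ↦ P x ∨ Q x) hF
  have := chainMap_kanComplex P hF
  have := chainMap_kanComplex Q hF
  have := chainMap_kanComplex (F := F) (fun x ↦ P x ∧ Q x) hF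
  have w₁ : F.map p ≫ fromValue j₀ h₀ F = fromValue j₁ h₁ F ≫ chainRes (fun _ ↦ And.left) F := by
    rw [map_fromValue, fromValue_res]
  have w₂ : F.map q ≫ fromValue j₀ h₀ F = fromValue j₂ h₂ F ≫ chainRes (fun _ ↦ And.right) F := by
    rw [map_fromValue, fromValue_res]
  rw [← isHomotopyEquiv_comp_iff_right (isHomotopyEquiv_unionMap hF hP hQ),
    ← isHomotopyEquiv_comp_iff_right (hoPullback.map_isHomotopyEquiv w₁ w₂ e₁ e₂ e₀), unionMap,
    hoPullback.comp_ofComm, hoPullback.ofComm_map]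
  simp only [fromValue_res, map_fromValue]

/-- Replacing `Q` by a smaller `Q'` with the same homotopy limit does not change the homotopy limit
over the union with `P`, if `Q` and `Q'` have the same intersection with `P`. -/
theorem isHomotopyEquiv_chainRes_union (hF : ∀ i, KanComplex (F.obj i))
    {Q' : I → Prop} (hP : ∀ x y, (x ⟶ y) → P x → P y) (hQ : ∀ x y, (x ⟶ y) → Q x → Q y)
    (hQ' : ∀ x y, (x ⟶ y) → Q' x → Q' y) (h : ∀ x, Q' x → Q x) (h' : ∀ x, P x → Q x → Q' x)
    (e : IsHomotopyEquiv (chainRes h F)) :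
    IsHomotopyEquiv (chainRes (P := fun x ↦ P x ∨ Q' x) (Q := fun x ↦ P x ∨ Q x)
      (fun x ↦ Or.imp_right (h x)) F) := by
  have := chainMap_kanComplex (F := F) (fun x ↦ P x ∨ Q x) hF
  have := chainMap_kanComplex (F := F) (fun x ↦ P x ∨ Q' x) hF
  have := chainMap_kanComplex P hF
  have := chainMap_kanComplex Q hF
  have := chainMap_kanComplex Q' hF
  have := chainMap_kanComplex (F := F) (fun x ↦ P x ∧ Q x) hF
  have := chainMap_kanComplex (F := F) (fun x ↦ P x ∧ Q' x) hF
  have e₀ : IsHomotopyEquiv (chainRes (F := F) (P := fun x ↦ P x ∧ Q' x) (Q := fun x ↦ P x ∧ Q x)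
      (fun x ↦ And.imp_right (h x))) :=
    isHomotopyEquiv_chainRes_of_iff _ fun x hx ↦ ⟨hx.1, h' x hx.1 hx.2⟩
  have e₁ : IsHomotopyEquiv (chainRes (F := F) (P := P) (fun _ ↦ id)) :=
    isHomotopyEquiv_chainRes_of_iff _ fun _ ↦ id
  have e' := hoPullback.map_isHomotopyEquiv
    (f := chainRes (F := F) (P := fun x ↦ P x ∧ Q x) (fun _ ↦ And.left))
    (g := chainRes (F := F) (P := fun x ↦ P x ∧ Q x) (fun _ ↦ And.right))
    (f' := chainRes (F := F) (P := fun x ↦ P x ∧ Q' x) (fun _ ↦ And.left))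
    (g' := chainRes (F := F) (P := fun x ↦ P x ∧ Q' x) (fun _ ↦ And.right))
    (by rw [chainRes_comp, chainRes_comp]) (by rw [chainRes_comp, chainRes_comp]) e₁ e e₀
  rw [← isHomotopyEquiv_comp_iff_right (isHomotopyEquiv_unionMap hF hP hQ')]
  have e'' := isHomotopyEquiv_comp (isHomotopyEquiv_unionMap hF hP hQ) e'
  rw [unionMap, hoPullback.ofComm_map] at e''
  rw [unionMap, hoPullback.comp_ofComm]
  simp only [chainRes_comp] at e'' ⊢
  exact e''

end UnionHomotopy

/-! ### Inert maps as translations -/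

section Inert

/-- An inert map is a translation, by its value at `0`. -/
def shift {V W : InertCat} (f : V ⟶ W) : ℕ := f.hom.toOrderHom 0

theorem inert_apply {V W : InertCat} (f : V ⟶ W) (i : Fin (V.obj.len + 1)) :
    (f.hom.toOrderHom i : ℕ) = shift f + i := by
  induction i using Fin.induction with
  | zero => rfl
  | succ i ih =>
    rw [f.property i, ih]
    simp [add_assoc]

theorem shift_add_len_le {V W : InertCat} (f : V ⟶ W) : shift f + V.obj.len ≤ W.obj.len := by
  have h := inert_apply f (Fin.last _)
  have := (f.hom.toOrderHom (Fin.last _)).isLt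
  rw [Fin.val_last] at h
  omega

theorem inert_hom_ext {V W : InertCat} {f g : V ⟶ W} (h : shift f = shift g) : f = g := by
  apply WideSubcategory.hom_ext
  apply SimplexCategory.Hom.ext
  ext i
  rw [inert_apply, inert_apply, h]

theorem shift_comp {V W Z : InertCat} (f : V ⟶ W) (g : W ⟶ Z) :
    shift (f ≫ g) = shift f + shift g := by
  change (g.hom.toOrderHom (f.hom.toOrderHom 0) : ℕ) = _
  rw [inert_apply, add_comm]
  rfl

/-- The translation by `a`, as an inert map. -/
def inertMk (V W : InertCat) (a : ℕ) (h : a + V.obj.len ≤ W.obj.len) : V ⟶ W :=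
  ⟨SimplexCategory.Hom.mk ⟨fun i ↦ ⟨a + i, by omega⟩, fun i j hij ↦ by
    simpa using hij⟩, fun i ↦ by
      change a + (i.succ : ℕ) = a + (i.castSucc : ℕ) + 1
      simp [add_assoc]⟩

@[simp]
theorem shift_inertMk (V W : InertCat) (a : ℕ) (h : a + V.obj.len ≤ W.obj.len) :
    shift (inertMk V W a h) = a := rfl

variable {U : InertCat}

instance : Quiver.IsThin (Over U)ᵒᵖ := fun x y ↦ ⟨fun f g ↦ by
  apply Quiver.Hom.unop_inj
  apply Over.OverMorphism.ext
  apply inert_hom_ext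
  have hf := congrArg shift (Over.w f.unop)
  have hg := congrArg shift (Over.w g.unop)
  rw [shift_comp] at hf hg
  omega⟩

/-- The first vertex of an interval in `U`. -/
def first (x : (Over U)ᵒᵖ) : ℕ := shift x.unop.hom

/-- The length of an interval in `U`. -/
def length (x : (Over U)ᵒᵖ) : ℕ := x.unop.left.obj.len

theorem first_add_length_le (x : (Over U)ᵒᵖ) : first x + length x ≤ U.obj.len :=
  shift_add_len_le _

theorem shift_hom {x y : (Over U)ᵒᵖ} (f : x ⟶ y) : shift f.unop.left + first x = first y := by
  rw [first, first, ← Over.w f.unop, shift_comp]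

theorem nonempty_hom_iff {x y : (Over U)ᵒᵖ} :
    Nonempty (x ⟶ y) ↔ first x ≤ first y ∧ first y + length y ≤ first x + length x := by
  constructor
  · rintro ⟨f⟩
    have h₁ := shift_hom f
    have h₂ := shift_add_len_le f.unop.left
    rw [length, length]
    omega
  · rintro ⟨h₁, h₂⟩
    refine ⟨(Over.homMk (inertMk _ _ (first y - first x) ?_) ?_).op⟩
    · change _ + length y ≤ length x
      omega
    · apply inert_hom_ext
      rw [shift_comp, shift_inertMk]
      change _ + first x = first y
      omega

/-- The interval in `U` with given first vertex and length. -/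
def interval (U : InertCat) (a l : ℕ) (h : a + l ≤ U.obj.len) : (Over U)ᵒᵖ :=
  op (Over.mk (inertMk ⟨⦋l⦌⟩ U a h))

@[simp]
theorem first_interval (a l : ℕ) (h : a + l ≤ U.obj.len) : first (interval U a l h) = a := rfl

@[simp]
theorem length_interval (a l : ℕ) (h : a + l ≤ U.obj.len) : length (interval U a l h) = l := rfl

/-- A decomposition of `V` as a concatenation of `V₁` and `V₂` at a common vertex `V₀`. -/
structure IsCut {V₀ V₁ V₂ V : InertCat} (p : V₀ ⟶ V₁) (q : V₀ ⟶ V₂) (f : V₁ ⟶ V) (g : V₂ ⟶ V) :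
    Prop where
  len_zero : V₀.obj.len = 0
  len_add : V₁.obj.len + V₂.obj.len = V.obj.len
  shift_p : shift p = V₁.obj.len
  shift_q : shift q = 0
  shift_f : shift f = 0
  shift_g : shift g = V₁.obj.len

theorem IsCut.w {V₀ V₁ V₂ V : InertCat} {p : V₀ ⟶ V₁} {q : V₀ ⟶ V₂} {f : V₁ ⟶ V} {g : V₂ ⟶ V}
    (h : IsCut p q f g) : p ≫ f = q ≫ g := by
  apply inert_hom_ext
  rw [shift_comp, shift_comp, h.shift_p, h.shift_q, h.shift_f, h.shift_g, add_comm]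

/-- The map from the value of a presheaf at a concatenation to the homotopy pullback of the values
at the parts. -/
def cutMap (A : SpacePresheaf.{u} InertCat) {V₀ V₁ V₂ V : InertCat} {p : V₀ ⟶ V₁} {q : V₀ ⟶ V₂}
    {f : V₁ ⟶ V} {g : V₂ ⟶ V} (h : IsCut p q f g) : (A.obj (op V)).obj ⟶
    hoPullback (A.map p.op).hom (A.map q.op).hom :=
  hoPullback.ofComm _ _ (A.map f.op).hom (A.map g.op).hom (by
    change (A.map f.op ≫ A.map p.op).hom = (A.map g.op ≫ A.map q.op).hom
    rw [← Functor.map_comp, ← Functor.map_comp, ← op_comp, ← op_comp, h.w])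

/-- The comparison map of a concatenation depends only on the lengths of the parts. -/
theorem isHomotopyEquiv_cutMap_iff_of_length {A : SpacePresheaf.{u} InertCat}
    {V₀ V₁ V₂ V : InertCat} {p : V₀ ⟶ V₁} {q : V₀ ⟶ V₂} {f : V₁ ⟶ V}
    {g : V₂ ⟶ V} {W₀ W₁ W₂ W : InertCat} {p' : W₀ ⟶ W₁} {q' : W₀ ⟶ W₂} {f' : W₁ ⟶ W} {g' : W₂ ⟶ W}
    (h : IsCut p q f g) (h' : IsCut p' q' f' g') (h₁ : V₁.obj.len = W₁.obj.len)
    (h₂ : V₂.obj.len = W₂.obj.len) :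
    IsHomotopyEquiv (cutMap A h) ↔ IsHomotopyEquiv (cutMap A h') := by
  obtain ⟨n₀, rfl⟩ : ∃ n, V₀ = ⟨⦋n⦌⟩ := ⟨V₀.obj.len, rfl⟩
  obtain ⟨n₁, rfl⟩ : ∃ n, V₁ = ⟨⦋n⦌⟩ := ⟨V₁.obj.len, rfl⟩
  obtain ⟨n₂, rfl⟩ : ∃ n, V₂ = ⟨⦋n⦌⟩ := ⟨V₂.obj.len, rfl⟩
  obtain ⟨n, rfl⟩ : ∃ n, V = ⟨⦋n⦌⟩ := ⟨V.obj.len, rfl⟩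
  obtain ⟨m₀, rfl⟩ : ∃ n, W₀ = ⟨⦋n⦌⟩ := ⟨W₀.obj.len, rfl⟩
  obtain ⟨m₁, rfl⟩ : ∃ n, W₁ = ⟨⦋n⦌⟩ := ⟨W₁.obj.len, rfl⟩
  obtain ⟨m₂, rfl⟩ : ∃ n, W₂ = ⟨⦋n⦌⟩ := ⟨W₂.obj.len, rfl⟩
  obtain ⟨m, rfl⟩ : ∃ n, W = ⟨⦋n⦌⟩ := ⟨W.obj.len, rfl⟩
  obtain rfl : n₀ = m₀ := h.len_zero.trans h'.len_zero.symm
  obtain rfl : n₁ = m₁ := h₁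
  obtain rfl : n₂ = m₂ := h₂
  obtain rfl : n = m := h.len_add.symm.trans h'.len_add
  obtain rfl := inert_hom_ext (h.shift_p.trans h'.shift_p.symm)
  obtain rfl := inert_hom_ext (h.shift_q.trans h'.shift_q.symm)
  obtain rfl := inert_hom_ext (h.shift_f.trans h'.shift_f.symm)
  obtain rfl := inert_hom_ext (h.shift_g.trans h'.shift_g.symm)
  rfl

/-- A presheaf of spaces takes concatenations to homotopy pullbacks. -/
def CutLocal (A : SpacePresheaf.{u} InertCat) : Prop :=
  ∀ ⦃V₀ V₁ V₂ V : InertCat⦄ ⦃p : V₀ ⟶ V₁⦄ ⦃q : V₀ ⟶ V₂⦄ ⦃f : V₁ ⟶ V⦄ ⦃g : V₂ ⟶ V⦄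
    (h : IsCut p q f g), IsHomotopyEquiv (cutMap A h)

/-- A presheaf of spaces takes concatenations with a last edge to homotopy pullbacks. -/
def EdgeLocal (A : SpacePresheaf.{u} InertCat) : Prop :=
  ∀ ⦃V₀ V₁ V₂ V : InertCat⦄ ⦃p : V₀ ⟶ V₁⦄ ⦃q : V₀ ⟶ V₂⦄ ⦃f : V₁ ⟶ V⦄ ⦃g : V₂ ⟶ V⦄
    (h : IsCut p q f g), 1 ≤ V₁.obj.len → V₂.obj.len = 1 → IsHomotopyEquiv (cutMap A h)

theorem CutLocal.edgeLocal {A : SpacePresheaf.{u} InertCat} (h : CutLocal A) : EdgeLocal A :=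
  fun _ _ _ _ _ _ _ _ hc _ _ ↦ h hc

end Inert

/-! ### Covering sieves and concatenations -/

section Cover

variable {U : InertCat} (A : SpacePresheaf.{u} InertCat)

/-- The restriction of a presheaf of spaces to the intervals in `U`. -/
abbrev overDiagram (U : InertCat) (A : SpacePresheaf.{u} InertCat) : (Over U)ᵒᵖ ⥤ SSet.{u} :=
  (Over.forget U).op ⋙ A ⋙ Space.toSSet

theorem overDiagram_kan (x : (Over U)ᵒᵖ) : SSet.KanComplex ((overDiagram U A).obj x) :=
  (A.obj _).property

variable {A}

/-- Mapping spaces out of the union of two intervals with a common end. -/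
theorem isHomotopyEquiv_fromValue_cut_iff {P Q : (Over U)ᵒᵖ → Prop}
    (hP : ∀ x y, (x ⟶ y) → P x → P y) (hQ : ∀ x y, (x ⟶ y) → Q x → Q y) {j j₁ j₂ j₀ : (Over U)ᵒᵖ}
    (h : ∀ x, P x ∨ Q x → Nonempty (j ⟶ x))
    (h₁ : ∀ x, P x → Nonempty (j₁ ⟶ x)) (h₂ : ∀ x, Q x → Nonempty (j₂ ⟶ x))
    (e₁ : IsHomotopyEquiv (fromValue j₁ h₁ (overDiagram U A)))
    (e₂ : IsHomotopyEquiv (fromValue j₂ h₂ (overDiagram U A)))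
    (hP₀ : P j₀) (hQ₀ : Q j₀) (l₁ : first j₁ = first j) (l₂ : first j₂ = first j + length j₁)
    (l₃ : length j = length j₁ + length j₂) (l₄ : first j₀ = first j₂) (l₅ : length j₀ = 0) :
    ∃ (p : j₀.unop.left ⟶ j₁.unop.left) (q : j₀.unop.left ⟶ j₂.unop.left)
      (f : j₁.unop.left ⟶ j.unop.left) (g : j₂.unop.left ⟶ j.unop.left) (hc : IsCut p q f g),
      IsHomotopyEquiv (fromValue j h (overDiagram U A)) ↔ IsHomotopyEquiv (cutMap A hc) := by
  obtain ⟨f⟩ : Nonempty (j ⟶ j₁) := nonempty_hom_iff.2 (by omega)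
  obtain ⟨g⟩ : Nonempty (j ⟶ j₂) := nonempty_hom_iff.2 (by omega)
  obtain ⟨p⟩ : Nonempty (j₁ ⟶ j₀) := nonempty_hom_iff.2 (by omega)
  obtain ⟨q⟩ : Nonempty (j₂ ⟶ j₀) := nonempty_hom_iff.2 (by omega)
  have sf := shift_hom f
  have sg := shift_hom g
  have sp := shift_hom p
  have sq := shift_hom q
  have h₀ (x) (hx : P x ∧ Q x) : Nonempty (j₀ ⟶ x) := nonempty_hom_iff.2 (by
    have k₁ := nonempty_hom_iff.1 (h₁ x hx.1)
    have k₂ := nonempty_hom_iff.1 (h₂ x hx.2)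
    omega)
  refine ⟨p.unop.left, q.unop.left, f.unop.left, g.unop.left, ⟨l₅, l₃.symm, ?_, ?_, ?_, ?_⟩, ?_⟩
  · change _ = length j₁
    omega
  · omega
  · omega
  · change _ = length j₁
    omega
  · exact isHomotopyEquiv_fromValue_union_iff (overDiagram_kan A) hP hQ f g p q h h₁ h₂ h₀ e₁ e₂
      (isHomotopyEquiv_fromValue j₀ h₀ ⟨hP₀, hQ₀⟩)

/-- If a presheaf takes concatenations with a last edge to homotopy pullbacks, then its value at an
interval `j` is the homotopy limit of its values over any covering family of subintervals. The last
edge of `j` lies in a largest member of the family that contains it; by the assumption that member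
may be replaced by its last edge and the rest, and induction applies to `j` without its last
edge. -/
theorem EdgeLocal.isHomotopyEquiv_fromValue (hA : EdgeLocal A) (l : ℕ) :
    ∀ (j : (Over U)ᵒᵖ) (R : (Over U)ᵒᵖ → Prop) (_ : length j = l)
      (_ : ∀ x y, (x ⟶ y) → R x → R y) (h : ∀ x, R x → Nonempty (j ⟶ x))
      (_ : ∀ x, Nonempty (j ⟶ x) → length x ≤ 1 → R x),
      IsHomotopyEquiv (fromValue j h (overDiagram U A)) := by
  classical
  induction l with
  | zero =>
    intro j R hl hR h hc
    exact FreeDecomposition.isHomotopyEquiv_fromValue j h (hc j ⟨𝟙 _⟩ (by omega))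
  | succ l ih =>
    intro j R hl hR h hc
    by_cases hj : R j
    · exact FreeDecomposition.isHomotopyEquiv_fromValue j h hj
    have hl1 : 1 ≤ l := by
      by_contra hl0
      exact hj (hc j ⟨𝟙 _⟩ (by omega))
    have hU := first_add_length_le j
    -- the end of `j` is `b + 1`
    obtain ⟨b, hb⟩ : ∃ b, b = first j + l := ⟨_, rfl⟩
    have hex : ∃ k, ∃ hk : k ≤ b, R (interval U k (b + 1 - k) (by omega)) :=
      ⟨b, le_rfl, hc _ (nonempty_hom_iff.2 (by simp; omega)) (by simp)⟩
    let k := Nat.find hex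
    obtain ⟨hkb, hk⟩ := Nat.find_spec hex
    have hkmin (k' : ℕ) (hk' : k' ≤ b) (hR' : R (interval U k' (b + 1 - k') (by omega))) : k ≤ k' :=
      Nat.find_min' hex ⟨hk', hR'⟩
    change k ≤ b at hkb
    change R (interval U k _ _) at hk
    let m := interval U k (b + 1 - k) (by omega)
    let m' := interval U k (b - k) (by omega)
    let j₁ := interval U (first j) l (by omega)
    let e := interval U b 1 (by omega)
    let v := interval U b 0 (by omega)
    have hjm := nonempty_hom_iff.1 (h _ hk)
    simp only [first_interval, length_interval] at hjm
    let P : (Over U)ᵒᵖ → Prop := fun x ↦ R x ∧ Nonempty (j₁ ⟶ x)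
    let Q : (Over U)ᵒᵖ → Prop := fun x ↦ Nonempty (m ⟶ x)
    let Q' : (Over U)ᵒᵖ → Prop := fun x ↦ Nonempty (m' ⟶ x) ∨ Nonempty (e ⟶ x)
    let E : (Over U)ᵒᵖ → Prop := fun x ↦ Nonempty (e ⟶ x)
    have hP (x y) (f : x ⟶ y) (hx : P x) : P y := ⟨hR x y f hx.1, ⟨hx.2.some ≫ f⟩⟩
    have closed (z x y : (Over U)ᵒᵖ) (f : x ⟶ y) (hx : Nonempty (z ⟶ x)) : Nonempty (z ⟶ y) :=
      ⟨hx.some ≫ f⟩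
    have hQ' (x y) (f : x ⟶ y) (hx : Q' x) : Q' y := hx.imp (closed _ x y f) (closed _ x y f)
    have hF := overDiagram_kan (U := U) A
    have := hF
    have kan (P : (Over U)ᵒᵖ → Prop) := chainMap_kanComplex (F := overDiagram U A) P hF
    have hom_of {x y : (Over U)ᵒᵖ} (f : Nonempty (x ⟶ y)) := nonempty_hom_iff.1 f
    have hmx {x} (hx : R x) (hx' : b < first x + length x) : Nonempty (m ⟶ x) := by
      have hjx := hom_of (h x hx)
      refine nonempty_hom_iff.2 ?_
      simp only [m, first_interval, length_interval]
      by_cases hxb : first x ≤ b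
      · have := hkmin (first x) hxb (hR x _ (nonempty_hom_iff.2 (by simp; omega)).some hx)
        omega
      · omega
    have hj₁x {x} (hx : Nonempty (j ⟶ x)) (hx' : first x + length x ≤ b) :
        Nonempty (j₁ ⟶ x) := by
      have hjx := hom_of hx
      exact nonempty_hom_iff.2 (by simp [j₁]; omega)
    have hQR {x} (hx : Q x) : R x := hR m x hx.some hk
    have hQ'Q (x) (hx : Q' x) : Q x := by
      rcases hx with hx | hx
      · have := hom_of hx
        simp only [m', first_interval, length_interval] at this
        exact nonempty_hom_iff.2 (by simp [m]; omega)
      · have := hom_of hx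
        simp only [e, first_interval, length_interval] at this
        exact nonempty_hom_iff.2 (by simp [m]; omega)
    have hPQ (x) (hx : P x) (hx' : Q x) : Q' x := by
      have h₁ := hom_of hx.2
      have h₂ := hom_of hx'
      simp only [m, j₁, first_interval, length_interval] at h₁ h₂
      exact .inl (nonempty_hom_iff.2 (by simp [m']; omega))
    have hje {x} (hx : Nonempty (e ⟶ x)) : Nonempty (j ⟶ x) := by
      have := hom_of hx
      simp only [e, first_interval, length_interval] at this
      exact nonempty_hom_iff.2 (by omega)
    have hPR {x} (hx : P x ∨ E x) : R x := hx.elim And.left fun hx ↦ hQR (hQ'Q _ (.inr hx))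
    -- the largest member at the end of `j` may be replaced by its last edge and the rest
    have e₁ : IsHomotopyEquiv (chainRes hQ'Q (overDiagram U A)) := by
      by_cases hkb' : k = b
      · refine isHomotopyEquiv_chainRes_of_iff _ fun x hx ↦ .inr ?_
        have := hom_of hx
        simp only [m, first_interval, length_interval] at this
        exact nonempty_hom_iff.2 (by simp [e]; omega)
      · rw [← isHomotopyEquiv_comp_iff_left (FreeDecomposition.isHomotopyEquiv_fromValue
          (P := Q) m (fun x hx ↦ hx) ⟨𝟙 _⟩), fromValue_res]
        obtain ⟨p, q, f, g, hcut, hiff⟩ := isHomotopyEquiv_fromValue_cut_iff (A := A)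
          (closed m') (closed e) (j := m) (j₁ := m') (j₂ := e) (j₀ := v) hQ'Q (fun x hx ↦ hx)
          (fun x hx ↦ hx)
          (FreeDecomposition.isHomotopyEquiv_fromValue _ _ ⟨𝟙 _⟩)
          (FreeDecomposition.isHomotopyEquiv_fromValue _ _ ⟨𝟙 _⟩)
          (nonempty_hom_iff.2 (by simp [m', v]; omega))
          (nonempty_hom_iff.2 (by simp [e, v])) rfl (by simp [m, m', e]; omega)
          (by simp [m, m', e]; omega) rfl rfl
        exact hiff.2 (hA hcut (by change 1 ≤ length m'; simp [m']; omega) rfl)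
    have e₂ := isHomotopyEquiv_chainRes_union hF hP (closed m) hQ' hQ'Q hPQ e₁
    have e₃ : IsHomotopyEquiv (chainRes (P := fun x ↦ P x ∨ E x) (fun x ↦ hPR)
        (overDiagram U A)) := by
      have i₁ (x) (hx : P x ∨ Q x) : R x := hx.elim And.left hQR
      have i₂ (x) (hx : P x ∨ E x) : P x ∨ Q' x := hx.imp_right .inr
      have e₄ : IsHomotopyEquiv (chainRes i₁ (overDiagram U A)) :=
        isHomotopyEquiv_chainRes_of_iff _ fun x hx ↦ by
          by_cases hx' : first x + length x ≤ b
          · exact .inl ⟨hx, hj₁x (h x hx) hx'⟩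
          · exact .inr (hmx hx (by omega))
      have e₅ : IsHomotopyEquiv (chainRes i₂ (overDiagram U A)) :=
        isHomotopyEquiv_chainRes_of_iff _ fun x hx ↦ by
          rcases hx with hx | hx | hx
          · exact .inl hx
          · have hxm := hom_of hx
            have hxR := hQR (hQ'Q x (.inl hx))
            simp only [m', first_interval, length_interval] at hxm
            exact .inl ⟨hxR, hj₁x (h x hxR) (by omega)⟩
          · exact .inr hx
      have e₆ := isHomotopyEquiv_comp (isHomotopyEquiv_comp e₄ e₂) e₅
      rwa [chainRes_comp, chainRes_comp] at e₆
    have hjj₁ : Nonempty (j ⟶ j₁) := nonempty_hom_iff.2 (by simp [j₁]; omega)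
    rw [← isHomotopyEquiv_comp_iff_right e₃, fromValue_res]
    obtain ⟨p, q, f, g, hcut, hiff⟩ := isHomotopyEquiv_fromValue_cut_iff (A := A)
      hP (closed e) (j := j) (j₁ := j₁) (j₂ := e) (j₀ := v) (fun x hx ↦ h x (hPR hx))
      (fun x hx ↦ hx.2) (fun x hx ↦ hx)
      (ih j₁ P rfl hP (fun x hx ↦ hx.2) fun x hx hx' ↦
        ⟨hc x ⟨hjj₁.some ≫ hx.some⟩ hx', hx⟩)
      (FreeDecomposition.isHomotopyEquiv_fromValue _ _ ⟨𝟙 _⟩)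
      ⟨hc v (nonempty_hom_iff.2 (by simp [v]; omega)) (by simp [v]),
        nonempty_hom_iff.2 (by simp [v, j₁]; omega)⟩
      (nonempty_hom_iff.2 (by simp [e, v])) rfl (by simp [j₁, e]; omega)
      (by simp [j₁, e]; omega) rfl rfl
    exact hiff.2 (hA hcut hl1 rfl)

end Cover

/-! ### Homotopy limits over full subcategories of thin categories -/

section Comparison

section OverChain

variable {J : Type} [SmallCategory J] [Quiver.IsThin J]

theorem overChain_ext {j : J} {n : ℕ} {F G : Fin (n + 1) ⥤ Over j}
    (h : ∀ a, (F.obj a).left = (G.obj a).left) : F = G := by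
  have thin (x y : Over j) (f g : x ⟶ y) : f = g :=
    Over.OverMorphism.ext (Subsingleton.elim _ _)
  have hobj (x y : Over j) (e : x.left = y.left) : x = y := by
    obtain ⟨x, ⟨⟨⟩⟩, f⟩ := x
    obtain ⟨y, ⟨⟨⟩⟩, g⟩ := y
    obtain rfl : x = y := e
    obtain rfl : f = g := Subsingleton.elim (α := (x ⟶ j)) _ _
    rfl
  exact CategoryTheory.Functor.ext (fun a ↦ hobj _ _ (h a)) fun _ _ _ ↦ thin _ _ _ _

/-- The simplex of the nerve of an over category given by a chain of objects. -/
def overChain {j : J} {n : ℕ} (c : Fin (n + 1) → J) (hc : ∀ a b, a ≤ b → Nonempty (c a ⟶ c b))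
    (hj : ∀ a, Nonempty (c a ⟶ j)) : Fin (n + 1) ⥤ Over j where
  obj a := Over.mk (hj a).some
  map f := Over.homMk (hc _ _ (leOfHom f)).some (Subsingleton.elim _ _)
  map_id _ := Over.OverMorphism.ext (Subsingleton.elim _ _)
  map_comp _ _ := Over.OverMorphism.ext (Subsingleton.elim _ _)

end OverChain

variable {D : Type} [SmallCategory D] [Quiver.IsThin Dᵒᵖ] (p : ObjectProperty D)

instance : Quiver.IsThin p.FullSubcategoryᵒᵖ := fun x y ↦ ⟨fun f g ↦ by
  apply Quiver.Hom.unop_inj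
  apply ObjectProperty.hom_ext
  exact Quiver.Hom.op_inj (Subsingleton.elim (α := (op x.unop.obj ⟶ op y.unop.obj)) _ _)⟩

/-- The weight of chains of objects that satisfy `p` is, on these objects, the Bousfield-Kan
weight. -/
def toBousfieldKan : p.ι.op ⋙ chainWeight (fun x ↦ p x.unop) ⟶
    bousfieldKanWeight.{u} p.FullSubcategoryᵒᵖ where
  app j := mkHom (fun n c ↦ ⟨overChain (j := j) (fun a ↦ op ⟨(c.down.1 a).unop, c.down.2.1.2 a⟩)
      (fun a b h ↦ ⟨Quiver.Hom.op ⟨(c.down.2.1.1 a b h).some.unop⟩⟩)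
      (fun a ↦ ⟨Quiver.Hom.op ⟨(c.down.2.2 a).some.unop⟩⟩)⟩) (by
    intro m n f c
    apply ULift.ext
    exact overChain_ext (n := m.len) fun a ↦ rfl)
  naturality i j f := by
    apply sset_hom_ext
    intro n c
    apply ULift.ext
    exact overChain_ext (n := n.len) fun a ↦ rfl

/-- The inverse of `toBousfieldKan`. -/
def ofBousfieldKan : bousfieldKanWeight.{u} p.FullSubcategoryᵒᵖ ⟶
    p.ι.op ⋙ chainWeight (fun x ↦ p x.unop) where
  app j := mkHom (fun n (c : ULift (Fin (n.len + 1) ⥤ Over j)) ↦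
      ⟨⟨fun a ↦ op (c.down.obj a).left.unop.obj,
        ⟨fun _ _ h ↦ ⟨(c.down.map (homOfLE h)).left.unop.hom.op⟩,
          fun a ↦ (c.down.obj a).left.unop.property⟩,
        fun a ↦ ⟨(c.down.obj a).hom.unop.hom.op⟩⟩⟩) (fun _ _ ↦ rfl)
  naturality _ _ _ := rfl

theorem ofBousfieldKan_toBousfieldKan : ofBousfieldKan p ≫ toBousfieldKan.{u} p = 𝟙 _ := by
  refine NatTrans.ext (funext fun j ↦ sset_hom_ext fun n c ↦ ?_)
  apply ULift.ext
  exact overChain_ext (n := n.len) fun a ↦ rfl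

variable {p} {F : Dᵒᵖ ⥤ SSet.{u}}

variable (F p) in
/-- Restriction of natural transformations to the full subcategory of objects that satisfy `p`. -/
def chainMapToHomotopyLimit : chainMap (fun x ↦ p x.unop) F ⟶ homotopyLimit (p.ι.op ⋙ F) :=
  mkHom (L := homotopyLimit (p.ι.op ⋙ F)) (fun n φ ↦
    (ofBousfieldKan p ▷ _ ≫ Functor.whiskerLeft p.ι.op φ :
      bousfieldKanWeight.{u} _ ⊗ (Functor.const _).obj (SSet.stdSimplex.obj n) ⟶ p.ι.op ⋙ F))
    (fun _ _ ↦ rfl)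

/-- Extension of a natural transformation from the full subcategory of the objects that satisfy
`p`. -/
def extendChain (hp : ∀ x y : Dᵒᵖ, (x ⟶ y) → p x.unop → p y.unop) {K : SSet.{u}}
    (ψ : bousfieldKanWeight.{u} p.FullSubcategoryᵒᵖ ⊗ (Functor.const _).obj K ⟶ p.ι.op ⋙ F) :
    chainWeight (fun x ↦ p x.unop) ⊗ (Functor.const _).obj K ⟶ F where
  app i := mkHom (fun n (q : ((chainWeight.{u} fun x ↦ p x.unop).obj i ⊗ K).obj (op n)) ↦
      (tapp ψ (op ⟨i.unop, hp _ _ (q.1.down.2.2 0).some (q.1.down.2.1.2 0)⟩)).app (op n)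
        (((toBousfieldKan p).app (op ⟨i.unop, hp _ _ (q.1.down.2.2 0).some (q.1.down.2.1.2 0)⟩)).app
          (op n) q.1, q.2)) (by
    rintro m n f ⟨c, x⟩
    let j : p.FullSubcategoryᵒᵖ := op ⟨i.unop, hp _ _ (c.down.2.2 0).some (c.down.2.1.2 0)⟩
    exact (congrArg (fun w ↦ (tapp ψ j).app (op m) (w, K.map f.op x))
      (sset_naturality ((toBousfieldKan p).app j) f c)).trans
        (sset_naturality (tapp ψ j) f (((toBousfieldKan p).app j).app (op n) c, x)))
  naturality i i' g := by
    apply sset_hom_ext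
    rintro n ⟨c, x⟩
    have hi : p i.unop := hp _ _ (c.down.2.2 0).some (c.down.2.1.2 0)
    let j : p.FullSubcategoryᵒᵖ := op ⟨i.unop, hi⟩
    let j' : p.FullSubcategoryᵒᵖ := op ⟨i'.unop, hp _ _ g hi⟩
    let g' : j ⟶ j' := Quiver.Hom.op ⟨g.unop⟩
    exact (congrArg (fun w ↦ (tapp ψ j').app (op n) (w, x))
      (congrArg (fun k ↦ k.app (op n) c) ((toBousfieldKan p).naturality g'))).trans
        (congrArg (fun k ↦ k.app (op n) (((toBousfieldKan p).app j).app (op n) c, x))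
          (tapp_naturality ψ g'))

/-- Mapping spaces out of weights of chains are Bousfield-Kan homotopy limits over full
subcategories that are closed under maps out of their objects: the weight vanishes at all other
objects. -/
theorem isIso_chainMapToHomotopyLimit (hp : ∀ x y : Dᵒᵖ, (x ⟶ y) → p x.unop → p y.unop) :
    IsIso (chainMapToHomotopyLimit p F) := by
  have (n : SimplexCategoryᵒᵖ) : IsIso ((chainMapToHomotopyLimit p F).app n) := by
    rw [isIso_iff_bijective]
    constructor
    · intro φ φ' h
      refine tapp_ext fun i ↦ sset_hom_ext fun m q ↦ ?_
      obtain ⟨c, x⟩ := q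
      let j : p.FullSubcategoryᵒᵖ := op ⟨i.unop, hp _ _ (c.down.2.2 0).some (c.down.2.1.2 0)⟩
      exact congrArg (fun k ↦ (tapp (F := p.ι.op ⋙ F) k j).app (op m)
        (((toBousfieldKan p).app j).app (op m) c, x)) h
    · intro ψ
      refine ⟨extendChain hp ψ, ?_⟩
      refine tapp_ext fun i ↦ sset_hom_ext fun m q ↦ ?_
      obtain ⟨c, x⟩ := q
      exact congrArg (fun k ↦ (tapp ψ i).app (op m) ((k.app i).app (op m) c, x))
        (ofBousfieldKan_toBousfieldKan p)
  exact NatIso.isIso_of_isIso_app _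

theorem fromValue_chainMapToHomotopyLimit {j : Dᵒᵖ}
    (hj : ∀ x : Dᵒᵖ, p x.unop → Nonempty (j ⟶ x)) (c : (Functor.const _).obj (F.obj j) ⟶ p.ι.op ⋙ F)
    (hc : ∀ i, ∃ f, c.app i = F.map f) :
    fromValue j hj F ≫ chainMapToHomotopyLimit p F = homotopyLimitLift (.mk _ c) := by
  apply sset_hom_ext
  intro n x
  refine tapp_ext fun i ↦ sset_hom_ext fun m q ↦ ?_
  obtain ⟨w, s⟩ := q
  obtain ⟨f, hf⟩ := hc i
  have h := fromValueNat_app j hj F (((ofBousfieldKan p).app i).app (op m) w)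
    ((SSet.yonedaEquiv.symm x).app (op m) s) f
  exact h.trans (congrArg (fun k : F.obj j ⟶ (p.ι.op ⋙ F).obj i ↦
    k.app (op m) ((SSet.yonedaEquiv.symm x).app (op m) s)) hf.symm)

end Comparison

/-! ### Sheaves -/

section Sheaf

/-- The sieve condition in terms of mapping spaces out of weights of chains. -/
theorem isHomotopyEquiv_homotopyLimitLift_iff (A : SpacePresheaf.{u} InertCat) {U : InertCat}
    (S : Sieve U) (h : ∀ x : (Over U)ᵒᵖ, S x.unop.hom → Nonempty (op (Over.mk (𝟙 U)) ⟶ x)) :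
    IsHomotopyEquiv (homotopyLimitLift ((A ⋙ Space.toSSet).mapCone S.arrows.cocone.op)) ↔
      IsHomotopyEquiv (fromValue (op (Over.mk (𝟙 U))) h (overDiagram U A)) := by
  have := isIso_chainMapToHomotopyLimit (F := overDiagram U A) (p := fun x ↦ S x.hom)
    fun x y f hx ↦ by
      rw [← Over.w f.unop]
      exact S.downward_closed hx _
  rw [← isHomotopyEquiv_comp_isIso_iff (fromValue (op (Over.mk (𝟙 U))) h (overDiagram U A))
    (chainMapToHomotopyLimit (fun x : Over U ↦ S x.hom) (overDiagram U A))]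
  have e := fromValue_chainMapToHomotopyLimit (F := overDiagram U A) (p := fun x ↦ S x.hom) h
    ((A ⋙ Space.toSSet).mapCone S.arrows.cocone.op).π
    (fun i ↦ ⟨(Over.homMk (U := i.unop.obj) (V := Over.mk (𝟙 U)) i.unop.obj.hom (by simp)).op, rfl⟩)
  rw [e]
  rfl

theorem nonempty_hom_top {U : InertCat} (x : (Over U)ᵒᵖ) :
    Nonempty (op (Over.mk (𝟙 U)) ⟶ x) :=
  ⟨(Over.homMk x.unop.hom (by simp)).op⟩

/-- A covering sieve contains all intervals of length at most one. -/
theorem mem_of_length_le_one {U : InertCat} {S : Sieve U} (hS : S ∈ inertTopology U)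
    (x : (Over U)ᵒᵖ) (hx : length x ≤ 1) : S x.unop.hom := by
  obtain ⟨hv, he⟩ := (jointlySurjective_iff S).1 hS
  have hU := first_add_length_le x
  obtain hx | hx : length x = 0 ∨ length x = 1 := by omega
  · have h := S.downward_closed (hv ⟨first x, by omega⟩)
      (inertMk x.unop.left ⟨⦋0⦌⟩ 0 (by change 0 + length x ≤ 0; omega))
    convert h
    apply inert_hom_ext
    rw [shift_comp, shift_inertMk, zero_add]
    rfl
  · have h := S.downward_closed (he ⟨first x, by omega⟩)
      (inertMk x.unop.left ⟨⦋1⦌⟩ 0 (by change 0 + length x ≤ 1; omega))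
    convert h
    apply inert_hom_ext
    rw [shift_comp, shift_inertMk, zero_add]
    rfl

theorem EdgeLocal.isSpaceSheaf {A : SpacePresheaf.{u} InertCat} (hA : EdgeLocal A) :
    IsSpaceSheaf inertTopology A := fun U S hS ↦
  (isHomotopyEquiv_homotopyLimitLift_iff A S fun x _ ↦ nonempty_hom_top x).2
    (hA.isHomotopyEquiv_fromValue _ _ _ rfl (fun x y f hx ↦ by
      rw [← Over.w f.unop]
      exact S.downward_closed hx _) _ fun x _ hx ↦ mem_of_length_le_one hS x hx)

/-- The sieve generated by the two parts of a concatenation. -/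
def cutSieve {V₁ V₂ V : InertCat} (f : V₁ ⟶ V) (g : V₂ ⟶ V) : Sieve V where
  arrows W x := Nonempty (op (Over.mk f) ⟶ op (Over.mk x)) ∨
    Nonempty (op (Over.mk g) ⟶ op (Over.mk x))
  downward_closed {_ _} x hx y :=
    have k : op (Over.mk x) ⟶ op (Over.mk (y ≫ x)) := (Over.homMk y).op
    hx.imp (fun h ↦ ⟨h.some ≫ k⟩) (fun h ↦ ⟨h.some ≫ k⟩)

theorem cutSieve_mem {V₀ V₁ V₂ V : InertCat} {p : V₀ ⟶ V₁} {q : V₀ ⟶ V₂} {f : V₁ ⟶ V}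
    {g : V₂ ⟶ V} (h : IsCut p q f g) : cutSieve f g ∈ inertTopology V := by
  have h₁ := h.shift_f
  have h₂ := h.shift_g
  have h₃ := h.len_add
  refine (jointlySurjective_iff _).2 ⟨fun v ↦ ?_, fun e ↦ ?_⟩
  · have hv := v.isLt
    have e₁ : first (op (Over.mk (vertexMap v))) = v := rfl
    have e₂ : length (op (Over.mk (vertexMap v))) = 0 := rfl
    by_cases hv' : (v : ℕ) ≤ V₁.obj.len
    · refine .inl (nonempty_hom_iff.2 ?_)
      rw [e₁, e₂]
      change shift f ≤ _ ∧ _ ≤ shift f + V₁.obj.len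
      omega
    · refine .inr (nonempty_hom_iff.2 ?_)
      rw [e₁, e₂]
      change shift g ≤ _ ∧ _ ≤ shift g + V₂.obj.len
      omega
  · have hv := e.isLt
    have e₁ : first (op (Over.mk (edgeMap e))) = e := rfl
    have e₂ : length (op (Over.mk (edgeMap e))) = 1 := rfl
    by_cases hv' : (e : ℕ) + 1 ≤ V₁.obj.len
    · refine .inl (nonempty_hom_iff.2 ?_)
      rw [e₁, e₂]
      change shift f ≤ _ ∧ _ ≤ shift f + V₁.obj.len
      omega
    · refine .inr (nonempty_hom_iff.2 ?_)
      rw [e₁, e₂]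
      change shift g ≤ _ ∧ _ ≤ shift g + V₂.obj.len
      omega

/-- The sheaf condition for the sieve generated by the two parts of a concatenation is the
comparison with the homotopy pullback. -/
theorem cutLocal_of_isSpaceSheaf {A : SpacePresheaf.{u} InertCat}
    (hA : IsSpaceSheaf inertTopology A) : CutLocal A := by
  intro V₀ V₁ V₂ V p q f g h
  have h₁ := (isHomotopyEquiv_homotopyLimitLift_iff A (cutSieve f g)
    fun x _ ↦ nonempty_hom_top x).1 (hA V _ (cutSieve_mem h))
  have sp := h.shift_p
  have sq := h.shift_q
  have sf := h.shift_f
  have sg := h.shift_g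
  have l₀ := h.len_zero
  let j₁ : (Over V)ᵒᵖ := op (Over.mk f)
  let j₂ : (Over V)ᵒᵖ := op (Over.mk g)
  let j₀ : (Over V)ᵒᵖ := op (Over.mk (p ≫ f))
  let p' : j₁ ⟶ j₀ := (Over.homMk p).op
  let q' : j₂ ⟶ j₀ := (Over.homMk q h.w.symm).op
  have h₀ (x) (hx : Nonempty (j₁ ⟶ x) ∧ Nonempty (j₂ ⟶ x)) : Nonempty (j₀ ⟶ x) := by
    have k₁ := nonempty_hom_iff.1 hx.1
    have k₂ := nonempty_hom_iff.1 hx.2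
    refine nonempty_hom_iff.2 ?_
    have e₀ : first j₀ = V₁.obj.len := by
      change shift (p ≫ f) = _
      rw [shift_comp, sp, sf, add_zero]
    have e₀' : length j₀ = 0 := l₀
    have e₁ : first j₁ = 0 := sf
    have e₁' : length j₁ = V₁.obj.len := rfl
    have e₂ : first j₂ = V₁.obj.len := sg
    omega
  have e₁ := isHomotopyEquiv_fromValue j₁ (P := fun x ↦ Nonempty (j₁ ⟶ x)) (fun _ ↦ id)
    (F := overDiagram V A) ⟨𝟙 _⟩
  have e₂ := isHomotopyEquiv_fromValue j₂ (P := fun x ↦ Nonempty (j₂ ⟶ x)) (fun _ ↦ id)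
    (F := overDiagram V A) ⟨𝟙 _⟩
  have e₀ := isHomotopyEquiv_fromValue j₀
    (P := fun x ↦ Nonempty (j₁ ⟶ x) ∧ Nonempty (j₂ ⟶ x)) h₀ (F := overDiagram V A) ⟨⟨p'⟩, ⟨q'⟩⟩
  have h₂ := isHomotopyEquiv_fromValue_union_iff (overDiagram_kan A)
    (P := fun x ↦ Nonempty (j₁ ⟶ x)) (Q := fun x ↦ Nonempty (j₂ ⟶ x))
    (fun x y k hx ↦ ⟨hx.some ≫ k⟩) (fun x y k hx ↦ ⟨hx.some ≫ k⟩)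
    (j := op (Over.mk (𝟙 V))) (Over.homMk f).op (Over.homMk g).op p' q'
    (fun x _ ↦ nonempty_hom_top x) (fun _ ↦ id) (fun _ ↦ id) h₀
    e₁ e₂ e₀
  have h₃ := h₂.1 h₁
  exact h₃

theorem isSpaceSheaf_iff_edgeLocal {A : SpacePresheaf.{u} InertCat} :
    IsSpaceSheaf inertTopology A ↔ EdgeLocal A :=
  ⟨fun h ↦ (cutLocal_of_isSpaceSheaf h).edgeLocal, EdgeLocal.isSpaceSheaf⟩

end Sheaf

/-! ### Segal spaces and concatenations with an edge -/

section Segal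

open SSet modelCategoryQuillen

variable (X : SpacePresheaf.{u} SimplexCategory)

/-- The target of the last edge. -/
def segalTarget (k : ℕ) : segalFibreProduct X k ⟶ (X.obj (op ⦋0⦌)).obj :=
  mkHom (fun n p ↦ (X.map (SimplexCategory.const ⦋0⦌ ⦋1⦌ 1).op).hom.app (op n)
    (SSet.yonedaEquiv (p.1.1 (Fin.last k)))) (by
    intro m n f p
    rw [← sset_naturality, SSet.yonedaEquiv_naturality]
    rfl)

theorem yonedaEquiv_symm_segalTarget (k : ℕ) {n : SimplexCategory}
    (p : (segalFibreProduct X k).obj (op n)) :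
    SSet.yonedaEquiv.symm p ≫ segalTarget X k =
      p.1.1 (Fin.last k) ≫ (X.map (SimplexCategory.const ⦋0⦌ ⦋1⦌ 1).op).hom := by
  apply SSet.yonedaEquiv.injective
  rw [SSet.yonedaEquiv_comp, SSet.yonedaEquiv_comp, Equiv.apply_symm_apply]
  rfl

/-- The iterated homotopy fibre product without its last factor. -/
def segalInit {k : ℕ} {n : SimplexCategory} (p : (segalFibreProduct X (k + 1)).obj (op n)) :
    (segalFibreProduct X k).obj (op n) :=
  ⟨(fun i ↦ p.1.1 i.castSucc, fun i ↦ p.1.2 i.castSucc), fun i ↦ p.2 i.castSucc⟩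

/-- The iterated homotopy fibre product as a homotopy pullback, by splitting off the last
factor. -/
def segalSplit (k : ℕ) : segalFibreProduct X (k + 1) ⟶
    hoPullback (segalTarget X k) (X.map (SimplexCategory.const ⦋0⦌ ⦋1⦌ 0).op).hom :=
  mkHom (fun n p ↦ ⟨((segalInit X p, SSet.yonedaEquiv (p.1.1 (Fin.last (k + 1)))),
      p.1.2 (Fin.last k)), by
    have h := p.2 (Fin.last k)
    rw [yonedaEquiv_symm_segalTarget, Equiv.symm_apply_apply, ← SimplexCategory.δ_zero_eq_const,
      ← SimplexCategory.δ_one_eq_const]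
    exact h⟩) (by
    intro m n f p
    refine Subtype.ext (Prod.ext (Prod.ext rfl ?_) rfl)
    exact (SSet.yonedaEquiv_naturality _ _).symm)

theorem isIso_segalSplit (k : ℕ) : IsIso (segalSplit X k) := by
  have (n : SimplexCategoryᵒᵖ) : IsIso ((segalSplit X k).app n) := by
    rw [isIso_iff_bijective]
    constructor
    · intro p p' h
      have h₁ := congrArg (fun q ↦ q.1.1.1.1) h
      have h₂ := congrArg (fun q ↦ q.1.1.2) h
      have h₃ := congrArg (fun q ↦ q.1.2) h
      refine Subtype.ext (Prod.ext (funext fun i ↦ ?_) (funext fun i ↦ ?_))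
      · induction i using Fin.lastCases with
        | last => exact SSet.yonedaEquiv.injective h₂
        | cast i => exact congrFun (congrArg Prod.fst h₁) i
      · induction i using Fin.lastCases with
        | last => exact h₃
        | cast i => exact congrFun (congrArg Prod.snd h₁) i
    · rintro ⟨⟨⟨p, e⟩, h⟩, h₀, h₁⟩
      obtain ⟨E, hE, hE'⟩ : ∃ E : Fin (k + 2) → (SSet.stdSimplex.obj n.unop ⟶ (X.obj (op ⦋1⦌)).obj),
          (∀ i : Fin (k + 1), E i.castSucc = p.1.1 i) ∧
            E (Fin.last (k + 1)) = SSet.yonedaEquiv.symm e :=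
        ⟨Fin.snoc p.1.1 (SSet.yonedaEquiv.symm e), fun i ↦ Fin.snoc_castSucc .., Fin.snoc_last ..⟩
      obtain ⟨H, hH, hH'⟩ : ∃ H : Fin (k + 1) →
          (SSet.stdSimplex.obj n.unop ⊗ Δ[1] ⟶ (X.obj (op ⦋0⦌)).obj),
          (∀ i : Fin k, H i.castSucc = p.1.2 i) ∧ H (Fin.last k) = h :=
        ⟨Fin.snoc p.1.2 h, fun i ↦ Fin.snoc_castSucc .., Fin.snoc_last ..⟩
      refine ⟨⟨(E, H), fun i ↦ ?_⟩, ?_⟩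
      · induction i using Fin.lastCases with
        | last =>
          have h₀' := h₀.trans (yonedaEquiv_symm_segalTarget X k p)
          rw [← SimplexCategory.δ_zero_eq_const] at h₀'
          rw [← SimplexCategory.δ_one_eq_const] at h₁
          dsimp only
          rw [hE, hH', Fin.succ_last, hE']
          exact ⟨h₀', h₁⟩
        | cast i =>
          have := p.2 i
          dsimp only
          rw [hE, hH, Fin.succ_castSucc, hE]
          exact this
      · refine Subtype.ext (Prod.ext (Prod.ext (Subtype.ext (Prod.ext (funext hE) (funext hH))) ?_)
          hH')
        exact (congrArg SSet.yonedaEquiv hE').trans (Equiv.apply_symm_apply _ _)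
  exact NatIso.isIso_of_isIso_app _

/-- The iterated homotopy fibre product with a single factor. -/
def segalSingle : segalFibreProduct X 0 ⟶ (X.obj (op ⦋1⦌)).obj :=
  mkHom (fun _ p ↦ SSet.yonedaEquiv (p.1.1 0)) (fun _ _ ↦ (SSet.yonedaEquiv_naturality _ _).symm)

theorem isIso_segalSingle : IsIso (segalSingle X) := by
  have (n : SimplexCategoryᵒᵖ) : IsIso ((segalSingle X).app n) := by
    rw [isIso_iff_bijective]
    constructor
    · intro p p' h
      refine Subtype.ext (Prod.ext (funext fun i ↦ ?_) (funext fun i ↦ i.elim0))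
      obtain rfl : i = 0 := Subsingleton.elim (α := Fin 1) _ _
      exact SSet.yonedaEquiv.injective h
    · intro x
      exact ⟨⟨(fun _ ↦ SSet.yonedaEquiv.symm x, fun i ↦ i.elim0), fun i ↦ i.elim0⟩,
        Equiv.apply_symm_apply _ _⟩
  exact NatIso.isIso_of_isIso_app _

theorem segalFibreProduct_kanComplex (k : ℕ) : KanComplex (segalFibreProduct X k) := by
  have kan (n) : KanComplex (X.obj n).obj := (X.obj n).property
  induction k with
  | zero =>
    have := isIso_segalSingle X
    exact isFibrant_of_fibration (segalSingle X)
  | succ k ih =>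
    have := isIso_segalSplit X k
    exact isFibrant_of_fibration (segalSplit X k)

theorem isHomotopyEquiv_segalMap_zero : IsHomotopyEquiv (segalMap X 0) := by
  have := isIso_segalSingle X
  have e : segalMap X 0 ≫ segalSingle X = 𝟙 _ := by
    apply sset_hom_ext
    intro n x
    change SSet.yonedaEquiv (SSet.yonedaEquiv.symm x ≫ _) = x
    rw [SSet.yonedaEquiv_comp, Equiv.apply_symm_apply]
    have : SimplexCategory.mkOfSucc (n := 0 + 1) 0 = 𝟙 _ := by decide
    change (X.map (SimplexCategory.mkOfSucc (n := 0 + 1) 0).op).hom.app _ x = x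
    rw [this, op_id, CategoryTheory.Functor.map_id]
    rfl
  rw [← isHomotopyEquiv_comp_isIso_iff _ (segalSingle X), e]
  exact isHomotopyEquiv_of_isIso _

/-- The concatenation of `[k + 1]` and an edge. -/
theorem isCut_edge (k : ℕ) : IsCut (vertexMap (U := ⟨⦋k + 1⦌⟩) (Fin.last (k + 1)))
    (vertexMap (U := ⟨⦋1⦌⟩) 0) (inertMk ⟨⦋k + 1⦌⟩ ⟨⦋k + 2⦌⟩ 0 (by simp))
    (inertMk ⟨⦋1⦌⟩ ⟨⦋k + 2⦌⟩ (k + 1) (by simp)) where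
  len_zero := rfl
  len_add := rfl
  shift_p := rfl
  shift_q := rfl
  shift_f := rfl
  shift_g := rfl

theorem segalMap_segalTarget (k : ℕ) : segalMap X k ≫ segalTarget X k =
    (X.map (SimplexCategory.const ⦋0⦌ ⦋k + 1⦌ (Fin.last (k + 1))).op).hom := by
  have e : SimplexCategory.const ⦋0⦌ ⦋1⦌ 1 ≫ SimplexCategory.mkOfSucc (Fin.last k) =
      SimplexCategory.const ⦋0⦌ ⦋k + 1⦌ (Fin.last (k + 1)) := by
    rw [← SimplexCategory.δ_zero_eq_const, SimplexCategory.δ_zero_mkOfSucc, Fin.succ_last]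
  rw [← e, op_comp, CategoryTheory.Functor.map_comp]
  apply sset_hom_ext
  intro n x
  change (X.map _).hom.app (op n) (SSet.yonedaEquiv (SSet.yonedaEquiv.symm x ≫ _)) = _
  rw [SSet.yonedaEquiv_comp, Equiv.apply_symm_apply]
  rfl

/-- The decomposition of the Segal map by splitting off the last edge. -/
theorem segalMap_segalSplit (k : ℕ) : segalMap X (k + 1) ≫ segalSplit X k =
    cutMap ((restriction inertInclusion).obj X) (isCut_edge k) ≫
      hoPullback.map (segalMap X k) (𝟙 _) (𝟙 _)
        ((Category.comp_id _).trans (segalMap_segalTarget X k).symm) (by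
          exact (Category.comp_id _).trans (Category.id_comp _).symm) := by
  refine Eq.trans ?_ (hoPullback.ofComm_map _ _ _ _ _ _ _ _).symm
  apply sset_hom_ext
  intro n x
  refine Subtype.ext (Prod.ext (Prod.ext (Subtype.ext (Prod.ext (funext fun i ↦ ?_)
    (funext fun i ↦ ?_))) ?_) ?_)
  · have e : SimplexCategory.mkOfSucc i ≫ (inertMk ⟨⦋k + 1⦌⟩ ⟨⦋k + 2⦌⟩ 0 (by simp)).hom =
        SimplexCategory.mkOfSucc i.castSucc :=
      congrArg (fun f ↦ f.hom) (edgeMap_comp (U := ⟨⦋k + 2⦌⟩) (V := ⟨⦋k + 1⦌⟩)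
        (inertMk _ _ 0 (by simp)) i i.castSucc (Fin.ext (zero_add _)) (Fin.ext (zero_add _)))
    change SSet.yonedaEquiv.symm x ≫ (X.map (SimplexCategory.mkOfSucc i.castSucc).op).hom =
      SSet.yonedaEquiv.symm ((X.map (inertMk ⟨⦋k + 1⦌⟩ ⟨⦋k + 2⦌⟩ 0 (by simp)).hom.op).hom.app _ x) ≫
        (X.map (SimplexCategory.mkOfSucc i).op).hom
    rw [← e, op_comp, CategoryTheory.Functor.map_comp, ← SSet.yonedaEquiv_symm_comp, Category.assoc]
    rfl
  · have e : SimplexCategory.const ⦋0⦌ ⦋k + 1⦌ i.succ.castSucc ≫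
        (inertMk ⟨⦋k + 1⦌⟩ ⟨⦋k + 2⦌⟩ 0 (by simp)).hom =
          SimplexCategory.const ⦋0⦌ ⦋k + 2⦌ i.castSucc.succ.castSucc := by
      apply SimplexCategory.Hom.ext
      ext
      exact zero_add _
    change fst _ _ ≫ SSet.yonedaEquiv.symm x ≫
        (X.map (SimplexCategory.const ⦋0⦌ ⦋k + 2⦌ i.castSucc.succ.castSucc).op).hom =
      fst _ _ ≫ SSet.yonedaEquiv.symm
        ((X.map (inertMk ⟨⦋k + 1⦌⟩ ⟨⦋k + 2⦌⟩ 0 (by simp)).hom.op).hom.app _ x) ≫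
          (X.map (SimplexCategory.const ⦋0⦌ ⦋k + 1⦌ i.succ.castSucc).op).hom
    rw [← e, op_comp, CategoryTheory.Functor.map_comp, ← SSet.yonedaEquiv_symm_comp, Category.assoc]
    rfl
  · have e : SimplexCategory.mkOfSucc (Fin.last (k + 1)) =
        (inertMk ⟨⦋1⦌⟩ ⟨⦋k + 2⦌⟩ (k + 1) (by simp)).hom := by
      apply SimplexCategory.Hom.ext
      ext (i : Fin 2)
      match i with
      | 0 => rfl
      | 1 => rfl
    change SSet.yonedaEquiv (SSet.yonedaEquiv.symm x ≫
      (X.map (SimplexCategory.mkOfSucc (Fin.last (k + 1))).op).hom) = _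
    rw [SSet.yonedaEquiv_comp, Equiv.apply_symm_apply, e]
    rfl
  · have e : SimplexCategory.const ⦋0⦌ ⦋k + 1⦌ (Fin.last (k + 1)) ≫
        (inertMk ⟨⦋k + 1⦌⟩ ⟨⦋k + 2⦌⟩ 0 (by simp)).hom =
          SimplexCategory.const ⦋0⦌ ⦋k + 2⦌ (Fin.last k).succ.castSucc := by
      apply SimplexCategory.Hom.ext
      ext
      exact zero_add _
    have e' := segalMap_segalTarget X k
    change fst _ _ ≫ SSet.yonedaEquiv.symm x ≫
        (X.map (SimplexCategory.const ⦋0⦌ ⦋k + 2⦌ (Fin.last k).succ.castSucc).op).hom =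
      SSet.yonedaEquiv.symm x ▷ _ ≫ fst _ _ ≫
        ((X.map (inertMk ⟨⦋k + 1⦌⟩ ⟨⦋k + 2⦌⟩ 0 (by simp)).hom.op).hom ≫ segalMap X k) ≫
          segalTarget X k
    rw [Category.assoc, e', whiskerRight_fst_assoc, ← e, op_comp, CategoryTheory.Functor.map_comp]
    rfl

/-- Up to equality there is one concatenation of an edge to `[k + 1]`. -/
theorem EdgeLocal.of_standard {A : SpacePresheaf.{u} InertCat}
    (h : ∀ k, IsHomotopyEquiv (cutMap A (isCut_edge k))) : EdgeLocal A := by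
  intro V₀ V₁ V₂ V p q f g hc h₁ h₂
  exact (isHomotopyEquiv_cutMap_iff_of_length hc (isCut_edge (V₁.obj.len - 1))
    (Nat.sub_add_cancel h₁).symm h₂).2 (h _)

/-- A simplicial space is Segal if and only if it takes concatenations with a last edge to homotopy
pullbacks. -/
theorem isSegal_iff_edgeLocal :
    IsSegal X ↔ EdgeLocal ((restriction inertInclusion).obj X) := by
  have kan (n) : KanComplex (X.obj n).obj := (X.obj n).property
  have := segalFibreProduct_kanComplex X
  have step (k : ℕ) (hk : IsHomotopyEquiv (segalMap X k)) : IsHomotopyEquiv (segalMap X (k + 1)) ↔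
      IsHomotopyEquiv (cutMap ((restriction inertInclusion).obj X) (isCut_edge k)) := by
    have := isIso_segalSplit X k
    rw [← isHomotopyEquiv_comp_isIso_iff _ (segalSplit X k), segalMap_segalSplit]
    have : KanComplex (((restriction inertInclusion).obj X).obj (op ⟨⦋k + 2⦌⟩)).obj := kan _
    have e := hoPullback.map_isHomotopyEquiv (a := segalMap X k)
      (b := 𝟙 (X.obj (op ⦋1⦌)).obj) (c := 𝟙 (X.obj (op ⦋0⦌)).obj)
        (f := (X.map (SimplexCategory.const ⦋0⦌ ⦋k + 1⦌ (Fin.last (k + 1))).op).hom)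
        (g := (X.map (SimplexCategory.const ⦋0⦌ ⦋1⦌ 0).op).hom)
        ((Category.comp_id _).trans (segalMap_segalTarget X k).symm) (by
          rw [Category.comp_id, Category.id_comp]) hk (isHomotopyEquiv_of_isIso _)
          (isHomotopyEquiv_of_isIso _)
    exact isHomotopyEquiv_comp_iff_right e
  constructor
  · intro h
    exact EdgeLocal.of_standard fun k ↦ (step k (h k)).1 (h (k + 1))
  · intro h k
    induction k with
    | zero => exact isHomotopyEquiv_segalMap_zero X
    | succ k ih => exact (step k ih).2 (h _ (by simp) rfl)

end Segal

/-! ### Disjoint unions of simplicial sets -/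

section Sigma

open SSet modelCategoryQuillen

variable {S : Type}

/-- The disjoint union of a family of simplicial sets. -/
def sigmaSet (K : S → SSet.{u}) : SSet.{u} :=
  mkSSet (fun n ↦ Σ s, (K s).obj (op n)) (fun f x ↦ ⟨x.1, (K x.1).map f.op x.2⟩)
    (fun _ x ↦ Sigma.ext rfl (heq_of_eq (sset_map_id _)))
    (fun _ _ _ ↦ Sigma.ext rfl (heq_of_eq (sset_map_comp _ _ _).symm))

variable {K L : S → SSet.{u}} {M : SSet.{u}}

/-- The inclusion of a summand in a disjoint union. -/
def sigmaι (K : S → SSet.{u}) (s : S) : K s ⟶ sigmaSet K :=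
  mkHom (fun _ x ↦ ⟨s, x⟩) (fun _ _ ↦ rfl)

/-- The map out of a disjoint union given by maps out of the summands. -/
def sigmaDesc (f : ∀ s, K s ⟶ M) : sigmaSet K ⟶ M :=
  mkHom (fun n (x : Σ s, (K s).obj (op n)) ↦ (f x.1).app (op n) x.2) (by
    rintro m n g ⟨s, x⟩
    exact sset_naturality (f s) g x)

theorem sigmaι_desc (f : ∀ s, K s ⟶ M) (s : S) : sigmaι K s ≫ sigmaDesc f = f s := rfl

theorem sigmaSet_hom_ext {f g : sigmaSet K ⟶ M} (h : ∀ s, sigmaι K s ≫ f = sigmaι K s ≫ g) :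
    f = g := by
  apply sset_hom_ext
  rintro n ⟨s, x⟩
  exact congrArg (fun k ↦ k.app (op n) x) (h s)

/-- The map of disjoint unions given by maps of the summands. -/
def sigmaMap (f : ∀ s, K s ⟶ L s) : sigmaSet K ⟶ sigmaSet L :=
  sigmaDesc fun s ↦ f s ≫ sigmaι L s

/-- The map out of a product with a disjoint union given by maps out of the summands. -/
def sigmaTensorDesc {T : SSet.{u}} (h : ∀ s, K s ⊗ T ⟶ M) : sigmaSet K ⊗ T ⟶ M :=
  mkHom (fun n (q : (Σ s, (K s).obj (op n)) × T.obj (op n)) ↦ (h q.1.1).app (op n) (q.1.2, q.2)) (by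
    rintro m n g ⟨⟨s, x⟩, t⟩
    exact sset_naturality (h s) g (x, t))

instance (s : S) : Mono (sigmaι K s) := by
  rw [NatTrans.mono_iff_mono_app]
  intro n
  rw [mono_iff_injective]
  exact sigma_mk_injective (β := fun s ↦ (K s).obj n) (i := s)

/-- A map to a disjoint union whose simplices all lie in one summand factors through it. -/
theorem exists_comp_sigmaι (s : S) (m : M ⟶ sigmaSet K)
    (h : ∀ (n : SimplexCategory) (x : M.obj (op n)), (m.app (op n) x).1 = s) :
    ∃ m' : M ⟶ K s, m' ≫ sigmaι K s = m := by
  have h' (n : SimplexCategory) (x : M.obj (op n)) :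
      ∃ y : (K s).obj (op n), (sigmaι K s).app (op n) y = m.app (op n) x := by
    have hx := h n x
    generalize m.app (op n) x = z at hx
    obtain ⟨s', y⟩ := z
    obtain rfl : s' = s := hx
    exact ⟨y, rfl⟩
  choose y hy using h'
  refine ⟨mkHom y fun {k n} g x ↦ ?_, sset_hom_ext fun n x ↦ hy n x⟩
  have : Function.Injective ((sigmaι K s).app (op k)) :=
    sigma_mk_injective (β := fun s ↦ (K s).obj (op k)) (i := s)
  apply this
  rw [hy, sset_naturality, sset_naturality, hy]

/-- All simplices of a standard simplex have the same summand. -/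
theorem stdSimplex_summand {n k : SimplexCategory} (m : SSet.stdSimplex.obj n ⟶ sigmaSet K)
    (t : (SSet.stdSimplex.obj n).obj (op k)) :
    (m.app (op k) t).1 = (SSet.yonedaEquiv m).1 := by
  obtain ⟨x, rfl⟩ := SSet.yonedaEquiv.symm.surjective m
  rw [Equiv.apply_symm_apply]
  rfl

/-- Horns have pairwise intersecting faces, so they lie in a single summand. -/
theorem sigmaSet_kanComplex (hK : ∀ s, KanComplex (K s)) : KanComplex (sigmaSet K) := by
  rw [KanComplex.iff]
  intro n i f hf
  obtain ⟨j₀, hj₀⟩ : ∃ j₀ : Fin (n + 2), j₀ ≠ i := exists_ne i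
  let s := (SSet.yonedaEquiv (f j₀ hj₀)).1
  have hs (j) (hj : j ≠ i) : (SSet.yonedaEquiv (f j hj)).1 = s := by
    cases n with
    | zero =>
      obtain rfl : j = j₀ := by omega
      rfl
    | succ n =>
      have key (j k) (hj : j ≠ i) (hk : k ≠ i) (hjk : j < k) :
          (SSet.yonedaEquiv (f j hj)).1 = (SSet.yonedaEquiv (f k hk)).1 := by
        have := congrArg (fun m : Δ[n] ⟶ sigmaSet K ↦ (SSet.yonedaEquiv m).1)
          ((horn.isCompatible_iff f).1 hf j k hj hk hjk)
        exact (stdSimplex_summand _ _).symm.trans (this.trans (stdSimplex_summand _ _))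
      rcases lt_trichotomy j j₀ with h | rfl | h
      · exact key _ _ hj hj₀ h
      · rfl
      · exact (key _ _ hj₀ hj h).symm
  choose f' hf' using fun j hj ↦ exists_comp_sigmaι s (f j hj)
    fun n x ↦ (stdSimplex_summand _ x).trans (hs j hj)
  have hc : horn.IsCompatible f' := by
    cases n with
    | zero => trivial
    | succ n =>
      rw [horn.isCompatible_iff] at hf ⊢
      intro j k hj hk hjk
      rw [← cancel_mono (sigmaι K s), Category.assoc, Category.assoc, hf', hf']
      exact hf j k hj hk hjk
  obtain ⟨φ, hφ⟩ := KanComplex.iff.1 (hK s) f' hc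
  exact ⟨φ ≫ sigmaι K s, fun j hj ↦ by rw [← Category.assoc, hφ, hf']⟩

/-- A homotopy does not change the summand. -/
theorem homotopy_summand (H : M ⊗ Δ[1] ⟶ sigmaSet K) {n : SimplexCategory} (z : M.obj (op n))
    (t t' : (Δ[1] : SSet.{u}).obj (op n)) :
    (H.app (op n) (z, t)).1 = (H.app (op n) (z, t')).1 := by
  let v : ⦋0⦌ ⟶ n := SimplexCategory.const ⦋0⦌ n 0
  let z' : M.obj (op ⦋1⦌) := M.map (SimplexCategory.σ 0).op (M.map v.op z)
  let e : (Δ[1] : SSet.{u}).obj (op ⦋1⦌) := SSet.stdSimplex.objEquiv.symm (𝟙 _)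
  have key (t : (Δ[1] : SSet.{u}).obj (op n)) :
      (H.app (op n) (z, t)).1 = (H.app (op ⦋1⦌) (z', e)).1 := by
    let d : ⦋0⦌ ⟶ ⦋1⦌ := v ≫ SSet.stdSimplex.objEquiv t
    have h₁ : (H.app (op ⦋0⦌) (M.map v.op z, (Δ[1] : SSet.{u}).map v.op t)).1 =
        (H.app (op n) (z, t)).1 := congrArg Sigma.fst (sset_naturality H v (z, t))
    have h₂ : (H.app (op ⦋0⦌) (M.map d.op z', (Δ[1] : SSet.{u}).map d.op e)).1 =
        (H.app (op ⦋1⦌) (z', e)).1 := congrArg Sigma.fst (sset_naturality H d (z', e))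
    rw [← h₁, ← h₂]
    have h₃ : M.map d.op z' = M.map v.op z := by
      have : d ≫ SimplexCategory.σ 0 = 𝟙 _ := Subsingleton.elim _ _
      have h := sset_map_comp (K := M) d (SimplexCategory.σ 0) (M.map v.op z)
      rw [this, sset_map_id] at h
      exact h
    have h₄ : (Δ[1] : SSet.{u}).map d.op e = (Δ[1] : SSet.{u}).map v.op t := by
      apply SSet.stdSimplex.objEquiv.injective
      exact Category.comp_id d
    rw [h₃, h₄]
  rw [key, key]

theorem Homotopic.of_sigmaι {s : S} {a b : M ⟶ K s}
    (h : Homotopic (a ≫ sigmaι K s) (b ≫ sigmaι K s)) : Homotopic a b := by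
  rw [homotopic_iff] at h ⊢
  obtain ⟨H, h₀, h₁⟩ := h
  obtain ⟨H', rfl⟩ := exists_comp_sigmaι s H (by
    rintro n ⟨z, t⟩
    exact (homotopy_summand H z t _).trans
      (congrArg (fun k ↦ (k.app (op n) z : Σ s, (K s).obj (op n)).1) h₀))
  refine ⟨H', ?_, ?_⟩
  · rw [← cancel_mono (sigmaι K s), Category.assoc, h₀]
  · rw [← cancel_mono (sigmaι K s), Category.assoc, h₁]

theorem Homotopic.sigma {f g : ∀ s, K s ⟶ M} (h : ∀ s, Homotopic (f s) (g s)) :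
    Homotopic (sigmaDesc f) (sigmaDesc g) := by
  simp only [homotopic_iff] at h ⊢
  choose H h₀ h₁ using h
  exact ⟨sigmaTensorDesc H, sigmaSet_hom_ext h₀, sigmaSet_hom_ext h₁⟩

/-- A map of disjoint unions is a homotopy equivalence if and only if all its summands are. -/
theorem isHomotopyEquiv_sigmaMap_iff (f : ∀ s, K s ⟶ L s) :
    IsHomotopyEquiv (sigmaMap f) ↔ ∀ s, IsHomotopyEquiv (f s) := by
  constructor
  · rintro ⟨g, h₁, h₂⟩ s
    obtain ⟨g', hg'⟩ := exists_comp_sigmaι s (sigmaι L s ≫ g) (by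
      intro n y
      obtain ⟨H, H₀, H₁⟩ := (homotopic_iff _ _).1 h₂
      have e₀ := congrArg (fun k ↦ (k.app (op n) ⟨s, y⟩ : Σ s, (L s).obj (op n)).1) H₀
      have e₁ := congrArg (fun k ↦ (k.app (op n) ⟨s, y⟩ : Σ s, (L s).obj (op n)).1) H₁
      exact e₀.symm.trans ((homotopy_summand H _ _ _).trans e₁))
    refine ⟨g', Homotopic.of_sigmaι ?_, Homotopic.of_sigmaι ?_⟩
    · have := Homotopic.precomp h₁ (sigmaι K s)
      rw [Category.assoc, hg']
      exact this
    · have := Homotopic.precomp h₂ (sigmaι L s)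
      rw [← Category.assoc, ← hg', Category.assoc] at this
      exact this
  · intro h
    choose g h₁ h₂ using h
    refine ⟨sigmaMap g, ?_, ?_⟩
    · have e : sigmaMap f ≫ sigmaMap g = sigmaDesc fun s ↦ (f s ≫ g s) ≫ sigmaι K s :=
        sigmaSet_hom_ext fun s ↦ rfl
      have e' : 𝟙 (sigmaSet K) = sigmaDesc fun s ↦ 𝟙 (K s) ≫ sigmaι K s :=
        sigmaSet_hom_ext fun s ↦ rfl
      rw [e, e']
      exact Homotopic.sigma fun s ↦ Homotopic.postcomp (h₁ s) (sigmaι K s)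
    · have e : sigmaMap g ≫ sigmaMap f = sigmaDesc fun s ↦ (g s ≫ f s) ≫ sigmaι L s :=
        sigmaSet_hom_ext fun s ↦ rfl
      have e' : 𝟙 (sigmaSet L) = sigmaDesc fun s ↦ 𝟙 (L s) ≫ sigmaι L s :=
        sigmaSet_hom_ext fun s ↦ rfl
      rw [e, e']
      exact Homotopic.sigma fun s ↦ Homotopic.postcomp (h₂ s) (sigmaι L s)

section Pullback

theorem hoPullback.symm_path {K L M : SSet.{u}} (f : K ⟶ M) (g : L ⟶ M) {n : SimplexCategory}
    (p : (hoPullback f g).obj (op n)) :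
    SSet.yonedaEquiv.symm p ▷ _ ≫ hoPullback.path f g = p.1.2 := by
  apply sset_hom_ext
  rintro m ⟨s, t⟩
  obtain ⟨s, rfl⟩ := SSet.stdSimplex.objEquiv.symm.surjective s
  exact (hoPullback.path_app p s t).symm

variable {S₁ S₂ : Type} {K₁ : S₁ → SSet.{u}} {K₂ : S₂ → SSet.{u}} (f : ∀ s, K₁ s ⟶ M)
  (g : ∀ s, K₂ s ⟶ M) (r₁ : S → S₁) (r₂ : S → S₂)

/-- The comparison of a disjoint union of homotopy pullbacks with the homotopy pullback of disjoint
unions. -/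
def sigmaPullback : sigmaSet (fun s ↦ hoPullback (f (r₁ s)) (g (r₂ s))) ⟶
    hoPullback (sigmaDesc f) (sigmaDesc g) :=
  sigmaDesc fun s ↦ hoPullback.map (sigmaι K₁ (r₁ s)) (sigmaι K₂ (r₂ s)) (𝟙 M)
    (Category.comp_id _) (Category.comp_id _)

/-- Homotopy pullbacks over a fixed base commute with disjoint unions. -/
theorem isIso_sigmaPullback (hr : Function.Bijective fun s ↦ (r₁ s, r₂ s)) :
    IsIso (sigmaPullback f g r₁ r₂) := by
  have path {n : SimplexCategory} (s : S) (p : (hoPullback (f (r₁ s)) (g (r₂ s))).obj (op n)) :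
      ((sigmaPullback f g r₁ r₂).app (op n) ⟨s, p⟩).1.2 = p.1.2 := by
    change SSet.yonedaEquiv.symm p ▷ _ ≫ hoPullback.path _ _ ≫ 𝟙 M = _
    rw [Category.comp_id, hoPullback.symm_path]
  have (n : SimplexCategoryᵒᵖ) : IsIso ((sigmaPullback f g r₁ r₂).app n) := by
    rw [isIso_iff_bijective]
    constructor
    · rintro ⟨s, p⟩ ⟨s', p'⟩ h
      have h₁ := congrArg (fun q ↦ q.1.1.1) h
      have h₂ := congrArg (fun q ↦ q.1.1.2) h
      have h₃ := congrArg (fun q ↦ q.1.2) h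
      obtain rfl : s = s' := hr.injective
        (Prod.ext (congrArg Sigma.fst h₁) (congrArg Sigma.fst h₂))
      refine Sigma.ext rfl (heq_of_eq (Subtype.ext (Prod.ext (Prod.ext ?_ ?_) ?_)))
      · exact sigma_mk_injective (β := fun s ↦ (K₁ s).obj n) h₁
      · exact sigma_mk_injective (β := fun s ↦ (K₂ s).obj n) h₂
      · exact (path s p).symm.trans (h₃.trans (path s p'))
    · rintro ⟨⟨⟨⟨s₁, a⟩, ⟨s₂, b⟩⟩, h⟩, h₀, h₁⟩
      obtain ⟨s, hs⟩ := hr.surjective (s₁, s₂)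
      obtain rfl : r₁ s = s₁ := congrArg Prod.fst hs
      obtain rfl : r₂ s = s₂ := congrArg Prod.snd hs
      refine ⟨⟨s, ⟨((a, b), h), h₀, h₁⟩⟩, Subtype.ext (Prod.ext rfl (path s _))⟩
  exact NatIso.isIso_of_isIso_app _

end Pullback

end Sigma

/-! ### The left adjoint of restriction along the inert maps -/

section Free

/-- An active map out of `[n]`, that is, a monotone map from `[n]` to `[m]` that preserves the first
and the last element, encoded as a monotone sequence of natural numbers that starts at `0`. The
target `[m]` is determined by the last value. -/
def Act (n : SimplexCategory) : Type := { h : Fin (n.len + 1) → ℕ // Monotone h ∧ h 0 = 0 }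

namespace Act

variable {l m n : SimplexCategory}

/-- The last value of an active map. -/
def top (h : Act n) : ℕ := h.1 (Fin.last n.len)

theorem le_top (h : Act n) (i : Fin (n.len + 1)) : h.1 i ≤ h.top := h.2.1 (Fin.le_last i)

/-- The target of an active map. -/
abbrev target (h : Act n) : InertCat := ⟨⦋h.top⦌⟩

/-- The underlying monotone map of an active map. -/
def hom (h : Act n) : n ⟶ ⦋h.top⦌ :=
  SimplexCategory.Hom.mk ⟨fun i ↦ ⟨h.1 i, Nat.lt_succ_of_le (h.le_top i)⟩, fun _ _ hij ↦ h.2.1 hij⟩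

/-- The identity, as an active map. -/
def id (n : SimplexCategory) : Act n := ⟨fun i ↦ i, fun _ _ h ↦ h, rfl⟩

/-- The active part of the composition of a monotone map and an active map. -/
def pull (φ : m ⟶ n) (h : Act n) : Act m :=
  ⟨fun i ↦ h.1 (φ.toOrderHom i) - h.1 (φ.toOrderHom 0),
    fun _ _ hij ↦ Nat.sub_le_sub_right (h.2.1 (φ.toOrderHom.monotone hij)) _, Nat.sub_self _⟩

theorem apply_zero_le (φ : m ⟶ n) (h : Act n) (i : Fin (m.len + 1)) :
    h.1 (φ.toOrderHom 0) ≤ h.1 (φ.toOrderHom i) :=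
  h.2.1 (φ.toOrderHom.monotone (Fin.zero_le i))

theorem apply_zero_add_top_pull_le (φ : m ⟶ n) (h : Act n) :
    h.1 (φ.toOrderHom 0) + (pull φ h).top ≤ h.top :=
  (Nat.add_sub_of_le (apply_zero_le φ h _)).trans_le (h.le_top _)

/-- The inert part of the composition of a monotone map and an active map. -/
def inertPart (φ : m ⟶ n) (h : Act n) : (pull φ h).target ⟶ h.target :=
  inertMk _ _ (h.1 (φ.toOrderHom 0)) (apply_zero_add_top_pull_le φ h)

theorem pull_hom_inertPart (φ : m ⟶ n) (h : Act n) :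
    (pull φ h).hom ≫ (inertPart φ h).hom = φ ≫ h.hom := by
  apply SimplexCategory.Hom.ext
  ext i
  exact Nat.add_sub_of_le (apply_zero_le φ h i)

theorem pull_id (h : Act n) : pull (𝟙 n) h = h :=
  Subtype.ext (funext fun i ↦ (congrArg (h.1 i - ·) h.2.2).trans (Nat.sub_zero _))

theorem pull_comp (φ : l ⟶ m) (ψ : m ⟶ n) (h : Act n) : pull (φ ≫ ψ) h = pull φ (pull ψ h) :=
  Subtype.ext (funext fun _ ↦
    (Nat.sub_sub_sub_cancel_right (apply_zero_le ψ h (φ.toOrderHom 0))).symm)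

theorem pull_inert {V W : InertCat} (a : W ⟶ V) : pull a.hom (id V.obj) = id W.obj := by
  refine Subtype.ext (funext fun i ↦ ?_)
  change (a.hom.toOrderHom i : ℕ) - shift a = i
  rw [inert_apply, Nat.add_sub_cancel_left]

end Act

variable (A : SpacePresheaf.{u} InertCat)

/-- The values of a presheaf at the targets of the active maps out of `[n]`. -/
abbrev freeSummand (n : SimplexCategory) (h : Act n) : SSet.{u} := (A.obj (op h.target)).obj

/-- The inclusion of the summand of an active map. -/
abbrev freeι (n : SimplexCategory) (h : Act n) :
    (A.obj (op h.target)).obj ⟶ sigmaSet (freeSummand A n) := sigmaι (freeSummand A n) h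

/-- The inclusion of a summand, after restriction along an inert map, depends only on the active
map and on the translation. -/
theorem map_sigmaι_congr {n : SimplexCategory} {h h' : Act n} (e : h = h') {V : InertCat}
    (a : h.target ⟶ V) (a' : h'.target ⟶ V) (ha : shift a = shift a') :
    (A.map a.op).hom ≫ freeι A n h =
      (A.map a'.op).hom ≫ freeι A n h' := by
  subst e
  rw [inert_hom_ext ha]

theorem map_hom_comp_hom {V W Z : InertCat} (a : V ⟶ W) (b : W ⟶ Z) :
    (A.map b.op).hom ≫ (A.map a.op).hom = (A.map (a ≫ b).op).hom := by
  rw [op_comp, CategoryTheory.Functor.map_comp]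
  rfl

/-- The left adjoint of restriction along the inert maps, on a presheaf of spaces. As every monotone
map is uniquely an active map followed by an inert map, its value at `[n]` is the disjoint union of
the values of the presheaf at the targets of the active maps out of `[n]`. -/
def freeObj : SpacePresheaf.{u} SimplexCategory where
  obj n := ⟨sigmaSet (freeSummand A n.unop),
    sigmaSet_kanComplex fun h ↦ (A.obj (op h.target)).property⟩
  map {_ m} φ := ObjectProperty.homMk (sigmaDesc fun h ↦
    (A.map (Act.inertPart φ.unop h).op).hom ≫ freeι A m.unop (Act.pull φ.unop h))
  map_id n := by
    apply ObjectProperty.hom_ext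
    refine sigmaSet_hom_ext fun h ↦ ?_
    refine (map_sigmaι_congr A (Act.pull_id h) (Act.inertPart (𝟙 n.unop) h) (𝟙 _) h.2.2).trans ?_
    rw [op_id, CategoryTheory.Functor.map_id]
    rfl
  map_comp {n m l} ψ φ := by
    apply ObjectProperty.hom_ext
    refine sigmaSet_hom_ext fun h ↦ ?_
    refine (map_sigmaι_congr A (Act.pull_comp φ.unop ψ.unop h)
      (Act.inertPart (φ.unop ≫ ψ.unop) h)
      (Act.inertPart φ.unop (Act.pull ψ.unop h) ≫ Act.inertPart ψ.unop h) ?_).trans ?_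
    · rw [shift_comp]
      exact (Nat.sub_add_cancel (Act.apply_zero_le ψ.unop h _)).symm
    · rw [← map_hom_comp_hom]
      rfl

/-- The left adjoint of restriction along the inert maps, on presheaves of spaces. -/
def free : SpacePresheaf.{u} InertCat ⥤ SpacePresheaf.{u} SimplexCategory where
  obj := freeObj
  map {A B} f :=
    { app := fun n ↦ ObjectProperty.homMk (sigmaMap fun h : Act n.unop ↦ (f.app (op h.target)).hom)
      naturality := fun n m φ ↦ by
        apply ObjectProperty.hom_ext
        refine sigmaSet_hom_ext fun h ↦ ?_
        have e := congrArg (fun k ↦ k.hom) (f.naturality (Act.inertPart φ.unop h).op)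
        exact congrArg (fun k : (A.obj (op h.target)).obj ⟶
          (B.obj (op (Act.pull φ.unop h).target)).obj ↦ k ≫ freeι B m.unop (Act.pull φ.unop h)) e }
  map_id A := by
    refine NatTrans.ext (funext fun n ↦ ObjectProperty.hom_ext _ ?_)
    exact sigmaSet_hom_ext fun h ↦ rfl
  map_comp f g := by
    refine NatTrans.ext (funext fun n ↦ ObjectProperty.hom_ext _ ?_)
    exact sigmaSet_hom_ext fun h ↦ rfl

/-- The unit of the adjunction: the inclusion of the summand of the identity. -/
def freeUnit : A ⟶ (restriction inertInclusion).obj (freeObj A) where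
  app V := ObjectProperty.homMk ((A.map (inertMk (Act.id V.unop.obj).target V.unop 0
    (Nat.zero_add _).le).op).hom ≫ freeι A V.unop.obj (Act.id V.unop.obj))
  naturality V W a := by
    apply ObjectProperty.hom_ext
    change (A.map a.unop.op).hom ≫ (A.map _).hom ≫ freeι A W.unop.obj _ = (A.map _).hom ≫
      (A.map (Act.inertPart a.unop.hom (Act.id V.unop.obj)).op).hom ≫ freeι A W.unop.obj _
    rw [← Category.assoc, ← Category.assoc, map_hom_comp_hom, map_hom_comp_hom]
    refine (map_sigmaι_congr A (Act.pull_inert a.unop) _ _ ?_).symm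
    rw [shift_comp, shift_comp]
    exact (Nat.add_zero _).trans (Nat.zero_add _).symm

/-- The counit of the adjunction: on the summand of an active map, restriction along it. -/
def freeCounit (X : SpacePresheaf.{u} SimplexCategory) :
    freeObj ((restriction inertInclusion).obj X) ⟶ X where
  app n := ObjectProperty.homMk (sigmaDesc fun h : Act n.unop ↦ (X.map h.hom.op).hom)
  naturality n m φ := by
    apply ObjectProperty.hom_ext
    refine sigmaSet_hom_ext fun h ↦ ?_
    change (X.map (Act.inertPart φ.unop h).hom.op ≫ X.map (Act.pull φ.unop h).hom.op).hom =
      (X.map h.hom.op ≫ X.map φ.unop.op).hom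
    rw [← CategoryTheory.Functor.map_comp, ← CategoryTheory.Functor.map_comp, ← op_comp, ← op_comp,
      Act.pull_hom_inertPart]

/-- The adjunction of `free` and restriction along the inert maps. -/
def freeAdjunction : free.{u} ⊣ restriction inertInclusion where
  unit :=
    { app := freeUnit
      naturality := fun A B f ↦ by
        refine NatTrans.ext (funext fun V ↦ ObjectProperty.hom_ext _ ?_)
        have e := congrArg (fun k ↦ k.hom)
          (f.naturality (inertMk (Act.id V.unop.obj).target V.unop 0
          (Nat.zero_add _).le).op)
        exact (congrArg (fun k : (A.obj V).obj ⟶ (B.obj (op (Act.id V.unop.obj).target)).obj ↦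
          k ≫ freeι B V.unop.obj (Act.id V.unop.obj)) e).symm }
  counit :=
    { app := freeCounit
      naturality := fun X Y f ↦ by
        refine NatTrans.ext (funext fun n ↦ ObjectProperty.hom_ext _ ?_)
        refine sigmaSet_hom_ext fun h ↦ ?_
        exact congrArg (fun k ↦ k.hom) (f.naturality h.hom.op).symm }
  left_triangle_components A := by
    refine NatTrans.ext (funext fun n ↦ ObjectProperty.hom_ext _ ?_)
    refine sigmaSet_hom_ext fun h ↦ ?_
    change ((A.map (inertMk (Act.id ⦋h.top⦌).target h.target 0 (Nat.zero_add _).le).op).hom ≫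
      (A.map (Act.inertPart h.hom (Act.id ⦋h.top⦌)).op).hom ≫
        freeι A n.unop (Act.pull h.hom (Act.id ⦋h.top⦌))) = freeι A n.unop h
    rw [← Category.assoc, map_hom_comp_hom]
    refine (map_sigmaι_congr A ?_ _ (𝟙 _) ?_).trans ?_
    · exact Subtype.ext (funext fun i ↦ (congrArg (h.1 i - ·) h.2.2).trans (Nat.sub_zero _))
    · rw [shift_comp]
      exact h.2.2
    · rw [op_id, CategoryTheory.Functor.map_id]
      rfl
  right_triangle_components X := by
    refine NatTrans.ext (funext fun V ↦ ObjectProperty.hom_ext _ ?_)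
    let a : (Act.id V.unop.obj).target ⟶ V.unop := inertMk _ _ 0 (Nat.zero_add _).le
    have e : (Act.id V.unop.obj).hom ≫ a.hom = 𝟙 _ := by
      apply SimplexCategory.Hom.ext
      ext i
      exact Nat.zero_add _
    change (X.map a.hom.op ≫ X.map (Act.id V.unop.obj).hom.op).hom = _
    rw [← CategoryTheory.Functor.map_comp, ← op_comp, e, op_id, CategoryTheory.Functor.map_id]
    rfl

end Free

/-! ### Existence and uniqueness of the homotopy left Kan extension -/

section HoFree

/-- The left adjoint preserves objectwise homotopy equivalences, so it need not be derived. -/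
theorem free_map_mem {A B : SpacePresheaf.{u} InertCat} (f : A ⟶ B)
    (hf : presheafEquivalences InertCat f) :
    presheafEquivalences SimplexCategory (free.map f) := fun n ↦ by
  have hf' (V) : IsHomotopyEquiv (f.app V).hom := hf V
  have h : IsHomotopyEquiv (sigmaMap fun h : Act n.unop ↦ (f.app (op h.target)).hom) :=
    (isHomotopyEquiv_sigmaMap_iff _).2 fun h ↦ hf' _
  exact h

theorem free_inverts : (presheafEquivalences.{u} InertCat).IsInvertedBy
    (free.{u} ⋙ (presheafEquivalences.{u} SimplexCategory).Q) := fun _ _ f hf ↦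
  (presheafEquivalences.{u} SimplexCategory).Q_inverts (free.map f) (free_map_mem f hf)

/-- The functor induced by `free` on homotopy categories. -/
def hoFree : HoPresheaf.{u} InertCat ⥤ HoPresheaf.{u} SimplexCategory :=
  Localization.Construction.lift (free.{u} ⋙ (presheafEquivalences.{u} SimplexCategory).Q)
    free_inverts

instance : CatCommSq free.{u} (presheafEquivalences.{u} InertCat).Q
    (presheafEquivalences.{u} SimplexCategory).Q hoFree where
  iso := eqToIso (Localization.Construction.fac _ free_inverts).symm

instance : CatCommSq (restriction.{u} inertInclusion) (presheafEquivalences.{u} SimplexCategory).Q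
    (presheafEquivalences.{u} InertCat).Q (hoRestriction inertInclusion) where
  iso := eqToIso (Localization.Construction.fac _ (restriction_inverts inertInclusion)).symm

/-- The adjunction of `hoFree` and restriction along the inert maps, on homotopy categories. -/
def hoFreeAdjunction : hoFree.{u} ⊣ hoRestriction inertInclusion :=
  freeAdjunction.localization (presheafEquivalences.{u} InertCat).Q
    (presheafEquivalences.{u} InertCat) (presheafEquivalences.{u} SimplexCategory).Q
    (presheafEquivalences.{u} SimplexCategory) _ _

theorem isHomotopyLeftKanExtension_free (A : SpacePresheaf.{u} InertCat) :
    IsHomotopyLeftKanExtension inertInclusion A (freeObj A) :=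
  ⟨hoFreeAdjunction.unit.app ((presheafEquivalences.{u} InertCat).Q.obj A),
    ⟨mkInitialOfLeftAdjoint _ hoFreeAdjunction ((presheafEquivalences.{u} InertCat).Q.obj A)⟩⟩

/-- Homotopy left Kan extensions are unique up to isomorphism in the homotopy category. -/
theorem IsHomotopyLeftKanExtension.nonempty_iso {C D : Type} [SmallCategory C] [SmallCategory D]
    {j : C ⥤ D} {A : SpacePresheaf.{u} C} {X Y : SpacePresheaf.{u} D}
    (hX : IsHomotopyLeftKanExtension j A X) (hY : IsHomotopyLeftKanExtension j A Y) :
    Nonempty ((presheafEquivalences.{u} D).Q.obj X ≅ (presheafEquivalences.{u} D).Q.obj Y) := by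
  obtain ⟨η, ⟨h⟩⟩ := hX
  obtain ⟨η', ⟨h'⟩⟩ := hY
  exact ⟨(StructuredArrow.proj _ _).mapIso (h.uniqueUpToIso h')⟩

end HoFree

/-! ### Homotopy invariance -/

section Invariance

variable {V₀ V₁ V₂ V : InertCat} {p : V₀ ⟶ V₁} {q : V₀ ⟶ V₂} {f : V₁ ⟶ V} {g : V₂ ⟶ V}

/-- The homotopy pullback of the values of a presheaf at the parts of a concatenation. -/
abbrev cutTarget (A : SpacePresheaf.{u} InertCat) (p : V₀ ⟶ V₁) (q : V₀ ⟶ V₂) : Space.{u} :=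
  ⟨hoPullback (A.map p.op).hom (A.map q.op).hom, inferInstance⟩

/-- The map of homotopy pullbacks induced by a map of presheaves. -/
def cutTargetMap {A B : SpacePresheaf.{u} InertCat} (φ : A ⟶ B) (p : V₀ ⟶ V₁) (q : V₀ ⟶ V₂) :
    hoPullback (A.map p.op).hom (A.map q.op).hom ⟶
      hoPullback (B.map p.op).hom (B.map q.op).hom :=
  hoPullback.map (φ.app (op V₁)).hom (φ.app (op V₂)).hom (φ.app (op V₀)).hom
    (congrArg (fun k ↦ k.hom) (φ.naturality p.op)) (congrArg (fun k ↦ k.hom) (φ.naturality q.op))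

theorem cutMap_naturality {A B : SpacePresheaf.{u} InertCat} (φ : A ⟶ B) (h : IsCut p q f g) :
    (φ.app (op V)).hom ≫ cutMap B h = cutMap A h ≫ cutTargetMap φ p q := by
  rw [cutMap, cutMap, cutTargetMap, hoPullback.ofComm_map, hoPullback.comp_ofComm]
  have e₁ : (φ.app (op V)).hom ≫ (B.map f.op).hom = (A.map f.op).hom ≫ (φ.app (op V₁)).hom :=
    congrArg (fun k ↦ k.hom) (φ.naturality f.op).symm
  have e₂ : (φ.app (op V)).hom ≫ (B.map g.op).hom = (A.map g.op).hom ≫ (φ.app (op V₂)).hom :=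
    congrArg (fun k ↦ k.hom) (φ.naturality g.op).symm
  congr 1

theorem cutTargetMap_comp {A B C : SpacePresheaf.{u} InertCat} (φ : A ⟶ B) (ψ : B ⟶ C) (p : V₀ ⟶ V₁)
    (q : V₀ ⟶ V₂) : cutTargetMap (φ ≫ ψ) p q = cutTargetMap φ p q ≫ cutTargetMap ψ p q := by
  rw [cutTargetMap, cutTargetMap, cutTargetMap, hoPullback.map_comp]
  rfl

/-- The comparison map of a concatenation, as a functor of the presheaf. -/
def cutFunctor (h : IsCut p q f g) : SpacePresheaf.{u} InertCat ⥤ Arrow Space.{u} where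
  obj A := Arrow.mk (ObjectProperty.homMk (cutMap A h) : A.obj (op V) ⟶ cutTarget A p q)
  map {A B} φ := Arrow.homMk (φ.app (op V)) (ObjectProperty.homMk (cutTargetMap φ p q))
    (ObjectProperty.hom_ext _ (cutMap_naturality φ h))
  map_id A := Arrow.hom_ext _ _ rfl (ObjectProperty.hom_ext _ hoPullback.map_id)
  map_comp φ ψ := Arrow.hom_ext _ _ rfl (ObjectProperty.hom_ext _ (cutTargetMap_comp φ ψ p q))

/-- In the homotopy category of spaces, the comparison map of a concatenation depends only on the
image of the presheaf in the homotopy category of presheaves. -/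
theorem cutFunctor_inverts (h : IsCut p q f g) :
    (presheafEquivalences.{u} InertCat).IsInvertedBy (cutFunctor.{u} h ⋙ toHo.mapArrow) := by
  intro A B φ hφ
  have hφ' (V) : IsHomotopyEquiv (φ.app V).hom := hφ V
  have h₁ : IsIso ((cutFunctor.{u} h ⋙ toHo.mapArrow).map φ).left :=
    (isIso_toHo_map_iff (φ.app (op V))).2 (hφ _)
  have h₂ : IsIso ((cutFunctor.{u} h ⋙ toHo.mapArrow).map φ).right :=
    (isIso_toHo_map_iff
      (ObjectProperty.homMk (cutTargetMap φ p q) : cutTarget A p q ⟶ cutTarget B p q)).2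
      (hoPullback.map_isHomotopyEquiv (congrArg (fun k ↦ k.hom) (φ.naturality p.op))
        (congrArg (fun k ↦ k.hom) (φ.naturality q.op)) (hφ' _) (hφ' _) (hφ' _))
  exact Arrow.isIso_of_isIso_left_of_isIso_right _

theorem isHomotopyEquiv_cutMap_iff_of_iso {A B : SpacePresheaf.{u} InertCat}
    (e : (presheafEquivalences.{u} InertCat).Q.obj A ≅ (presheafEquivalences.{u} InertCat).Q.obj B)
    (h : IsCut p q f g) : IsHomotopyEquiv (cutMap A h) ↔ IsHomotopyEquiv (cutMap B h) := by
  have i : (cutFunctor.{u} h ⋙ toHo.mapArrow).obj A ≅ (cutFunctor.{u} h ⋙ toHo.mapArrow).obj B :=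
    (Localization.Construction.lift _ (cutFunctor_inverts h)).mapIso e
  have e' := (MorphismProperty.isomorphisms HoSpace.{u}).arrow_mk_iso_iff i
  have iff (A : SpacePresheaf.{u} InertCat) := isIso_toHo_map_iff
    (ObjectProperty.homMk (cutMap A h) : A.obj (op V) ⟶ cutTarget A p q)
  exact (iff A).symm.trans (e'.trans (iff B))

theorem edgeLocal_restriction_iff_of_iso {X Y : SpacePresheaf.{u} SimplexCategory}
    (e : (presheafEquivalences.{u} SimplexCategory).Q.obj X ≅
      (presheafEquivalences.{u} SimplexCategory).Q.obj Y) :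
    EdgeLocal ((restriction inertInclusion).obj X) ↔
      EdgeLocal ((restriction inertInclusion).obj Y) := by
  have e' : (presheafEquivalences.{u} InertCat).Q.obj ((restriction inertInclusion).obj X) ≅
      (presheafEquivalences.{u} InertCat).Q.obj ((restriction inertInclusion).obj Y) :=
    (hoRestriction inertInclusion).mapIso e
  exact forall₄_congr fun _ _ _ _ ↦ forall₄_congr fun _ _ _ _ ↦ forall₃_congr fun h _ _ ↦
    isHomotopyEquiv_cutMap_iff_of_iso e' h

end Invariance

/-! ### Concatenations and the left adjoint -/

section FreeCut

variable {V₀ V₁ V₂ V : InertCat} {p : V₀ ⟶ V₁} {q : V₀ ⟶ V₂} {f : V₁ ⟶ V} {g : V₂ ⟶ V}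

theorem IsCut.f_apply (h : IsCut p q f g) (i : Fin (V₁.obj.len + 1)) :
    (f.hom.toOrderHom i : ℕ) = i := by
  rw [inert_apply, h.shift_f, zero_add]

theorem IsCut.g_apply (h : IsCut p q f g) (i : Fin (V₂.obj.len + 1)) :
    (g.hom.toOrderHom i : ℕ) = V₁.obj.len + i := by
  rw [inert_apply, h.shift_g]

/-- An active map out of a concatenation decomposes its target as a concatenation. -/
theorem IsCut.act (h : IsCut p q f g) (H : Act V.obj) :
    IsCut (inertMk ⟨⦋0⦌⟩ (Act.pull f.hom H).target (Act.pull f.hom H).top (le_refl _))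
      (inertMk ⟨⦋0⦌⟩ (Act.pull g.hom H).target 0 (Nat.zero_le _))
      (Act.inertPart f.hom H) (Act.inertPart g.hom H) := by
  have e₁ : H.1 (f.hom.toOrderHom 0) = 0 :=
    (congrArg H.1 (Fin.ext (h.f_apply 0))).trans H.2.2
  have e₂ : f.hom.toOrderHom (Fin.last _) = g.hom.toOrderHom 0 :=
    Fin.ext ((h.f_apply _).trans (h.g_apply 0).symm)
  have e₃ : g.hom.toOrderHom (Fin.last _) = Fin.last _ :=
    Fin.ext ((h.g_apply _).trans h.len_add)
  have e₄ : (Act.pull f.hom H).top = H.1 (g.hom.toOrderHom 0) := by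
    change H.1 _ - H.1 _ = _
    rw [e₁, e₂, Nat.sub_zero]
  refine ⟨rfl, ?_, rfl, rfl, e₁, e₄.symm⟩
  change (Act.pull f.hom H).top + (H.1 _ - H.1 _) = H.1 _
  rw [e₄, e₃]
  exact Nat.add_sub_of_le (H.le_top _)

/-- Active maps out of a concatenation are pairs of active maps out of the parts. -/
theorem IsCut.bijective_pull (h : IsCut p q f g) :
    Function.Bijective fun H : Act V.obj ↦ (Act.pull f.hom H, Act.pull g.hom H) := by
  have hl := h.len_add
  constructor
  · intro H H' e
    have e₁ (i) : H.1 (f.hom.toOrderHom i) - H.1 (f.hom.toOrderHom 0) =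
        H'.1 (f.hom.toOrderHom i) - H'.1 (f.hom.toOrderHom 0) :=
      congrFun (congrArg (fun k ↦ k.1.1) e) i
    have e₂ (i) : H.1 (g.hom.toOrderHom i) - H.1 (g.hom.toOrderHom 0) =
        H'.1 (g.hom.toOrderHom i) - H'.1 (g.hom.toOrderHom 0) :=
      congrFun (congrArg (fun k ↦ k.2.1) e) i
    have f0 : f.hom.toOrderHom 0 = 0 := Fin.ext (h.f_apply 0)
    have e₁' (i) : H.1 (f.hom.toOrderHom i) = H'.1 (f.hom.toOrderHom i) := by
      simpa only [f0, H.2.2, H'.2.2, Nat.sub_zero] using e₁ i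
    have fg : g.hom.toOrderHom 0 = f.hom.toOrderHom (Fin.last _) :=
      Fin.ext ((h.g_apply 0).trans (h.f_apply (Fin.last _)).symm)
    refine Subtype.ext (funext fun i ↦ ?_)
    by_cases hi : (i : ℕ) ≤ V₁.obj.len
    · have : i = f.hom.toOrderHom ⟨i, Nat.lt_succ_of_le hi⟩ :=
        Fin.ext (h.f_apply ⟨i, Nat.lt_succ_of_le hi⟩).symm
      rw [this, e₁']
    · have : i = g.hom.toOrderHom ⟨i - V₁.obj.len, by omega⟩ :=
        Fin.ext ((Nat.add_sub_of_le (Nat.le_of_not_le hi)).symm.trans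
          (h.g_apply ⟨i - V₁.obj.len, by omega⟩).symm)
      have h₂ := e₂ ⟨i - V₁.obj.len, by omega⟩
      rw [← this, fg, e₁'] at h₂
      have h₃ := Act.apply_zero_le g.hom H ⟨i - V₁.obj.len, by omega⟩
      have h₄ := Act.apply_zero_le g.hom H' ⟨i - V₁.obj.len, by omega⟩
      rw [← this, fg] at h₃ h₄
      rw [e₁'] at h₃
      omega
  · rintro ⟨H₁, H₂⟩
    let F (i : ℕ) : ℕ := if hi : i ≤ V₁.obj.len then H₁.1 ⟨i, Nat.lt_succ_of_le hi⟩
      else H₁.top + H₂.1 ⟨min (i - V₁.obj.len) V₂.obj.len, by omega⟩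
    have F₁ (i : Fin (V₁.obj.len + 1)) : F i = H₁.1 i := dif_pos (Nat.le_of_lt_succ i.isLt)
    have F₃ {i : ℕ} (hi : ¬ i ≤ V₁.obj.len) :
        F i = H₁.top + H₂.1 ⟨min (i - V₁.obj.len) V₂.obj.len, by omega⟩ := dif_neg hi
    have F₂ (i : Fin (V₂.obj.len + 1)) : F (V₁.obj.len + i) = H₁.top + H₂.1 i := by
      by_cases hi : (i : ℕ) = 0
      · obtain rfl : i = 0 := Fin.ext hi
        rw [H₂.2.2]
        exact F₁ (Fin.last _)
      · refine (F₃ (by omega)).trans (congrArg (H₁.top + H₂.1 ·) (Fin.ext ?_))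
        change min (V₁.obj.len + i - V₁.obj.len) V₂.obj.len = i
        have := i.isLt
        omega
    have hF : Monotone F := by
      intro a b hab
      by_cases hb : b ≤ V₁.obj.len
      · exact (F₁ ⟨a, by omega⟩).trans_le ((H₁.2.1 (by exact hab)).trans (F₁ ⟨b, by omega⟩).ge)
      · by_cases ha : a ≤ V₁.obj.len
        · refine (F₁ ⟨a, by omega⟩).trans_le ((H₁.le_top _).trans ?_)
          exact (Nat.le_add_right _ _).trans (F₃ hb).ge
        · refine (F₃ ha).trans_le (le_trans ?_ (F₃ hb).ge)
          exact Nat.add_le_add_left (H₂.2.1 (Fin.mk_le_mk.2 (by omega))) _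
    refine ⟨⟨fun i ↦ F i, fun _ _ hab ↦ hF hab, (F₁ 0).trans H₁.2.2⟩, Prod.ext ?_ ?_⟩
    · refine Subtype.ext (funext fun i ↦ ?_)
      change F _ - F _ = _
      rw [h.f_apply, h.f_apply, F₁, F₁, H₁.2.2, Nat.sub_zero]
    · refine Subtype.ext (funext fun i ↦ ?_)
      change F _ - F _ = _
      rw [h.g_apply, h.g_apply, F₂, F₂]
      exact (congrArg (fun k ↦ H₁.top + H₂.1 i - (H₁.top + k)) H₂.2.2).trans
        (Nat.add_sub_cancel_left ..)

/-- Disjoint unions of commutative squares over a fixed vertex: if the indices of the total union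
are the pairs of indices of the two sides, the comparison with the homotopy pullback can be checked
on summands. -/
theorem isHomotopyEquiv_ofComm_sigma_iff {S S₁ S₂ : Type} {N : S → SSet.{u}} {K₁ : S₁ → SSet.{u}}
    {K₂ : S₂ → SSet.{u}} {M M' : SSet.{u}} [SSet.KanComplex M] [SSet.KanComplex M']
    [SSet.KanComplex (sigmaSet N)] [SSet.KanComplex (sigmaSet K₁)] [SSet.KanComplex (sigmaSet K₂)]
    {b₁ : sigmaSet K₁ ⟶ M'} {b₂ : sigmaSet K₂ ⟶ M'} {v : M' ⟶ M} [IsIso v]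
    {a₁ : ∀ s, K₁ s ⟶ M} {a₂ : ∀ s, K₂ s ⟶ M}
    (w₁ : b₁ ≫ v = sigmaDesc a₁) (w₂ : b₂ ≫ v = sigmaDesc a₂) {r₁ : S → S₁} {r₂ : S → S₂}
    (hr : Function.Bijective fun s ↦ (r₁ s, r₂ s)) (x : ∀ s, N s ⟶ K₁ (r₁ s))
    (y : ∀ s, N s ⟶ K₂ (r₂ s)) (w : ∀ s, x s ≫ a₁ (r₁ s) = y s ≫ a₂ (r₂ s))
    (w' : sigmaDesc (fun s ↦ x s ≫ sigmaι K₁ (r₁ s)) ≫ b₁ =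
      sigmaDesc (fun s ↦ y s ≫ sigmaι K₂ (r₂ s)) ≫ b₂) :
    IsHomotopyEquiv (hoPullback.ofComm b₁ b₂ _ _ w') ↔
      ∀ s, IsHomotopyEquiv (hoPullback.ofComm (a₁ (r₁ s)) (a₂ (r₂ s)) (x s) (y s) (w s)) := by
  have hm := hoPullback.map_isHomotopyEquiv (w₁.trans (Category.id_comp _).symm)
    (w₂.trans (Category.id_comp _).symm) (isHomotopyEquiv_of_isIso (𝟙 (sigmaSet K₁)))
    (isHomotopyEquiv_of_isIso (𝟙 (sigmaSet K₂))) (isHomotopyEquiv_of_isIso v)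
  have := isIso_sigmaPullback a₁ a₂ r₁ r₂ hr
  have e : sigmaMap (L := fun s ↦ hoPullback (a₁ (r₁ s)) (a₂ (r₂ s)))
      (fun s ↦ hoPullback.ofComm (a₁ (r₁ s)) (a₂ (r₂ s)) (x s) (y s) (w s)) ≫
        sigmaPullback a₁ a₂ r₁ r₂ = hoPullback.ofComm b₁ b₂ _ _ w' ≫
          hoPullback.map (𝟙 _) (𝟙 _) v (w₁.trans (Category.id_comp _).symm)
            (w₂.trans (Category.id_comp _).symm) := by
    rw [hoPullback.ofComm_map]
    refine sigmaSet_hom_ext fun s ↦ ?_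
    rw [hoPullback.comp_ofComm]
    have e₁ : sigmaι N s ≫ sigmaMap (L := fun s ↦ hoPullback (a₁ (r₁ s)) (a₂ (r₂ s)))
        (fun s ↦ hoPullback.ofComm (a₁ (r₁ s)) (a₂ (r₂ s)) (x s) (y s) (w s)) =
          hoPullback.ofComm (a₁ (r₁ s)) (a₂ (r₂ s)) (x s) (y s) (w s) ≫
            sigmaι (fun s ↦ hoPullback (a₁ (r₁ s)) (a₂ (r₂ s))) s := rfl
    rw [← Category.assoc, e₁, Category.assoc, sigmaPullback, sigmaι_desc]
    refine (hoPullback.ofComm_map (f := a₁ (r₁ s)) (g := a₂ (r₂ s)) (f' := sigmaDesc a₁)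
      (g' := sigmaDesc a₂) (sigmaι K₁ (r₁ s)) (sigmaι K₂ (r₂ s)) (𝟙 M) (Category.comp_id _)
      (Category.comp_id _) (x s) (y s) (w s)).trans ?_
    congr 1
  rw [← isHomotopyEquiv_comp_iff_right hm, ← e, isHomotopyEquiv_comp_isIso_iff,
    isHomotopyEquiv_sigmaMap_iff]

variable (A : SpacePresheaf.{u} InertCat)

theorem map_hom_id (V : InertCat) : (A.map (𝟙 V).op).hom = 𝟙 _ := by
  rw [op_id, CategoryTheory.Functor.map_id]
  rfl

/-- The map from the value of the left adjoint to the value of the presheaf at `[0]`: on the summand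
of an active map, restriction to the first vertex of its target. -/
def freeVertex (V₀ : InertCat) : sigmaSet (freeSummand A V₀.obj) ⟶ (A.obj (op ⟨⦋0⦌⟩)).obj :=
  sigmaDesc fun h ↦ (A.map (inertMk ⟨⦋0⦌⟩ h.target 0 (Nat.zero_le _)).op).hom

/-- The only active map out of `[0]` is the identity. -/
theorem isIso_freeVertex (h₀ : V₀.obj.len = 0) : IsIso (freeVertex A V₀) := by
  obtain ⟨n₀, rfl⟩ : ∃ n, V₀ = ⟨⦋n⦌⟩ := ⟨V₀.obj.len, rfl⟩
  obtain rfl : n₀ = 0 := h₀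
  refine ⟨freeι A ⦋0⦌ (Act.id ⦋0⦌), sigmaSet_hom_ext fun h ↦ ?_, ?_⟩
  · have e : h = Act.id ⦋0⦌ := by
      refine Subtype.ext (funext fun i ↦ ?_)
      obtain rfl : i = 0 := Subsingleton.elim (α := Fin 1) _ _
      exact h.2.2
    refine (map_sigmaι_congr A e (𝟙 _) (inertMk ⟨⦋0⦌⟩ h.target 0 (Nat.zero_le _)) rfl).symm.trans ?_
    rw [map_hom_id]
    rfl
  · have : inertMk ⟨⦋0⦌⟩ (Act.id ⦋0⦌).target 0 (Nat.zero_le _) = 𝟙 _ := inert_hom_ext rfl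
    exact (congrArg (fun k ↦ (A.map k.op).hom) this).trans (map_hom_id A _)

/-- The restriction of the left adjoint along an inert map. -/
abbrev freeRes {V W : InertCat} (a : V ⟶ W) :
    sigmaSet (freeSummand A W.obj) ⟶ sigmaSet (freeSummand A V.obj) :=
  sigmaDesc fun h ↦ (A.map (Act.inertPart a.hom h).op).hom ≫ freeι A V.obj (Act.pull a.hom h)

/-- The comparison map of the left adjoint at a concatenation is the disjoint union, over all active
maps out of the concatenation, of the comparison maps of the presheaf at the targets. -/
theorem isHomotopyEquiv_cutMap_freeObj_iff (h : IsCut p q f g) :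
    IsHomotopyEquiv (cutMap ((restriction inertInclusion).obj (freeObj A)) h) ↔
      ∀ H : Act V.obj, IsHomotopyEquiv (cutMap A (h.act H)) := by
  have kan (V : InertCat) : SSet.KanComplex (A.obj (op V)).obj := (A.obj (op V)).property
  have kan' (V : InertCat) : SSet.KanComplex (sigmaSet (freeSummand A V.obj)) :=
    sigmaSet_kanComplex fun h ↦ kan h.target
  have := kan' V₀
  have := kan' V₁
  have := kan' V₂
  have := isIso_freeVertex A h.len_zero
  have w₁ : freeRes A p ≫ freeVertex A V₀ = sigmaDesc fun h₁ : Act V₁.obj ↦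
      (A.map (inertMk ⟨⦋0⦌⟩ h₁.target h₁.top (le_refl _)).op).hom := by
    refine sigmaSet_hom_ext fun h₁ ↦ ?_
    have e : inertMk ⟨⦋0⦌⟩ (Act.pull p.hom h₁).target 0 (Nat.zero_le _) ≫ Act.inertPart p.hom h₁ =
        inertMk ⟨⦋0⦌⟩ h₁.target h₁.top (le_refl _) := by
      apply inert_hom_ext
      rw [shift_comp]
      exact (Nat.zero_add _).trans (congrArg h₁.1 (Fin.ext h.shift_p))
    exact (map_hom_comp_hom A _ _).trans
      (congrArg (fun k : (⟨⦋0⦌⟩ : InertCat) ⟶ h₁.target ↦ (A.map k.op).hom) e)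
  have w₂ : freeRes A q ≫ freeVertex A V₀ = sigmaDesc fun h₂ : Act V₂.obj ↦
      (A.map (inertMk ⟨⦋0⦌⟩ h₂.target 0 (Nat.zero_le _)).op).hom := by
    refine sigmaSet_hom_ext fun h₂ ↦ ?_
    have e : inertMk ⟨⦋0⦌⟩ (Act.pull q.hom h₂).target 0 (Nat.zero_le _) ≫ Act.inertPart q.hom h₂ =
        inertMk ⟨⦋0⦌⟩ h₂.target 0 (Nat.zero_le _) := by
      apply inert_hom_ext
      rw [shift_comp]
      exact (Nat.zero_add _).trans ((congrArg h₂.1 (Fin.ext h.shift_q)).trans h₂.2.2)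
    exact (map_hom_comp_hom A _ _).trans
      (congrArg (fun k : (⟨⦋0⦌⟩ : InertCat) ⟶ h₂.target ↦ (A.map k.op).hom) e)
  have := kan' V
  exact isHomotopyEquiv_ofComm_sigma_iff w₁ w₂ h.bijective_pull
    (fun H ↦ (A.map (Act.inertPart f.hom H).op).hom)
    (fun H ↦ (A.map (Act.inertPart g.hom H).op).hom) _ _

theorem CutLocal.edgeLocal_freeObj {A : SpacePresheaf.{u} InertCat} (hA : CutLocal A) :
    EdgeLocal ((restriction inertInclusion).obj (freeObj A)) :=
  fun _ _ _ _ _ _ _ _ h _ _ ↦ (isHomotopyEquiv_cutMap_freeObj_iff A h).2 fun _ ↦ hA _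

/-- The presheaf is the summand of the identities in the restriction of its left adjoint. -/
theorem EdgeLocal.of_freeObj {A : SpacePresheaf.{u} InertCat}
    (hA : EdgeLocal ((restriction inertInclusion).obj (freeObj A))) : EdgeLocal A := by
  intro V₀ V₁ V₂ V p q f g h h₁ h₂
  refine (isHomotopyEquiv_cutMap_iff_of_length h (h.act (Act.id V.obj)) ?_ ?_).2
    ((isHomotopyEquiv_cutMap_freeObj_iff A h).1 (hA h h₁ h₂) _)
  · rw [Act.pull_inert]
    rfl
  · rw [Act.pull_inert]
    rfl

end FreeCut

end FreeDecomposition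

end

theorem mainTheorem7 (A : FreeDecomposition.SpacePresheaf.{u} FreeDecomposition.InertCat) :
    (∃ X : FreeDecomposition.SpacePresheaf.{u} SimplexCategory,
      FreeDecomposition.IsHomotopyLeftKanExtension FreeDecomposition.inertInclusion A X) ∧
    ∀ X : FreeDecomposition.SpacePresheaf.{u} SimplexCategory,
      FreeDecomposition.IsHomotopyLeftKanExtension FreeDecomposition.inertInclusion A X →
        (FreeDecomposition.IsSegal X ↔
          FreeDecomposition.IsSpaceSheaf FreeDecomposition.inertTopology A) ∧
        (FreeDecomposition.IsSpaceSheaf FreeDecomposition.inertTopology A ↔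
          FreeDecomposition.IsSpaceSheaf FreeDecomposition.inertTopology
            ((FreeDecomposition.restriction FreeDecomposition.inertInclusion).obj X)) := by
  refine ⟨⟨FreeDecomposition.freeObj A, FreeDecomposition.isHomotopyLeftKanExtension_free A⟩,
    fun X hX ↦ ?_⟩
  obtain ⟨e⟩ := hX.nonempty_iso (FreeDecomposition.isHomotopyLeftKanExtension_free A)
  have key : FreeDecomposition.IsSpaceSheaf FreeDecomposition.inertTopology A ↔
      FreeDecomposition.EdgeLocal
        ((FreeDecomposition.restriction FreeDecomposition.inertInclusion).obj X) := by
    rw [FreeDecomposition.edgeLocal_restriction_iff_of_iso e]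
    exact ⟨fun h ↦ (FreeDecomposition.cutLocal_of_isSpaceSheaf h).edgeLocal_freeObj,
      fun h ↦ h.of_freeObj.isSpaceSheaf⟩
  exact ⟨(FreeDecomposition.isSegal_iff_edgeLocal X).trans key.symm,
    key.trans FreeDecomposition.isSpaceSheaf_iff_edgeLocal.symm⟩
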